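/- For $u\in L^4(\mathbb R)$, $u\not\equiv0$, with distributional second derivative $u''\in L^2(\mathbb R)$, let $$Q_{\mathbb R}(u)=\frac{\int_{\mathbb R}(u'')^2\,dx-\int_{\mathbb R}u''u^2\,dx}{\int_{\mathbb R}u^4\,dx},$$ and let $I\in\mathbb R$ be the infimum of $Q_{\mathbb R}(u)$ over all such $u$. For $T>0$, let $\mathcal A_T$ be the set of all $u\not\equiv 0$ with $u\in L^4_{\rm loc}(\mathbb R)$, $u''\in L^2_{\rm loc}(\mathbb R)$ and $u(\cdot+2T)=u$, and for $u\in\mathcal A_T$ let $$Q_T(u)=\frac{\int_{-T}^{T}(u'')^2\,dx-\int_{-T}^{T}u''u^2\,dx}{\int_{-T}^{T}u^4\,dx}.$$ **Proposition (existence of a minimizer for the periodic case).** For every $T>0$ there exists a $2T$-periodic function $u\in C^\infty(\mathbb R)$, $u\not\equiv0$, such that $Q_T(u)=I$. Moreover, there is at least one such function $u$ that minimizes $Q_T$ over $\mathcal A_T$ and has the following properties: $u$ attains its absolute maximum over $\mathbb R$ at $0$, $u(0)>0$, $u'(0)=u'(T)=0$, $u$ is even and strictly decreasing on $(0,T)$,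 $u$ takes both positive and negative values in $(0,T)$, and on $\mathbb R$ it solves $$u''''-2\,u''\,u-(u')^2=2\,I\,|u|^2u .$$ -/

import Mathlib

open MeasureTheory Set
open scoped ContDiff

/-- `w` is the second derivative of `u` on the real line in the sense of distributions. -/
def HasWeakSecondDeriv (u w : ℝ → ℝ) : Prop :=
  LocallyIntegrable u volume ∧ LocallyIntegrable w volume ∧
    ∀ φ : ℝ → ℝ, ContDiff ℝ ∞ φ → HasCompactSupport φ →
      ∫ x, u x * iteratedDeriv 2 φ x = ∫ x, w x * φ x

/-- Local `L^p` integrability on the real line. -/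
def LocMemLp (u : ℝ → ℝ) (p : ENNReal) : Prop :=
  ∀ K : Set ℝ, IsCompact K → MemLp u p (volume.restrict K)

/-- The quotient `Q_J(u)` over a set `J`, for a function `u` with second derivative `w`. -/
noncomputable def quotientQ (J : Set ℝ) (u w : ℝ → ℝ) : ℝ :=
  ((∫ x in J, w x ^ 2) - ∫ x in J, w x * u x ^ 2) / ∫ x in J, u x ^ 4

/-- The admissible functions for the problem on the whole line: `u ∈ L⁴(ℝ)` is not
(almost everywhere) zero, and its weak second derivative `w` is in `L²(ℝ)`. -/
def LineAdmissible (u w : ℝ → ℝ) : Prop :=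
  MemLp u 4 volume ∧ MemLp w 2 volume ∧ HasWeakSecondDeriv u w ∧ ¬ u =ᵐ[volume] 0

/-- The values of `Q_ℝ` on the admissible functions. -/
def lineValues : Set ℝ :=
  {q | ∃ u w : ℝ → ℝ, LineAdmissible u w ∧ q = quotientQ univ u w}

/-- The infimum `I` of `Q_ℝ`. -/
noncomputable def infimumI : ℝ := sInf lineValues

/-- The admissible functions for the `2T`-periodic problem: `u ∈ L⁴_loc` is not (almost
everywhere) zero and `2T`-periodic, and its weak second derivative `w` is in `L²_loc`. -/
def PeriodicAdmissible (T : ℝ) (u w : ℝ → ℝ) : Prop :=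
  LocMemLp u 4 ∧ LocMemLp w 2 ∧ HasWeakSecondDeriv u w ∧
    (fun x => u (x + 2 * T)) =ᵐ[volume] u ∧ ¬ u =ᵐ[volume] 0

/-- `u`, with second derivative `w`, minimizes `Q_T` among all admissible `2T`-periodic
functions. -/
def IsPeriodicMinimizer (T : ℝ) (u w : ℝ → ℝ) : Prop :=
  PeriodicAdmissible T u w ∧
    ∀ v z : ℝ → ℝ, PeriodicAdmissible T v z →
      quotientQ (Ico (-T) T) u w ≤ quotientQ (Ico (-T) T) v z

/-- A `C²` function has its classical second derivative as weak second derivative. -/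
theorem hasWeakSecondDeriv_of_contDiff {u : ℝ → ℝ} (hu : ContDiff ℝ 2 u) :
    HasWeakSecondDeriv u (iteratedDeriv 2 u) := by
  have hu1 : ContDiff ℝ 1 (deriv u) := by
    simpa using hu.iterate_deriv' 1 1
  have hu2 : Continuous (deriv (deriv u)) := by
    simpa using (hu1.iterate_deriv' 0 1).continuous
  have e : ∀ f : ℝ → ℝ, iteratedDeriv 2 f = deriv (deriv f) := by
    intro f; simp [iteratedDeriv_succ, iteratedDeriv_zero]
  refine ⟨hu.continuous.locallyIntegrable, ?_, ?_⟩
  · rw [e]; exact hu2.locallyIntegrable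
  · intro φ hφ hc
    rw [e, e]
    have hφ' : ContDiff ℝ 2 φ := contDiff_infty.1 hφ 2
    have hφ1 : ContDiff ℝ 1 (deriv φ) := by
      simpa using hφ'.iterate_deriv' 1 1
    have hφ2 : Continuous (deriv (deriv φ)) := by
      simpa using (hφ1.iterate_deriv' 0 1).continuous
    have key := integral_mul_deriv_eq_deriv_mul_of_integrable (u := u) (v := deriv φ)
      (u' := deriv u) (v' := deriv (deriv φ))
      (fun x _ => (hu.differentiable (by norm_num) x).hasDerivAt)
      (fun x _ => (hφ1.differentiable (by norm_num) x).hasDerivAt)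
      ((hu.continuous.mul hφ2).integrable_of_hasCompactSupport hc.deriv.deriv.mul_left)
      ((hu1.continuous.mul hφ1.continuous).integrable_of_hasCompactSupport hc.deriv.mul_left)
      ((hu.continuous.mul hφ1.continuous).integrable_of_hasCompactSupport hc.deriv.mul_left)
    have key2 := integral_mul_deriv_eq_deriv_mul_of_integrable (u := deriv u) (v := φ)
      (u' := deriv (deriv u)) (v' := deriv φ)
      (fun x _ => (hu1.differentiable (by norm_num) x).hasDerivAt)
      (fun x _ => (hφ'.differentiable (by norm_num) x).hasDerivAt)
      ((hu1.continuous.mul hφ1.continuous).integrable_of_hasCompactSupport hc.deriv.mul_left)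
      ((hu2.mul hφ'.continuous).integrable_of_hasCompactSupport hc.mul_left)
      ((hu1.continuous.mul hφ'.continuous).integrable_of_hasCompactSupport hc.mul_left)
    rw [key, key2, neg_neg]

/-- The set of values of `Q_ℝ` is nonempty. -/
theorem lineValues_nonempty : lineValues.Nonempty := by
  let f : ContDiffBump (0 : ℝ) := ⟨1, 2, by norm_num, by norm_num⟩
  have hf : ContDiff ℝ 2 (f : ℝ → ℝ) := f.contDiff
  have hc : HasCompactSupport (f : ℝ → ℝ) := f.hasCompactSupport
  have e : iteratedDeriv 2 (f : ℝ → ℝ) = deriv (deriv f) := by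
    simp [iteratedDeriv_succ, iteratedDeriv_zero]
  have h2 : Continuous (iteratedDeriv 2 (f : ℝ → ℝ)) := hf.continuous_iteratedDeriv 2 le_rfl
  refine ⟨_, f, iteratedDeriv 2 f, ⟨hf.continuous.memLp_of_hasCompactSupport hc,
    h2.memLp_of_hasCompactSupport (e ▸ hc.deriv.deriv),
    hasWeakSecondDeriv_of_contDiff hf, ?_⟩, rfl⟩
  intro h
  have h0 : (f : ℝ → ℝ) = 0 := (hf.continuous.ae_eq_iff_eq volume continuous_const).1 h
  have h1 : f 0 = 1 := f.one_of_mem_closedBall (x := 0) (by simp [f])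
  rw [h0] at h1
  simp at h1

/-- The set of values of `Q_ℝ` is bounded below. -/
theorem lineValues_bddBelow : BddBelow lineValues := by
  refine ⟨-1 / 4, ?_⟩
  rintro q ⟨u, w, ⟨hu, hw, -, -⟩, rfl⟩
  have i4 : Integrable (fun x => u x ^ 4) := by
    have := hu.integrable_norm_pow (p := 4) (by norm_num)
    refine this.congr (Filter.Eventually.of_forall fun x => ?_)
    simp [Even.pow_abs (show Even 4 by decide)]
  have i2 : Integrable (fun x => w x ^ 2) := hw.integrable_sq
  have i3 : Integrable (fun x => w x * u x ^ 2) := by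
    refine (i2.add i4).mono' (hw.1.mul (hu.1.pow 2)) (Filter.Eventually.of_forall fun x => ?_)
    rw [Real.norm_eq_abs, abs_le]
    constructor
    · simp only [Pi.add_apply]
      nlinarith [sq_nonneg (w x + u x ^ 2), sq_nonneg (w x), sq_nonneg (u x ^ 2)]
    · simp only [Pi.add_apply]
      nlinarith [sq_nonneg (w x - u x ^ 2), sq_nonneg (w x), sq_nonneg (u x ^ 2)]
  have hn : 0 ≤ ∫ x, u x ^ 4 := integral_nonneg fun x => by positivity
  unfold quotientQ
  simp only [Measure.restrict_univ]
  rcases hn.eq_or_lt with h | h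
  · rw [← h]; norm_num
  · rw [le_div_iff₀ h, ← integral_sub i2 i3, ← integral_const_mul]
    refine integral_mono (i4.const_mul _) (i2.sub i3) fun x => ?_
    simp only
    nlinarith [sq_nonneg (w x - u x ^ 2 / 2)]

/-- `infimumI` is the greatest lower bound of the values of `Q_ℝ`. -/
theorem isGLB_infimumI : IsGLB lineValues infimumI :=
  isGLB_csInf lineValues_nonempty lineValues_bddBelow

/-! Write N = ∫ (u'')² - ∫ u''u² and D = ∫ u⁴ on an interval (`num`, `den`). Under u ↦ s² u(s · + c)
both acquire the factor s⁷, so the infimum m of N/D among functions with u' = 0 at both ends is the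
same for every interval. Completing a square gives m ≥ -1/4, and an explicit polynomial gives m < 0.
The inequality N ≥ mD (`NeumannBound m`) is additive over intervals split at critical points of u,
and this additivity drives the whole argument.

The constant m equals I. On the line, finite energy forces u and u' to vanish at infinity, so u has
a critical point and can be made Neumann far away at small cost (`NeumannBound.line`). A periodic
function has a critical point by Rolle, so the bound applies to one full period
(`NeumannBound.le_quotientQ`). Conversely, cutting off n periods of a periodic function with
quotient m produces an error independent of n, while N and D grow linearly in n
(`infimumI_le_of_periodic`).

The heart is that m is attained on some interval (`exists_minimizer`). Scale invariance destroys
compactness, so almost minimizers are first replaced by monotone pieces: minimizing under a cap on D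
yields a function all of whose pieces between critical points compete with it, hence one piece is at
least as good (`exists_increasing_piece`). An increasing piece is rescaled to start at height -1,
and then ∫ (u'')², D and the reciprocal of the length L are bounded (`normalized_bounds`). If the
lengths stay bounded along a subsequence, the limit is a minimizer. If they tend to infinity, the
limit lives on a half line and has no excess N - mD asymptotically. Either its derivative vanishes
at some x > 0, and [0, x] carries a minimizer, or it is an increasing nonpositive solution of the
Euler–Lagrange equation tending to zero, which conservation of energy excludes
(`no_half_line_solution`).

A minimizer restricted to the interval between consecutive critical points, rescaled, possibly
reversed, and extended evenly and periodically satisfies the Euler–Lagrange equation on the line and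
is smooth. A Pohozaev-type identity shows that its energy is zero (`energy_eq_zero`), and a monotone
quantity available at zero energy gives u(0) > 0 (`pos_of_energy_eq_zero`). It takes negative values
because N = ∫ (u'')² + 2 ∫ u (u')² is negative. -/

/-! ### Twice weakly differentiable functions and their affine changes of variable -/

/-- `u` is twice weakly differentiable on the line: `u` is `C¹` with derivative `p`, and `p` is a
primitive of the locally square integrable function `w`. -/
structure IsH2 (u p w : ℝ → ℝ) : Prop where
  meas : AEStronglyMeasurable w volume
  sq : ∀ a b, IntervalIntegrable (fun x => w x ^ 2) volume a b
  der : ∀ a b, p b - p a = ∫ x in a..b, w x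
  hasDeriv : ∀ x, HasDerivAt u (p x) x

theorem intervalIntegrable_of_sq {w : ℝ → ℝ} (hm : AEStronglyMeasurable w volume) {a b : ℝ}
    (hs : IntervalIntegrable (fun x => w x ^ 2) volume a b) : IntervalIntegrable w volume a b := by
  refine ((intervalIntegrable_const (c := (1 : ℝ))).add hs).mono_fun hm.restrict
    (Filter.Eventually.of_forall fun x => ?_)
  simp only [Real.norm_eq_abs]
  rw [abs_of_nonneg (by positivity : 0 ≤ 1 + w x ^ 2)]
  rw [abs_le]; constructor <;> nlinarith [sq_nonneg (w x + 1), sq_nonneg (w x - 1)]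

theorem hasDerivAt_primitive {f : ℝ → ℝ} (hf : Continuous f) (a x : ℝ) :
    HasDerivAt (fun y => ∫ t in a..y, f t) (f x) x :=
  intervalIntegral.integral_hasDerivAt_right (hf.intervalIntegrable _ _)
    hf.stronglyMeasurable.stronglyMeasurableAtFilter hf.continuousAt

/-- Integration by parts for primitives of locally integrable functions. -/
theorem integral_mul_primitive_parts {f f' g g' : ℝ → ℝ}
    (hf' : ∀ a b, IntervalIntegrable f' volume a b) (hf : ∀ a b, f b - f a = ∫ x in a..b, f' x)
    (hg' : ∀ a b, IntervalIntegrable g' volume a b) (hg : ∀ a b, g b - g a = ∫ x in a..b, g' x)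
    (a b : ℝ) :
    ∫ x in a..b, f x * g' x = f b * g b - f a * g a - ∫ x in a..b, f' x * g x := by
  -- The rule for absolutely continuous functions is phrased with `deriv`; Lebesgue differentiation
  -- identifies `deriv h` with `h'` almost everywhere.
  have key : ∀ h h' : ℝ → ℝ, (∀ a b, IntervalIntegrable h' volume a b) →
      (∀ a b, h b - h a = ∫ x in a..b, h' x) →
      AbsolutelyContinuousOnInterval h a b ∧ ∀ᵐ x, deriv h x = h' x := by
    intro h h' hi hh
    have e : h = fun x => h a + ∫ t in a..x, h' t := by
      ext x; rw [← hh a x]; ring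
    refine ⟨?_, ?_⟩
    · have h1 := (hi a b).absolutelyContinuousOnInterval_intervalIntegral (c := a) (by simp)
      have h2 : AbsolutelyContinuousOnInterval (fun _ : ℝ => h a) a b :=
        (contDiff_const (n := 1)).contDiffOn.absolutelyContinuousOnInterval
      rw [e]; exact h2.fun_add h1
    · have hl : LocallyIntegrable h' volume := by
        intro x
        refine ⟨Icc (x - 1) (x + 1), Icc_mem_nhds (by linarith) (by linarith), ?_⟩
        rw [integrableOn_Icc_iff_integrableOn_Ioc]
        exact (intervalIntegrable_iff_integrableOn_Ioc_of_le (by linarith)).1 (hi _ _)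
      filter_upwards [LocallyIntegrable.ae_hasDerivAt_integral hl] with x hx
      rw [e]
      exact ((hx a).const_add (h a)).deriv
  obtain ⟨f1, f2⟩ := key f f' hf' hf
  obtain ⟨g1, g2⟩ := key g g' hg' hg
  have := f1.integral_mul_deriv_eq_deriv_mul g1
  rw [intervalIntegral.integral_congr_ae (g := fun x => f x * g' x) (by
      filter_upwards [g2] with x hx _; rw [hx]),
    intervalIntegral.integral_congr_ae (f := fun x => deriv f x * g x)
      (g := fun x => f' x * g x) (by filter_upwards [f2] with x hx _; rw [hx])] at this
  exact this

namespace IsH2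

variable {u p w : ℝ → ℝ}

theorem w_int (h : IsH2 u p w) (a b : ℝ) : IntervalIntegrable w volume a b :=
  intervalIntegrable_of_sq h.meas (h.sq a b)

theorem p_cont (h : IsH2 u p w) : Continuous p := by
  have e : p = fun x => p 0 + ∫ t in (0 : ℝ)..x, w t := by
    ext x; rw [← h.der 0 x]; ring
  rw [e]
  exact continuous_const.add (intervalIntegral.continuous_primitive (fun a b => h.w_int a b) 0)

theorem u_cont (h : IsH2 u p w) : Continuous u :=
  continuous_iff_continuousAt.2 fun x => (h.hasDeriv x).continuousAt

theorem u_sub (h : IsH2 u p w) (a b : ℝ) : u b - u a = ∫ x in a..b, p x :=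
  (intervalIntegral.integral_eq_sub_of_hasDerivAt (fun x _ => h.hasDeriv x)
    (h.p_cont.intervalIntegrable _ _)).symm

theorem w_mul_int (h : IsH2 u p w) {f : ℝ → ℝ} (hf : Continuous f) (a b : ℝ) :
    IntervalIntegrable (fun x => w x * f x) volume a b :=
  (h.w_int a b).mul_continuousOn hf.continuousOn

theorem mk_of {w : ℝ → ℝ} (hm : AEStronglyMeasurable w volume)
    (hs : ∀ a b, IntervalIntegrable (fun x => w x ^ 2) volume a b) (x₀ c d : ℝ) :
    IsH2 (fun x => c + ∫ t in x₀..x, (d + ∫ s in x₀..t, w s)) (fun x => d + ∫ s in x₀..x, w s) w := by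
  have hi := fun a b => intervalIntegrable_of_sq hm (hs a b)
  have hc : Continuous fun x => d + ∫ s in x₀..x, w s :=
    continuous_const.add (intervalIntegral.continuous_primitive hi x₀)
  refine ⟨hm, hs, fun a b => ?_, fun x => (hasDerivAt_primitive hc x₀ x).const_add c⟩
  rw [add_sub_add_left_eq_sub, intervalIntegral.integral_interval_sub_left (hi _ _) (hi _ _)]

theorem add {v q z : ℝ → ℝ} (h : IsH2 u p w) (k : IsH2 v q z) :
    IsH2 (fun x => u x + v x) (fun x => p x + q x) (fun x => w x + z x) := by
  refine ⟨h.meas.add k.meas, fun a b => ?_, fun a b => ?_, fun x => (h.hasDeriv x).add (k.hasDeriv x)⟩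
  · refine (((h.sq a b).add (k.sq a b)).const_mul 2).mono_fun ((h.meas.add k.meas).pow 2).restrict
      (Filter.Eventually.of_forall fun x => ?_)
    simp only [Real.norm_eq_abs]
    rw [abs_of_nonneg (by positivity), abs_of_nonneg (by positivity)]
    nlinarith [sq_nonneg (w x - z x)]
  · rw [intervalIntegral.integral_add (h.w_int a b) (k.w_int a b), ← h.der, ← k.der]; ring

theorem smul (h : IsH2 u p w) (r : ℝ) :
    IsH2 (fun x => r * u x) (fun x => r * p x) (fun x => r * w x) := by
  refine ⟨h.meas.const_mul r, fun a b => ?_, fun a b => ?_, fun x => (h.hasDeriv x).const_mul r⟩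
  · simp only [mul_pow]; exact (h.sq a b).const_mul _
  · rw [intervalIntegral.integral_const_mul, ← h.der]; ring

/-- Negative `s` is admitted on purpose: it provides reflections and turns increasing pieces into
decreasing ones. -/
theorem comp_affine (h : IsH2 u p w) {s : ℝ} (hs : s ≠ 0) (c : ℝ) :
    IsH2 (fun x => u (s * x + c)) (fun x => s * p (s * x + c))
      (fun x => s ^ 2 * w (s * x + c)) := by
  have hq : Measure.QuasiMeasurePreserving (fun x : ℝ => s * x + c) volume volume := by
    refine ⟨by fun_prop, ?_⟩
    have : (fun x : ℝ => s * x + c) = (fun x => x + c) ∘ fun x => s * x := rfl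
    rw [this, ← Measure.map_map (by fun_prop) (by fun_prop), Real.map_volume_mul_left hs,
      Measure.map_smul, (measurePreserving_add_right volume c).map_eq]
    exact Measure.smul_absolutelyContinuous
  refine ⟨(h.meas.comp_quasiMeasurePreserving hq).const_mul (s ^ 2), fun a b => ?_, fun a b => ?_,
    fun x => ?_⟩
  · simp only [mul_pow]
    have h1 := (h.sq (s * a + c) (s * b + c)).comp_add_right c
    simp only [add_sub_cancel_right] at h1
    have h2 := h1.comp_mul_left (c := s)
    rw [mul_div_cancel_left₀ _ hs, mul_div_cancel_left₀ _ hs] at h2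
    exact h2.const_mul _
  · rw [intervalIntegral.integral_const_mul, intervalIntegral.integral_comp_mul_add _ hs,
      ← h.der, smul_eq_mul]
    field_simp
  · have := (h.hasDeriv (s * x + c)).comp x (((hasDerivAt_id x).const_mul s).add_const c)
    convert! this using 1
    simp [mul_comm]

theorem of_contDiff (hu : ContDiff ℝ 2 u) : IsH2 u (deriv u) (iteratedDeriv 2 u) := by
  have hw : Continuous (iteratedDeriv 2 u) := hu.continuous_iteratedDeriv 2 le_rfl
  have hu1 : ContDiff ℝ 1 (deriv u) := by simpa using hu.iterate_deriv' 1 1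
  have e : iteratedDeriv 2 u = deriv (deriv u) := by
    simp [iteratedDeriv_succ, iteratedDeriv_zero]
  refine ⟨hw.aestronglyMeasurable, fun a b => (hw.pow 2).intervalIntegrable _ _, fun a b => ?_,
    fun x => (hu.differentiable (by norm_num) x).hasDerivAt⟩
  refine (intervalIntegral.integral_eq_sub_of_hasDerivAt (fun x _ => ?_)
    (hw.intervalIntegrable _ _)).symm
  rw [e]
  exact (hu1.differentiable (by norm_num) x).hasDerivAt

end IsH2

/-! ### Numerator, denominator, scale invariance and the Neumann bound -/

/-- The numerator of the quotient on `[a, b]`. -/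
noncomputable def num (a b : ℝ) (u w : ℝ → ℝ) : ℝ :=
  (∫ x in a..b, w x ^ 2) - ∫ x in a..b, w x * u x ^ 2

/-- The denominator of the quotient on `[a, b]`. -/
noncomputable def den (a b : ℝ) (u : ℝ → ℝ) : ℝ := ∫ x in a..b, u x ^ 4

/-- Each integrand is homogeneous of degree 8 in `s`, and the change of variables costs one power.
The denominator has the same factor, so the quotient is invariant; for negative `s` the odd power
matches the reversed orientation of the interval. -/
theorem num_affine (a b : ℝ) (u w : ℝ → ℝ) {s : ℝ} (hs : s ≠ 0) (c : ℝ) :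
    num a b (fun x => s ^ 2 * u (s * x + c)) (fun x => s ^ 2 * (s ^ 2 * w (s * x + c))) =
      s ^ 7 * num (s * a + c) (s * b + c) u w := by
  unfold num
  have e1 : ∀ x, (s ^ 2 * (s ^ 2 * w (s * x + c))) ^ 2 = s ^ 8 * (fun y => w y ^ 2) (s * x + c) :=
    fun x => by ring
  have e2 : ∀ x, (s ^ 2 * (s ^ 2 * w (s * x + c))) * (s ^ 2 * u (s * x + c)) ^ 2 =
    s ^ 8 * (fun y => w y * u y ^ 2) (s * x + c) := fun x => by ring
  have i1 := intervalIntegral.integral_comp_mul_add (a := a) (b := b) (fun y => w y ^ 2) hs c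
  have i2 := intervalIntegral.integral_comp_mul_add (a := a) (b := b)
    (fun y => w y * u y ^ 2) hs c
  simp only [e1, e2, intervalIntegral.integral_const_mul]
  simp only [smul_eq_mul] at i1 i2
  rw [i1, i2]
  field_simp

theorem den_affine (a b : ℝ) (u : ℝ → ℝ) {s : ℝ} (hs : s ≠ 0) (c : ℝ) :
    den a b (fun x => s ^ 2 * u (s * x + c)) = s ^ 7 * den (s * a + c) (s * b + c) u := by
  unfold den
  have e1 : ∀ x, (s ^ 2 * u (s * x + c)) ^ 4 = s ^ 8 * (fun y => u y ^ 4) (s * x + c) :=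
    fun x => by ring
  have i1 := intervalIntegral.integral_comp_mul_add (a := a) (b := b) (fun y => u y ^ 4) hs c
  simp only [e1, intervalIntegral.integral_const_mul]
  simp only [smul_eq_mul] at i1
  rw [i1]
  field_simp

theorem den_add {u : ℝ → ℝ} (hu : Continuous u) (a b c : ℝ) :
    den a b u + den b c u = den a c u :=
  intervalIntegral.integral_add_adjacent_intervals ((hu.pow 4).intervalIntegrable _ _)
    ((hu.pow 4).intervalIntegrable _ _)

theorem num_add {u p w : ℝ → ℝ} (h : IsH2 u p w) (a b c : ℝ) :
    num a b u w + num b c u w = num a c u w := by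
  unfold num
  have e1 := intervalIntegral.integral_add_adjacent_intervals (h.sq a b) (h.sq b c)
  have e2 := intervalIntegral.integral_add_adjacent_intervals
    (h.w_mul_int (h.u_cont.pow 2) a b) (h.w_mul_int (h.u_cont.pow 2) b c)
  simp only [Pi.pow_apply] at e2
  rw [← e1, ← e2]; ring

theorem num_swap (a b : ℝ) (u w : ℝ → ℝ) : num b a u w = - num a b u w := by
  unfold num
  rw [intervalIntegral.integral_symm a b, intervalIntegral.integral_symm a b]; ring

theorem den_swap (a b : ℝ) (u : ℝ → ℝ) : den b a u = - den a b u :=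
  intervalIntegral.integral_symm a b

theorem den_nonneg {a b : ℝ} (hab : a ≤ b) (u : ℝ → ℝ) : 0 ≤ den a b u :=
  intervalIntegral.integral_nonneg hab fun x _ => by positivity

theorem den_pos {a b : ℝ} (hab : a < b) {u : ℝ → ℝ} (hu : Continuous u) {x : ℝ}
    (hx : x ∈ Icc a b) (h0 : u x ≠ 0) : 0 < den a b u :=
  intervalIntegral.integral_pos hab (hu.pow 4).continuousOn (fun x _ => by positivity)
    ⟨x, hx, by positivity⟩

/-- The inequality `m ∫ u⁴ ≤ ∫ (u'')² - ∫ u'' u²` on every interval at the ends of which `u'`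
vanishes. -/
def NeumannBound (m : ℝ) : Prop :=
  ∀ u p w : ℝ → ℝ, IsH2 u p w → ∀ a b : ℝ, a ≤ b → p a = 0 → p b = 0 →
    m * den a b u ≤ num a b u w

/-- By scaling, it suffices to prove the Neumann bound on the unit interval. -/
theorem neumannBound_of_unit {m : ℝ}
    (hm : ∀ u p w : ℝ → ℝ, IsH2 u p w → p 0 = 0 → p 1 = 0 → m * den 0 1 u ≤ num 0 1 u w) :
    NeumannBound m := by
  intro u p w h a b hab ha hb
  rcases hab.eq_or_lt with rfl | hab
  · simp [num, den]
  have hs : 0 < b - a := sub_pos.2 hab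
  have := hm _ _ _ ((h.comp_affine hs.ne' a).smul ((b - a) ^ 2)) (by simp [ha]) (by simp [hb])
  rw [num_affine _ _ _ _ hs.ne', den_affine _ _ _ hs.ne'] at this
  simp only [mul_zero, zero_add, mul_one, sub_add_cancel] at this
  have h7 : 0 < (b - a) ^ 7 := by positivity
  nlinarith

/-! ### Weak compactness -/

open Filter Topology in
/-- Weak sequential compactness of bounded sequences in `L²(ℝ)`. -/
theorem exists_weak_limit {w : ℕ → ℝ → ℝ} {C : ℝ} (hw : ∀ n, MemLp (w n) 2 volume)
    (hC : ∀ n, ∫ x, w n x ^ 2 ≤ C) :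
    ∃ w₀ : ℝ → ℝ, MemLp w₀ 2 volume ∧ ∃ φ : ℕ → ℕ, StrictMono φ ∧
      ∀ g : ℝ → ℝ, MemLp g 2 volume →
        Tendsto (fun n => ∫ x, w (φ n) x * g x) atTop (𝓝 (∫ x, w₀ x * g x)) := by
  have : Fact ((2 : ENNReal) ≠ ⊤) := ⟨by simp⟩
  let H := Lp ℝ 2 (volume : Measure ℝ)
  have inn : ∀ (f g : ℝ → ℝ) (hf : MemLp f 2 volume) (hg : MemLp g 2 volume),
      inner ℝ (hf.toLp f) (hg.toLp g) = ∫ x, f x * g x := by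
    intro f g hf hg
    rw [L2.inner_def]
    refine integral_congr_ae ?_
    filter_upwards [hf.coeFn_toLp, hg.coeFn_toLp] with x h1 h2
    rw [h1, h2]
    simp [mul_comm]
  -- The Riesz isomorphism moves the sequence to the dual of the separable space `L²`, where closed
  -- balls are weak-* sequentially compact.
  let L : ℕ → WeakDual ℝ H := fun n =>
    StrongDual.toWeakDual (InnerProductSpace.toDual ℝ H ((hw n).toLp (w n)))
  have hL : ∀ n, L n ∈ WeakDual.toStrongDual ⁻¹' Metric.closedBall (0 : StrongDual ℝ H) (√C) := by
    intro n
    rw [mem_preimage, mem_closedBall_zero_iff]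
    have e : ‖WeakDual.toStrongDual (L n)‖ = ‖(hw n).toLp (w n)‖ :=
      (InnerProductSpace.toDual ℝ H).norm_map _
    rw [e]
    refine Real.le_sqrt_of_sq_le ?_
    rw [← real_inner_self_eq_norm_sq, inn]
    simpa [sq] using hC n
  obtain ⟨l, -, φ, hφ, hl⟩ := WeakDual.isSeqCompact_closedBall ℝ H 0 (√C) hL
  let f : H := (InnerProductSpace.toDual ℝ H).symm (WeakDual.toStrongDual l)
  refine ⟨f, Lp.memLp f, φ, hφ, fun g hg => ?_⟩
  have h1 := ((WeakDual.eval_continuous (hg.toLp g)).tendsto l).comp hl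
  have e1 : ∀ n, (L (φ n)) (hg.toLp g) = ∫ x, w (φ n) x * g x := fun n => by
    rw [← inn _ _ (hw (φ n)) hg]; rfl
  have e2 : l (hg.toLp g) = ∫ x, f x * g x := by
    have : l (hg.toLp g) = inner ℝ f (hg.toLp g) := by
      simp only [f, InnerProductSpace.toDual_symm_apply]; rfl
    rw [this, ← inn _ _ (Lp.memLp f) hg, Lp.toLp_coeFn]
  rw [← e2]
  simp only [← e1]
  exact h1

theorem intervalIntegrable_sq_of_memLp {w : ℝ → ℝ} (hw : MemLp w 2 volume) (a b : ℝ) :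
    IntervalIntegrable (fun x => w x ^ 2) volume a b :=
  hw.integrable_sq.intervalIntegrable

theorem intervalIntegral_sq_le {w : ℝ → ℝ} (hw : MemLp w 2 volume) {a b : ℝ} (hab : a ≤ b) :
    ∫ x in a..b, w x ^ 2 ≤ ∫ x, w x ^ 2 := by
  rw [intervalIntegral.integral_of_le hab]
  exact setIntegral_le_integral hw.integrable_sq (Filter.Eventually.of_forall fun x => sq_nonneg _)

/-- Young's inequality `|w| ≤ η + w² / η` replaces Cauchy–Schwarz. The choice `η = 1` gives growth
bounds, small `η` gives decay. -/
theorem abs_integral_le_of_sq {w : ℝ → ℝ} (hm : AEStronglyMeasurable w volume)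
    (hs : ∀ a b, IntervalIntegrable (fun x => w x ^ 2) volume a b) {a b : ℝ} (hab : a ≤ b)
    {η : ℝ} (hη : 0 < η) :
    ∫ x in a..b, |w x| ≤ η * (b - a) + (∫ x in a..b, w x ^ 2) / η := by
  have : ∫ x in a..b, |w x| ≤ ∫ x in a..b, (η + w x ^ 2 / η) := by
    refine intervalIntegral.integral_mono_on hab (intervalIntegrable_of_sq hm (hs a b)).abs
      (intervalIntegrable_const.add ((hs a b).div_const η)) fun x _ => ?_
    rw [← sub_nonneg]
    have e : η + w x ^ 2 / η - |w x| = (η ^ 2 + |w x| ^ 2 - η * |w x|) / η := by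
      rw [sq_abs]; field_simp
    rw [e]
    refine div_nonneg ?_ hη.le
    nlinarith [sq_nonneg (η - |w x|), sq_nonneg η, sq_nonneg (|w x|)]
  refine this.trans_eq ?_
  rw [intervalIntegral.integral_add intervalIntegrable_const ((hs a b).div_const η),
    intervalIntegral.integral_const, intervalIntegral.integral_div, smul_eq_mul]
  ring

namespace IsH2
variable {u p w : ℝ → ℝ}

theorem abs_p_sub_le (h : IsH2 u p w) {a b : ℝ} (hab : a ≤ b) {η : ℝ} (hη : 0 < η) :
    |p b - p a| ≤ η * (b - a) + (∫ x in a..b, w x ^ 2) / η := by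
  rw [h.der]
  exact (intervalIntegral.abs_integral_le_integral_abs hab).trans
    (abs_integral_le_of_sq h.meas h.sq hab hη)

theorem abs_p_le (h : IsH2 u p w) (h0 : p 0 = 0) (hw : MemLp w 2 volume) (x : ℝ) :
    |p x| ≤ |x| + ∫ x, w x ^ 2 := by
  rcases le_total 0 x with hx | hx
  · have h1 := h.abs_p_sub_le hx one_pos
    have h2 := intervalIntegral_sq_le hw hx
    rw [h0, sub_zero] at h1
    rw [abs_of_nonneg hx]; linarith
  · have h1 := h.abs_p_sub_le hx one_pos
    have h2 := intervalIntegral_sq_le hw hx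
    rw [h0, zero_sub, abs_neg] at h1
    rw [abs_of_nonpos hx]; linarith

end IsH2

open Filter Topology in
/-- Compactness of sequences of twice weakly differentiable functions. -/
theorem exists_isH2_limit {u p w : ℕ → ℝ → ℝ} {C : ℝ} (h : ∀ n, IsH2 (u n) (p n) (w n))
    (hw : ∀ n, MemLp (w n) 2 volume) (hC : ∀ n, ∫ x, w n x ^ 2 ≤ C) (hp : ∀ n, p n 0 = 0)
    (hu : ∀ n, |u n 0| ≤ C) :
    ∃ u₀ p₀ w₀ : ℝ → ℝ, IsH2 u₀ p₀ w₀ ∧ MemLp w₀ 2 volume ∧ p₀ 0 = 0 ∧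
      ∃ φ : ℕ → ℕ, StrictMono φ ∧
      (∀ x, Tendsto (fun n => p (φ n) x) atTop (𝓝 (p₀ x))) ∧
      (∀ x, Tendsto (fun n => u (φ n) x) atTop (𝓝 (u₀ x))) ∧
      (∀ a b, a ≤ b → ∀ ε > 0, ∀ᶠ n in atTop,
        ∫ x in a..b, w₀ x ^ 2 ≤ (∫ x in a..b, w (φ n) x ^ 2) + ε) := by
  obtain ⟨w₀, hw₀, φ₁, hφ₁, hl₁⟩ := exists_weak_limit hw hC
  obtain ⟨c, -, φ₂, hφ₂, hc⟩ := tendsto_subseq_of_bounded (Metric.isBounded_closedBall (x := (0 : ℝ))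
    (r := C)) (x := fun n => u (φ₁ n) 0) (fun n => by simpa using hu (φ₁ n))
  have hH := IsH2.mk_of hw₀.1 (intervalIntegrable_sq_of_memLp hw₀) 0 c 0
  simp only [zero_add] at hH
  have hl : ∀ g : ℝ → ℝ, MemLp g 2 volume → Tendsto (fun n => ∫ x, w (φ₁ (φ₂ n)) x * g x) atTop
      (𝓝 (∫ x, w₀ x * g x)) := fun g hg => (hl₁ g hg).comp hφ₂.tendsto_atTop
  have hpx : ∀ x, Tendsto (fun n => p (φ₁ (φ₂ n)) x) atTop (𝓝 (∫ t in (0 : ℝ)..x, w₀ t)) := by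
    intro x
    -- Weak convergence tested with indicators of intervals is pointwise convergence of the first
    -- derivatives.
    have key : ∀ a b : ℝ, a ≤ b → Tendsto (fun n => ∫ t in a..b, w (φ₁ (φ₂ n)) t) atTop
        (𝓝 (∫ t in a..b, w₀ t)) := by
      intro a b hab
      have := hl ((Ioc a b).indicator fun _ => 1) (memLp_indicator_const 2 measurableSet_Ioc 1
        (Or.inr (by simp)))
      have e : ∀ f : ℝ → ℝ, ∫ t, f t * (Ioc a b).indicator (fun _ => 1) t = ∫ t in a..b, f t := by
        intro f
        rw [intervalIntegral.integral_of_le hab, ← integral_indicator measurableSet_Ioc]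
        congr 1; ext t
        by_cases ht : t ∈ Ioc a b <;> simp [ht]
      simpa only [e] using this
    have e : ∀ n, p n x = ∫ t in (0 : ℝ)..x, w n t := fun n => by
      rw [← (h n).der, hp, sub_zero]
    simp only [e]
    rcases le_total 0 x with hx | hx
    · exact key 0 x hx
    · simp only [intervalIntegral.integral_symm x 0]
      exact (key x 0 hx).neg
  refine ⟨_, _, w₀, hH, hw₀, by simp, φ₁ ∘ φ₂, hφ₁.comp hφ₂, hpx, fun x => ?_, ?_⟩
  · have e : ∀ n, u n x = u n 0 + ∫ t in (0 : ℝ)..x, p n t := fun n => by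
      rw [← (h n).u_sub]; ring
    simp only [Function.comp_apply, e]
    refine hc.add (intervalIntegral.tendsto_integral_filter_of_dominated_convergence
      (fun t => |t| + C) (Eventually.of_forall fun n => (h _).p_cont.aestronglyMeasurable)
      (Eventually.of_forall fun n => Eventually.of_forall fun t _ => ?_)
      ((continuous_abs.add continuous_const).intervalIntegrable _ _)
      (Eventually.of_forall fun t _ => hpx t))
    have := (h (φ₁ (φ₂ n))).abs_p_le (hp _) (hw _) t
    rw [Real.norm_eq_abs]
    linarith [hC (φ₁ (φ₂ n))]
  · intro a b hab ε hε
    -- Weak lower semicontinuity on `[a, b]`: test with `w₀` cut off to the interval and expand `∫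
    -- (wₙ - w₀)² ≥ 0`.
    have h1 := hl ((Ioc a b).indicator w₀) (hw₀.indicator measurableSet_Ioc)
    have e : ∀ f : ℝ → ℝ, ∫ t, f t * (Ioc a b).indicator w₀ t = ∫ t in a..b, f t * w₀ t := by
      intro f
      rw [intervalIntegral.integral_of_le hab, ← integral_indicator measurableSet_Ioc]
      congr 1; ext t
      by_cases ht : t ∈ Ioc a b <;> simp [ht]
    simp only [e] at h1
    have h2 : ∫ x in a..b, w₀ x * w₀ x = ∫ x in a..b, w₀ x ^ 2 := by simp only [sq]
    rw [h2] at h1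
    filter_upwards [h1.eventually (lt_mem_nhds (sub_lt_self _ (half_pos hε)))] with n hn
    simp only [Function.comp_apply]
    have i1 : IntervalIntegrable (fun x => w (φ₁ (φ₂ n)) x * w₀ x) volume a b :=
      ((hw _).integrable_mul hw₀).intervalIntegrable
    have i2 := (h (φ₁ (φ₂ n))).sq a b
    have i3 := intervalIntegrable_sq_of_memLp hw₀ a b
    have h3 : 0 ≤ ∫ x in a..b, (w (φ₁ (φ₂ n)) x - w₀ x) ^ 2 :=
      intervalIntegral.integral_nonneg hab fun x _ => sq_nonneg _
    have e3 : ∀ x, (w (φ₁ (φ₂ n)) x - w₀ x) ^ 2 =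
      w (φ₁ (φ₂ n)) x ^ 2 + w₀ x ^ 2 - 2 * (w (φ₁ (φ₂ n)) x * w₀ x) := fun x => by ring
    simp only [e3] at h3
    rw [intervalIntegral.integral_sub (i2.add i3) (i1.const_mul 2),
      intervalIntegral.integral_add i2 i3, intervalIntegral.integral_const_mul] at h3
    linarith

/-! ### Identities and estimates for the numerator -/

theorem sub_eq_integral {F f : ℝ → ℝ} (hf : Continuous f) (h : ∀ x, HasDerivAt F (f x) x)
    (a b : ℝ) : F b - F a = ∫ x in a..b, f x :=
  (intervalIntegral.integral_eq_sub_of_hasDerivAt (fun x _ => h x)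
    (hf.intervalIntegrable _ _)).symm

theorem IsH2.w_mul_sq_int {u p w : ℝ → ℝ} (h : IsH2 u p w) (a b : ℝ) :
    IntervalIntegrable (fun x => w x * u x ^ 2) volume a b :=
  h.w_mul_int (h.u_cont.pow 2) a b

/-- Moving one derivative off `u''` leaves a cubic term in `u` and `u'` alone, which passes to the
limit; the only term that is merely lower semicontinuous is `∫ w²`. -/
theorem num_eq {u p w : ℝ → ℝ} (h : IsH2 u p w) (a b : ℝ) :
    num a b u w = (∫ x in a..b, w x ^ 2) + 2 * (∫ x in a..b, u x * p x ^ 2) -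
      (u b ^ 2 * p b - u a ^ 2 * p a) := by
  have hc : Continuous fun x => 2 * u x * p x := (continuous_const.mul h.u_cont).mul h.p_cont
  have := integral_mul_primitive_parts (f := fun x => u x ^ 2) (f' := fun x => 2 * u x * p x)
    (g := p) (g' := w) (fun a b => hc.intervalIntegrable _ _)
    (sub_eq_integral hc fun x => by simpa using (h.hasDeriv x).fun_pow 2) h.w_int h.der a b
  have e1 : ∫ x in a..b, w x * u x ^ 2 = ∫ x in a..b, u x ^ 2 * w x := by simp only [mul_comm]
  have e2 : ∫ x in a..b, 2 * u x * p x * p x = 2 * ∫ x in a..b, u x * p x ^ 2 := by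
    rw [← intervalIntegral.integral_const_mul]; congr 1; ext x; ring
  unfold num
  rw [e1, this, e2]; ring

theorem num_eq_of_neumann {u p w : ℝ → ℝ} (h : IsH2 u p w) {a b : ℝ} (ha : p a = 0)
    (hb : p b = 0) :
    num a b u w = (∫ x in a..b, w x ^ 2) + 2 * ∫ x in a..b, u x * p x ^ 2 := by
  rw [num_eq h, ha, hb]; ring

/-- From `(w - u²)² ≥ 0`. With a negative numerator it bounds `∫ w²` by the denominator. -/
theorem integral_sq_le {u p w : ℝ → ℝ} (h : IsH2 u p w) {a b : ℝ} (hab : a ≤ b) :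
    ∫ x in a..b, w x ^ 2 ≤ 2 * num a b u w + den a b u := by
  have i1 := h.sq a b
  have i2 := h.w_mul_sq_int a b
  have i3 : IntervalIntegrable (fun x => u x ^ 4) volume a b :=
    (h.u_cont.pow 4).intervalIntegrable _ _
  have h3 : 0 ≤ ∫ x in a..b, (w x - u x ^ 2) ^ 2 :=
    intervalIntegral.integral_nonneg hab fun x _ => sq_nonneg _
  have e3 : ∀ x, (w x - u x ^ 2) ^ 2 = w x ^ 2 + u x ^ 4 - 2 * (w x * u x ^ 2) := fun x => by ring
  simp only [e3] at h3
  rw [intervalIntegral.integral_sub (i1.add i3) (i2.const_mul 2),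
    intervalIntegral.integral_add i1 i3, intervalIntegral.integral_const_mul] at h3
  unfold num den
  linarith

/-- From `(w - u² / 2)² ≥ 0`; it makes all infima of quotients finite and needs no boundary
condition. -/
theorem num_ge {u p w : ℝ → ℝ} (h : IsH2 u p w) {a b : ℝ} (hab : a ≤ b) :
    -1 / 4 * den a b u ≤ num a b u w := by
  have i1 := h.sq a b
  have i2 := h.w_mul_sq_int a b
  have i3 : IntervalIntegrable (fun x => u x ^ 4) volume a b :=
    (h.u_cont.pow 4).intervalIntegrable _ _
  have h3 : 0 ≤ ∫ x in a..b, (w x - 1 / 2 * u x ^ 2) ^ 2 :=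
    intervalIntegral.integral_nonneg hab fun x _ => sq_nonneg _
  have e3 : ∀ x, (w x - 1 / 2 * u x ^ 2) ^ 2 = w x ^ 2 + 1 / 4 * u x ^ 4 - w x * u x ^ 2 :=
    fun x => by ring
  simp only [e3] at h3
  rw [intervalIntegral.integral_sub (i1.add (i3.const_mul _)) i2,
    intervalIntegral.integral_add i1 (i3.const_mul _), intervalIntegral.integral_const_mul] at h3
  unfold num den
  linarith

theorem p_sq_eq {u p w : ℝ → ℝ} (h : IsH2 u p w) {a : ℝ} (ha : p a = 0) (x : ℝ) :
    p x ^ 2 = 2 * ∫ t in a..x, w t * p t := by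
  have := integral_mul_primitive_parts h.w_int h.der h.w_int h.der a x
  rw [ha] at this
  have e : ∫ t in a..x, p t * w t = ∫ t in a..x, w t * p t := by simp only [mul_comm]
  rw [e] at this
  linarith

/-- Evaluate `p² = 2 ∫ w p` at a maximum point of `p²` and absorb half of `p²` by Young's
inequality. The constant 4 is not optimal. -/
theorem p_sq_le {u p w : ℝ → ℝ} (h : IsH2 u p w) {a b : ℝ} (hab : a < b) (ha : p a = 0) {x : ℝ}
    (hx : x ∈ Icc a b) : p x ^ 2 ≤ 4 * (b - a) * ∫ t in a..b, w t ^ 2 := by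
  obtain ⟨y, hy, hmax⟩ := isCompact_Icc.exists_isMaxOn ⟨x, hx⟩ ((h.p_cont.pow 2).continuousOn
    (s := Icc a b))
  have hs : ∀ t ∈ Icc a b, p t ^ 2 ≤ p y ^ 2 := fun t ht => hmax ht
  refine (hs x hx).trans ?_
  have hL : 0 < b - a := sub_pos.2 hab
  have h1 := p_sq_eq h ha y
  have h2 : ∫ t in a..y, w t * p t ≤
      ∫ t in a..y, (p y ^ 2 / (4 * (b - a)) + (b - a) * w t ^ 2) := by
    refine intervalIntegral.integral_mono_on hy.1 (h.w_mul_int h.p_cont _ _)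
      (intervalIntegrable_const.add ((h.sq _ _).const_mul _)) fun t ht => ?_
    have h3 : p t ^ 2 / (4 * (b - a)) ≤ p y ^ 2 / (4 * (b - a)) := by
      exact div_le_div_of_nonneg_right (hs t ⟨ht.1, ht.2.trans hy.2⟩) (by positivity)
    have h4 : 0 ≤ (p t / (2 * (b - a)) - w t) ^ 2 * (b - a) := by positivity
    have e : (p t / (2 * (b - a)) - w t) ^ 2 * (b - a) =
      p t ^ 2 / (4 * (b - a)) + (b - a) * w t ^ 2 - w t * p t := by field_simp; ring
    linarith
  rw [intervalIntegral.integral_add intervalIntegrable_const ((h.sq _ _).const_mul _),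
    intervalIntegral.integral_const, intervalIntegral.integral_const_mul, smul_eq_mul] at h2
  have h5 : ∫ t in a..y, w t ^ 2 ≤ ∫ t in a..b, w t ^ 2 :=
    intervalIntegral.integral_mono_interval le_rfl hy.1 hy.2
      (Filter.Eventually.of_forall fun t => sq_nonneg _) (h.sq _ _)
  have h6 : (y - a) * (p y ^ 2 / (4 * (b - a))) ≤ p y ^ 2 / 4 := by
    calc _ ≤ (b - a) * (p y ^ 2 / (4 * (b - a))) := by gcongr; exact hy.2
      _ = _ := by field_simp
  nlinarith

/-- If the numerator is negative, then the function cannot be small on a short interval. -/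
theorem exists_abs_ge_of_num_neg {u p w : ℝ → ℝ} (h : IsH2 u p w) {a b : ℝ} (hab : a < b)
    (ha : p a = 0) (hb : p b = 0) (hn : num a b u w < 0) :
    ∃ x ∈ Icc a b, 1 ≤ 8 * (b - a) ^ 2 * |u x| := by
  by_contra! hc
  rw [num_eq_of_neumann h ha hb] at hn
  have hL : 0 < b - a := sub_pos.2 hab
  set A := ∫ x in a..b, w x ^ 2
  -- If `|u| < 1 / (8 (b - a)²)` throughout, the bound on `p²` gives `2 ∫ u p² ≥ -A`, so the
  -- numerator is nonnegative.
  have h1 : ∫ x in a..b, (-(A / (2 * (b - a)))) ≤ ∫ x in a..b, u x * p x ^ 2 := by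
    refine intervalIntegral.integral_mono_on hab.le intervalIntegrable_const
      ((h.u_cont.mul (h.p_cont.pow 2)).intervalIntegrable _ _) fun x hx => ?_
    have h2 := p_sq_le h hab ha hx
    have h3 := hc x hx
    have h4 : |u x| ≤ 1 / (8 * (b - a) ^ 2) := by
      rw [le_div_iff₀ (by positivity)]; linarith
    have h5 : |u x| * p x ^ 2 ≤ 1 / (8 * (b - a) ^ 2) * (4 * (b - a) * A) := by gcongr
    have e : 1 / (8 * (b - a) ^ 2) * (4 * (b - a) * A) = A / (2 * (b - a)) := by
      field_simp; ring
    have h6 : -|u x| * p x ^ 2 ≤ u x * p x ^ 2 := by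
      gcongr; exact neg_abs_le _
    linarith
  rw [intervalIntegral.integral_const, smul_eq_mul] at h1
  have e : (b - a) * -(A / (2 * (b - a))) = - (A / 2) := by field_simp
  linarith

/-! ### Limits of integrals, constant continuation, a negative quotient -/

open Filter Topology in
theorem tendsto_integral_comp {u p : ℕ → ℝ → ℝ} {u₀ p₀ : ℝ → ℝ} {F : ℝ → ℝ → ℝ}
    (hF : Continuous fun z : ℝ × ℝ => F z.1 z.2) (hu : ∀ n, Continuous (u n))
    (hp : ∀ n, Continuous (p n)) {a b K : ℝ} (huK : ∀ n, ∀ x ∈ uIcc a b, |u n x| ≤ K)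
    (hpK : ∀ n, ∀ x ∈ uIcc a b, |p n x| ≤ K)
    (hul : ∀ x, Tendsto (fun n => u n x) atTop (𝓝 (u₀ x)))
    (hpl : ∀ x, Tendsto (fun n => p n x) atTop (𝓝 (p₀ x))) :
    Tendsto (fun n => ∫ x in a..b, F (u n x) (p n x)) atTop (𝓝 (∫ x in a..b, F (u₀ x) (p₀ x))) := by
  obtain ⟨B, hB⟩ := ((isCompact_Icc (a := -K) (b := K)).prod (isCompact_Icc (a := -K) (b := K))
    ).exists_bound_of_continuousOn hF.continuousOn
  refine intervalIntegral.tendsto_integral_filter_of_dominated_convergence (fun _ => B)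
    (Eventually.of_forall fun n =>
      (hF.comp ((hu n).prodMk (hp n))).aestronglyMeasurable)
    (Eventually.of_forall fun n => Eventually.of_forall fun x hx => ?_)
    intervalIntegrable_const (Eventually.of_forall fun x _ => ?_)
  · have hx' := uIoc_subset_uIcc hx
    exact hB (u n x, p n x) ⟨abs_le.1 (huK n x hx'), abs_le.1 (hpK n x hx')⟩
  · exact (hF.tendsto (u₀ x, p₀ x)).comp ((hul x).prodMk_nhds (hpl x))

/-- A function with `u'(0) = u'(L) = 0` can be continued by constants outside `[0, L]`. -/
theorem exists_const_extension {u p w : ℝ → ℝ} (h : IsH2 u p w) {L : ℝ} (hL : 0 ≤ L)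
    (h0 : p 0 = 0) (h1 : p L = 0) :
    ∃ v q z : ℝ → ℝ, IsH2 v q z ∧ MemLp z 2 volume ∧ (∀ x ∈ Icc 0 L, v x = u x) ∧
      (∀ x ∈ Icc 0 L, q x = p x) ∧ (∀ x ∈ Ioc 0 L, z x = w x) ∧ (∀ x, L ≤ x → q x = 0) ∧
      (∀ x, L < x → z x = 0) ∧ ∫ x, z x ^ 2 = ∫ x in (0 : ℝ)..L, w x ^ 2 := by
  let z := (Ioc 0 L).indicator w
  have hz : MemLp z 2 volume := by
    refine (memLp_two_iff_integrable_sq (h.meas.indicator measurableSet_Ioc)).2 ?_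
    have e : (fun x => z x ^ 2) = (Ioc 0 L).indicator (fun x => w x ^ 2) := by
      ext x; by_cases hx : x ∈ Ioc 0 L <;> simp [z, hx]
    rw [e, integrable_indicator_iff measurableSet_Ioc]
    exact (intervalIntegrable_iff_integrableOn_Ioc_of_le hL).1 (h.sq 0 L)
  have hH := IsH2.mk_of hz.1 (intervalIntegrable_sq_of_memLp hz) 0 (u 0) 0
  simp only [zero_add] at hH
  have hq : ∀ x ∈ Icc 0 L, ∫ t in (0 : ℝ)..x, z t = p x := by
    intro x hx
    have : ∫ t in (0 : ℝ)..x, z t = ∫ t in (0 : ℝ)..x, w t := by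
      refine intervalIntegral.integral_congr_ae (Filter.Eventually.of_forall fun t ht => ?_)
      rw [uIoc_of_le hx.1] at ht
      simp [z, ht.1, ht.2.trans hx.2]
    rw [this, ← h.der, h0, sub_zero]
  refine ⟨_, _, z, hH, hz, fun x hx => ?_, hq, fun x hx => by simp [z, hx.1, hx.2], fun x hx => ?_,
    fun x hx => by simp [z, hx], ?_⟩
  · have : ∫ t in (0 : ℝ)..x, ∫ s in (0 : ℝ)..t, z s = ∫ t in (0 : ℝ)..x, p t := by
      refine intervalIntegral.integral_congr fun t ht => ?_
      rw [uIcc_of_le hx.1] at ht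
      exact hq t ⟨ht.1, ht.2.trans hx.2⟩
    rw [this, ← h.u_sub]; ring
  · rw [← intervalIntegral.integral_add_adjacent_intervals (hH.w_int 0 L) (hH.w_int L x),
      hq L ⟨hL, le_rfl⟩, h1, zero_add, intervalIntegral.integral_zero_ae]
    refine Filter.Eventually.of_forall fun t ht => ?_
    rw [uIoc_of_le hx] at ht
    simp [z, ht.1]
  · rw [intervalIntegral.integral_of_le hL, ← integral_indicator measurableSet_Ioc]
    congr 1; ext x; by_cases hx : x ∈ Ioc 0 L <;> simp [z, hx]

theorem num_congr {u v w z : ℝ → ℝ} {a b : ℝ} (hab : a ≤ b) (hu : ∀ x ∈ Icc a b, v x = u x)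
    (hw : ∀ x ∈ Ioc a b, z x = w x) : num a b v z = num a b u w := by
  unfold num
  congr 1 <;> refine intervalIntegral.integral_congr_ae (Filter.Eventually.of_forall fun x hx => ?_)
  · rw [uIoc_of_le hab] at hx
    rw [hw x hx]
  · rw [uIoc_of_le hab] at hx
    rw [hw x hx, hu x ⟨hx.1.le, hx.2⟩]

theorem den_congr {u v : ℝ → ℝ} {a b : ℝ} (hab : a ≤ b) (hu : ∀ x ∈ Icc a b, v x = u x) :
    den a b v = den a b u := by
  refine intervalIntegral.integral_congr fun x hx => ?_
  rw [uIcc_of_le hab] at hx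
  simp only [hu x hx]

/-- A function on the unit interval with negative quotient. -/
theorem exists_num_neg : ∃ u p w : ℝ → ℝ, IsH2 u p w ∧ p 0 = 0 ∧ p 1 = 0 ∧ num 0 1 u w < 0 := by
  have hc : Continuous fun x : ℝ => 1 - 2 * x := by fun_prop
  -- The derivative `x - x²` vanishes at both ends, and the constant -10 keeps `u ≤ -9`. Hence the
  -- numerator is at most `1/3 - 2 · 9 · 1/30 < 0`.
  have h : IsH2 (fun x => -10 + x ^ 2 / 2 - x ^ 3 / 3) (fun x => x - x ^ 2) (fun x => 1 - 2 * x) := by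
    refine ⟨hc.aestronglyMeasurable, fun a b => (hc.pow 2).intervalIntegrable _ _,
      sub_eq_integral hc fun x => ?_, fun x => ?_⟩
    · simpa using (hasDerivAt_id x).fun_sub ((hasDerivAt_id x).fun_pow 2)
    · have := (((hasDerivAt_id x).fun_pow 2).div_const 2 |>.const_add (-10)).fun_sub
        (((hasDerivAt_id x).fun_pow 3).div_const 3)
      convert! this using 1
      simp
  refine ⟨_, _, _, h, by norm_num, by norm_num, ?_⟩
  rw [num_eq_of_neumann h (by norm_num) (by norm_num)]
  have e1 : ∫ x in (0 : ℝ)..1, (1 - 2 * x) ^ 2 = 1 / 3 := by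
    have e : ∀ x : ℝ, HasDerivAt (fun x => x - 2 * x ^ 2 + 4 / 3 * x ^ 3) ((1 - 2 * x) ^ 2) x := by
      intro x
      have := ((hasDerivAt_id x).fun_sub (((hasDerivAt_id x).fun_pow 2).const_mul 2)).fun_add
        (((hasDerivAt_id x).fun_pow 3).const_mul (4 / 3))
      convert! this using 1
      simp; ring
    rw [intervalIntegral.integral_eq_sub_of_hasDerivAt (fun x _ => e x)
      ((hc.pow 2).intervalIntegrable _ _)]
    norm_num
  have e2 : ∫ x in (0 : ℝ)..1, (x - x ^ 2) ^ 2 = 1 / 30 := by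
    have e : ∀ x : ℝ, HasDerivAt (fun x => x ^ 3 / 3 - x ^ 4 / 2 + x ^ 5 / 5) ((x - x ^ 2) ^ 2) x := by
      intro x
      have := ((((hasDerivAt_id x).fun_pow 3).div_const 3).fun_sub
        (((hasDerivAt_id x).fun_pow 4).div_const 2)).fun_add
        (((hasDerivAt_id x).fun_pow 5).div_const 5)
      convert! this using 1
      simp; ring
    rw [intervalIntegral.integral_eq_sub_of_hasDerivAt (fun x _ => e x)
      (Continuous.intervalIntegrable (by fun_prop) _ _)]
    norm_num
  have e3 : ∫ x in (0 : ℝ)..1, (-10 + x ^ 2 / 2 - x ^ 3 / 3) * (x - x ^ 2) ^ 2 ≤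
      ∫ x in (0 : ℝ)..1, (-9) * (x - x ^ 2) ^ 2 := by
    refine intervalIntegral.integral_mono_on zero_le_one
      (Continuous.intervalIntegrable (by fun_prop) _ _)
      (Continuous.intervalIntegrable (by fun_prop) _ _) fun x hx => ?_
    have h1 : x ^ 2 ≤ 1 := pow_le_one₀ hx.1 hx.2
    have h2 : 0 ≤ x ^ 3 := pow_nonneg hx.1 3
    gcongr
    linarith
  rw [intervalIntegral.integral_const_mul, e2] at e3
  rw [e1]
  linarith

theorem eq_zero_on_of_den_eq_zero {u p w : ℝ → ℝ} (h : IsH2 u p w) {a b : ℝ} (hab : a < b)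
    (hd : den a b u = 0) : (∀ x ∈ Icc a b, u x = 0) ∧ ∀ x ∈ Icc a b, p x = 0 := by
  have h1 : ∀ x ∈ Icc a b, u x = 0 := by
    intro x hx
    by_contra h0
    exact (den_pos hab h.u_cont hx h0).ne' hd
  refine ⟨h1, ?_⟩
  have h2 : ∀ x ∈ Ioo a b, p x = 0 := by
    intro x hx
    refine (h.hasDeriv x).unique ((hasDerivAt_const x (0 : ℝ)).congr_of_eventuallyEq ?_)
    filter_upwards [Icc_mem_nhds hx.1 hx.2] with y hy using h1 y hy
  have hcl : IsClosed {x | p x = 0} := isClosed_eq h.p_cont continuous_const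
  intro x hx
  rw [← closure_Ioo hab.ne] at hx
  exact closure_minimal (fun y hy => h2 y hy) hcl hx

/-! ### Constrained minimizers and their monotone pieces -/

/-- Between two zeros, a continuous function that does not vanish identically has two consecutive
zeros. -/
theorem exists_consecutive_zeros {p : ℝ → ℝ} (hp : Continuous p) {a b : ℝ} (ha : p a = 0)
    (hb : p b = 0) {x : ℝ} (hx : x ∈ Icc a b) (hpx : p x ≠ 0) :
    ∃ c d, a ≤ c ∧ c < d ∧ d ≤ b ∧ p c = 0 ∧ p d = 0 ∧ ∀ y ∈ Ioo c d, p y ≠ 0 := by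
  have hcl : IsClosed {y | p y = 0} := isClosed_eq hp continuous_const
  have k1 : IsCompact (Icc a x ∩ {y | p y = 0}) := isCompact_Icc.inter_right hcl
  have k2 : IsCompact (Icc x b ∩ {y | p y = 0}) := isCompact_Icc.inter_right hcl
  obtain ⟨c, ⟨hc1, hc2⟩, hc⟩ := k1.exists_isGreatest ⟨a, ⟨le_rfl, hx.1⟩, ha⟩
  obtain ⟨d, ⟨hd1, hd2⟩, hd⟩ := k2.exists_isLeast ⟨b, ⟨hx.2, le_rfl⟩, hb⟩
  have hcx : c < x := lt_of_le_of_ne hc1.2 fun e => hpx (e ▸ hc2)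
  have hxd : x < d := lt_of_le_of_ne hd1.1 fun e => hpx (e ▸ hd2)
  refine ⟨c, d, hc1.1, hcx.trans hxd, hd1.2, hc2, hd2, fun y hy h0 => ?_⟩
  rcases le_total y x with h | h
  · exact (hc ⟨⟨hc1.1.trans hy.1.le, h⟩, h0⟩).not_gt hy.1
  · exact (hd ⟨⟨h, hy.2.le.trans hd1.2⟩, h0⟩).not_gt hy.2

theorem pos_or_neg_of_ne_zero {p : ℝ → ℝ} (hp : Continuous p) {c d : ℝ}
    (h : ∀ y ∈ Ioo c d, p y ≠ 0) : (∀ y ∈ Ioo c d, 0 < p y) ∨ ∀ y ∈ Ioo c d, p y < 0 := by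
  by_contra! hc
  obtain ⟨⟨y, hy, hpy⟩, z, hz, hpz⟩ := hc
  obtain ⟨t, ht, h0⟩ := isPreconnected_Ioo.intermediate_value hy hz hp.continuousOn ⟨hpy, hpz⟩
  exact h t ht h0

open Filter Topology in
/-- The quotient has a minimizer on the unit interval under the constraint `∫ u⁴ ≤ M`. -/
theorem exists_constrained_min {v q z : ℝ → ℝ} (hv : IsH2 v q z) (hq0 : q 0 = 0) (hq1 : q 1 = 0)
    (hneg : num 0 1 v z < 0) :
    ∃ (u p w : ℝ → ℝ) (r : ℝ), IsH2 u p w ∧ p 0 = 0 ∧ p 1 = 0 ∧ 0 < den 0 1 u ∧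
      den 0 1 u ≤ den 0 1 v ∧ num 0 1 u w = r * den 0 1 u ∧ r * den 0 1 v ≤ num 0 1 v z ∧
      ∀ u p w : ℝ → ℝ, IsH2 u p w → p 0 = 0 → p 1 = 0 → den 0 1 u ≤ den 0 1 v →
        r * den 0 1 u ≤ num 0 1 u w := by
  set M := den 0 1 v
  have hM : 0 < M := by have := num_ge hv zero_le_one; linarith
  -- By scale invariance, minimizing sequences on the unit interval may have unbounded denominators;
  -- the cap `M` restores compactness.
  let S : Set ℝ := {r | ∃ u p w : ℝ → ℝ, IsH2 u p w ∧ p 0 = 0 ∧ p 1 = 0 ∧ 0 < den 0 1 u ∧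
    den 0 1 u ≤ M ∧ num 0 1 u w = r * den 0 1 u}
  have hvS : num 0 1 v z / M ∈ S :=
    ⟨v, q, z, hv, hq0, hq1, hM, le_rfl, by rw [div_mul_cancel₀ _ hM.ne']⟩
  have hbdd : BddBelow S := by
    refine ⟨-1 / 4, ?_⟩
    rintro r ⟨u, p, w, h, -, -, hd, -, hr⟩
    have := num_ge h zero_le_one
    rw [hr] at this
    exact le_of_mul_le_mul_right this hd
  set r := sInf S
  have hr : r ≤ num 0 1 v z / M := csInf_le hbdd hvS
  have hr0 : r < 0 := hr.trans_lt (div_neg_of_neg_of_pos hneg hM)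
  have hmin : ∀ u p w : ℝ → ℝ, IsH2 u p w → p 0 = 0 → p 1 = 0 → den 0 1 u ≤ M →
      r * den 0 1 u ≤ num 0 1 u w := by
    intro u p w h h0 h1 hd
    rcases (den_nonneg zero_le_one u).eq_or_lt with h2 | h2
    · have := num_ge h zero_le_one
      rw [← h2] at this ⊢
      linarith
    · have := csInf_le hbdd (a := num 0 1 u w / den 0 1 u)
        ⟨u, p, w, h, h0, h1, h2, hd, by rw [div_mul_cancel₀ _ h2.ne']⟩
      rwa [le_div_iff₀ h2] at this
  obtain ⟨s, -, hs, hsS⟩ := exists_seq_tendsto_sInf ⟨_, hvS⟩ hbdd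
  obtain ⟨N, hN⟩ := eventually_atTop.1 (hs.eventually (gt_mem_nhds hr0))
  have hs' : Tendsto (fun n => s (n + N)) atTop (𝓝 r) := (tendsto_add_atTop_iff_nat N).2 hs
  -- Constant continuation makes the whole-line compactness applicable; since the numerators are
  -- negative, `integral_sq_le` bounds `∫ w²` by `M`.
  have hch : ∀ n, ∃ u p w : ℝ → ℝ, IsH2 u p w ∧ MemLp w 2 volume ∧ p 0 = 0 ∧ p 1 = 0 ∧
      0 < den 0 1 u ∧ den 0 1 u ≤ M ∧ num 0 1 u w = s (n + N) * den 0 1 u ∧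
      ∫ x, w x ^ 2 ≤ M := by
    intro n
    obtain ⟨u, p, w, h, h0, h1, hd, hdM, hn⟩ := hsS (n + N)
    obtain ⟨u', p', w', h', hm, e1, e2, e3, -, -, e4⟩ := exists_const_extension h zero_le_one h0 h1
    have d1 := den_congr zero_le_one e1
    have d2 := num_congr zero_le_one e1 e3
    refine ⟨u', p', w', h', hm, ?_, ?_, by rwa [d1], by rwa [d1], by rw [d1, d2, hn], ?_⟩
    · rw [e2 0 (by simp), h0]
    · rw [e2 1 (by simp), h1]
    · rw [e4]
      have := integral_sq_le h zero_le_one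
      have h5 : num 0 1 u w < 0 := by rw [hn]; exact mul_neg_of_neg_of_pos (hN _ (by simp)) hd
      linarith
  choose u p w hH hm h0 h1 hd hdM hn hA using hch
  have hpb : ∀ n, ∀ x ∈ Icc (0 : ℝ) 1, |p n x| ≤ 1 + M := by
    intro n x hx
    have := (hH n).abs_p_le (h0 n) (hm n) x
    rw [abs_of_nonneg hx.1] at this
    linarith [hA n, hx.2]
  have hdiff : ∀ n, ∀ x ∈ Icc (0 : ℝ) 1, |u n x - u n 0| ≤ ∫ t in (0 : ℝ)..1, |p n t| := by
    intro n x hx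
    rw [(hH n).u_sub]
    refine (intervalIntegral.abs_integral_le_integral_abs hx.1).trans ?_
    exact intervalIntegral.integral_mono_interval le_rfl hx.1 hx.2
      (Eventually.of_forall fun t => abs_nonneg _) ((hH n).p_cont.abs.intervalIntegrable _ _)
  have hpint : ∀ n, ∫ t in (0 : ℝ)..1, |p n t| ≤ 1 + M := by
    intro n
    have := intervalIntegral.integral_mono_on zero_le_one ((hH n).p_cont.abs.intervalIntegrable 0 1)
      (intervalIntegrable_const (μ := volume) (c := 1 + M)) (hpb n)
    simpa using this
  -- On `[0, 1]` the values differ from `u(0)` by at most `1 + M`, so a larger `|u(0)|` would force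
  -- `|u| ≥ 1 + M` everywhere and `∫ u⁴ > M`.
  have hu0 : ∀ n, |u n 0| ≤ 2 + 2 * M := by
    intro n
    by_contra! hc
    have h3 : ∀ x ∈ Icc (0 : ℝ) 1, 1 + M ≤ |u n x| := by
      intro x hx
      have h4 := (hdiff n x hx).trans (hpint n)
      have h5 := abs_sub_abs_le_abs_sub (u n 0) (u n x)
      rw [abs_sub_comm] at h5
      linarith
    have h6 : ∫ x in (0 : ℝ)..1, (1 + M) ≤ den 0 1 (u n) := by
      refine intervalIntegral.integral_mono_on zero_le_one intervalIntegrable_const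
        (((hH n).u_cont.pow 4).intervalIntegrable _ _) fun x hx => ?_
      rw [← Even.pow_abs (show Even 4 by decide)]
      have := h3 x hx
      calc 1 + M ≤ (1 + M) ^ 4 := le_self_pow₀ (by linarith) (by norm_num)
        _ ≤ |u n x| ^ 4 := by gcongr
    simp at h6
    linarith [hdM n]
  obtain ⟨u₀, p₀, w₀, hH₀, hm₀, hp₀, φ, hφ, hpl, hul, hlsc⟩ := exists_isH2_limit hH hm
    (C := 2 + 2 * M) (fun n => by linarith [hA n]) h0 hu0
  have hub : ∀ n, ∀ x ∈ Icc (0 : ℝ) 1, |u n x| ≤ 3 + 3 * M := by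
    intro n x hx
    have h4 := (hdiff n x hx).trans (hpint n)
    have h5 := abs_sub_abs_le_abs_sub (u n x) (u n 0)
    linarith [hu0 n]
  have conv : ∀ F : ℝ → ℝ → ℝ, (Continuous fun z : ℝ × ℝ => F z.1 z.2) →
      Tendsto (fun n => ∫ x in (0 : ℝ)..1, F (u (φ n) x) (p (φ n) x)) atTop
        (𝓝 (∫ x in (0 : ℝ)..1, F (u₀ x) (p₀ x))) := fun F hF =>
    tendsto_integral_comp hF (fun n => (hH _).u_cont) (fun n => (hH _).p_cont) (K := 3 + 3 * M)
      (fun n x hx => hub _ x (by rwa [uIcc_of_le zero_le_one] at hx))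
      (fun n x hx => (hpb _ x (by rwa [uIcc_of_le zero_le_one] at hx)).trans (by linarith)) hul hpl
  have hp1 : p₀ 1 = 0 := tendsto_nhds_unique (hpl 1) (by simp [h1])
  have cD : Tendsto (fun n => den 0 1 (u (φ n))) atTop (𝓝 (den 0 1 u₀)) :=
    conv (fun x _ => x ^ 4) (by fun_prop)
  have cB : Tendsto (fun n => ∫ x in (0 : ℝ)..1, u (φ n) x * p (φ n) x ^ 2) atTop
    (𝓝 (∫ x in (0 : ℝ)..1, u₀ x * p₀ x ^ 2)) := conv (fun x y => x * y ^ 2) (by fun_prop)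
  have hDM : den 0 1 u₀ ≤ M := le_of_tendsto cD (Eventually.of_forall fun n => hdM _)
  have hnum : num 0 1 u₀ w₀ ≤ r * den 0 1 u₀ := by
    rw [num_eq_of_neumann hH₀ hp₀ hp1]
    refine le_of_forall_pos_le_add fun ε hε => ?_
    have hl := ((hs'.comp hφ.tendsto_atTop).mul cD).sub (cB.const_mul 2)
    have : ∫ x in (0 : ℝ)..1, w₀ x ^ 2 ≤
        r * den 0 1 u₀ - 2 * (∫ x in (0 : ℝ)..1, u₀ x * p₀ x ^ 2) + ε := by
      refine ge_of_tendsto (hl.add_const ε) ?_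
      filter_upwards [hlsc 0 1 zero_le_one ε hε] with n hn'
      have e := hn (φ n)
      rw [num_eq_of_neumann (hH _) (h0 _) (h1 _)] at e
      simp only [Function.comp_apply]
      linarith
    linarith
  -- A vanishing limit would mean uniform convergence to zero, but a negative numerator forces `|u|
  -- ≥ 1/8` somewhere.
  have hDpos : 0 < den 0 1 u₀ := by
    refine lt_of_le_of_ne (den_nonneg zero_le_one _) fun hD => ?_
    obtain ⟨z1, z2⟩ := eq_zero_on_of_den_eq_zero hH₀ zero_lt_one hD.symm
    have cP := conv (fun _ y => |y|) (by fun_prop)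
    have e : ∫ x in (0 : ℝ)..1, |p₀ x| = 0 := by
      rw [intervalIntegral.integral_congr (g := fun _ => (0 : ℝ))]
      · simp
      · intro x hx
        rw [uIcc_of_le zero_le_one] at hx
        simp [z2 x hx]
    rw [e] at cP
    have c0 := (hul 0).abs
    rw [z1 0 (by simp), abs_zero] at c0
    have c1 := c0.add cP
    rw [add_zero] at c1
    obtain ⟨n, hn'⟩ := (c1.eventually (gt_mem_nhds (show (0 : ℝ) < 1 / 8 by norm_num))).exists
    obtain ⟨x, hx, hx8⟩ := exists_abs_ge_of_num_neg (hH (φ n)) zero_lt_one (h0 _) (h1 _) (by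
      rw [hn]; exact mul_neg_of_neg_of_pos (hN _ (by simp)) (hd _))
    have h4 := hdiff (φ n) x hx
    have h5 := abs_sub_abs_le_abs_sub (u (φ n) x) (u (φ n) 0)
    norm_num at hx8
    linarith
  exact ⟨u₀, p₀, w₀, r, hH₀, hp₀, hp1, hDpos, hDM, le_antisymm hnum (hmin _ _ _ hH₀ hp₀ hp1 hDM),
    by rwa [le_div_iff₀ hM] at hr, hmin⟩

theorem IsH2.reflect {u p w : ℝ → ℝ} (h : IsH2 u p w) :
    IsH2 (fun x => u (-x)) (fun x => -p (-x)) (fun x => w (-x)) := by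
  have := h.comp_affine (s := -1) (by norm_num) 0
  simpa using this

theorem num_reflect (a b : ℝ) (u w : ℝ → ℝ) :
    num a b (fun x => u (-x)) (fun x => w (-x)) = num (-b) (-a) u w := by
  have := num_affine a b u w (s := -1) (by norm_num) 0
  rw [num_swap (-a) (-b)]
  norm_num at this
  simpa using this

theorem den_reflect (a b : ℝ) (u : ℝ → ℝ) : den a b (fun x => u (-x)) = den (-b) (-a) u := by
  have := den_affine a b u (s := -1) (by norm_num) 0
  rw [den_swap (-a) (-b)]
  norm_num at this
  simpa using this

/-- A function with negative numerator on the unit interval can be replaced by an increasing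
function on some interval without increasing the quotient. -/
theorem exists_increasing_piece {v q z : ℝ → ℝ} (hv : IsH2 v q z) (hq0 : q 0 = 0) (hq1 : q 1 = 0)
    {m : ℝ} (hneg : num 0 1 v z < 0) (hm : num 0 1 v z ≤ m * den 0 1 v) :
    ∃ (u p w : ℝ → ℝ) (a b : ℝ), IsH2 u p w ∧ a < b ∧ p a = 0 ∧ p b = 0 ∧
      (∀ x ∈ Ioo a b, 0 < p x) ∧ num a b u w ≤ m * den a b u := by
  obtain ⟨u, p, w, r, h, h0, h1, hd, hdM, hn, hrv, hmin⟩ := exists_constrained_min hv hq0 hq1 hneg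
  have hM : 0 < den 0 1 v := hd.trans_le hdM
  have hrm : r ≤ m := le_of_mul_le_mul_right (hrv.trans hm) hM
  have hr0 : r < 0 := by
    by_contra! hc
    have := mul_nonneg hc hM.le
    linarith
  -- Stretching the piece to the unit interval multiplies its denominator by `(d - c)⁷ ≤ 1`, so it
  -- still respects the cap and may be compared with the constrained minimizer.
  have hpiece : ∀ c d : ℝ, 0 ≤ c → c ≤ d → d ≤ 1 → p c = 0 → p d = 0 →
      r * den c d u ≤ num c d u w := by
    intro c d hc hcd hd1 hpc hpd
    rcases hcd.eq_or_lt with rfl | hcd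
    · simp [num, den]
    have hs : 0 < d - c := sub_pos.2 hcd
    have hmn := hmin _ _ _ ((h.comp_affine hs.ne' c).smul ((d - c) ^ 2)) (by simp [hpc])
      (by simp [hpd])
    rw [num_affine _ _ _ _ hs.ne', den_affine _ _ _ hs.ne'] at hmn
    simp only [mul_zero, zero_add, mul_one, sub_add_cancel] at hmn
    have h7 : 0 < (d - c) ^ 7 := by positivity
    have h8 : (d - c) ^ 7 ≤ 1 := pow_le_one₀ hs.le (by linarith)
    have d1 := den_add h.u_cont 0 c d
    have d2 := den_add h.u_cont 0 d 1
    have d3 := den_nonneg hc u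
    have d4 := den_nonneg hd1 u
    have d5 := den_nonneg hcd.le u
    have := hmn (by nlinarith)
    nlinarith
  have hne : ∃ x ∈ Icc (0 : ℝ) 1, p x ≠ 0 := by
    by_contra! hc
    rw [num_eq_of_neumann h h0 h1] at hn
    have e : ∫ x in (0 : ℝ)..1, u x * p x ^ 2 = 0 := by
      rw [intervalIntegral.integral_congr (g := fun _ => (0 : ℝ))]
      · simp
      · intro x hx
        rw [uIcc_of_le zero_le_one] at hx
        simp [hc x hx]
    have : 0 ≤ ∫ x in (0 : ℝ)..1, w x ^ 2 :=
      intervalIntegral.integral_nonneg zero_le_one fun x _ => sq_nonneg _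
    have := mul_neg_of_neg_of_pos hr0 hd
    linarith
  obtain ⟨x, hx, hpx⟩ := hne
  obtain ⟨c, d, hc, hcd, hd1, hpc, hpd, hnz⟩ := exists_consecutive_zeros h.p_cont h0 h1 hx hpx
  -- The quotient of the whole is exactly `r` and the outer pieces have `num ≥ r * den`, so the
  -- middle piece has `num ≤ r * den`.
  have hle : num c d u w ≤ m * den c d u := by
    have l1 := hpiece 0 c le_rfl hc (hcd.le.trans hd1) h0 hpc
    have l2 := hpiece d 1 (hc.trans hcd.le) hd1 le_rfl hpd h1
    have n1 := num_add h 0 c d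
    have n2 := num_add h 0 d 1
    have d1 := den_add h.u_cont 0 c d
    have d2 := den_add h.u_cont 0 d 1
    have : r * den c d u ≤ m * den c d u := by gcongr; exact den_nonneg hcd.le u
    nlinarith
  rcases pos_or_neg_of_ne_zero h.p_cont hnz with hs | hs
  · exact ⟨u, p, w, c, d, h, hcd, hpc, hpd, hs, hle⟩
  · refine ⟨_, _, _, -d, -c, h.reflect, neg_lt_neg hcd, by simp [hpd], by simp [hpc],
      fun y hy => ?_, by rw [num_reflect, den_reflect, neg_neg, neg_neg]; exact hle⟩
    have := hs (-y) ⟨by linarith [hy.2], by linarith [hy.1]⟩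
    linarith

/-! ### Decay at infinity and the bound on half lines -/

-- The integral up to `R` is monotone and bounded in `R`, hence convergent, so its increments over
-- unit steps vanish.
open Filter Topology in
theorem tendsto_integral_unit_zero {f : ℝ → ℝ} (hf : ∀ a b, IntervalIntegrable f volume a b)
    (h0 : ∀ x, 0 ≤ f x) {a C : ℝ} (hC : ∀ R, a ≤ R → ∫ x in a..R, f x ≤ C) :
    Tendsto (fun x => ∫ t in x..x + 1, f t) atTop (𝓝 0) := by
  let J : ℝ → ℝ := fun R => ∫ x in a..max a R, f x
  have hJ : Monotone J := fun x y hxy =>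
    intervalIntegral.integral_mono_interval le_rfl (le_max_left _ _) (max_le_max le_rfl hxy)
      (Eventually.of_forall h0) (hf _ _)
  have hb : BddAbove (range J) := ⟨C, by rintro _ ⟨R, rfl⟩; exact hC _ (le_max_left _ _)⟩
  have h1 := tendsto_atTop_ciSup hJ hb
  have h2 := (h1.comp (tendsto_atTop_add_const_right atTop (1 : ℝ) tendsto_id)).sub h1
  rw [sub_self] at h2
  refine h2.congr' ?_
  filter_upwards [eventually_ge_atTop a] with x hx
  simp only [J, Function.comp_apply, id_eq, max_eq_right hx, max_eq_right (show a ≤ x + 1 by linarith)]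
  exact intervalIntegral.integral_interval_sub_left (hf _ _) (hf _ _)

theorem integral_abs_le_of_pow_four {u : ℝ → ℝ} (hu : Continuous u) (x : ℝ) {η : ℝ} (hη : 0 < η) :
    ∫ t in x..x + 1, |u t| ≤ η + (∫ t in x..x + 1, u t ^ 4) / η ^ 3 := by
  have : ∫ t in x..x + 1, |u t| ≤ ∫ t in x..x + 1, (η + u t ^ 4 / η ^ 3) := by
    refine intervalIntegral.integral_mono_on (by linarith) (hu.abs.intervalIntegrable _ _)
      ((continuous_const.add ((hu.pow 4).div_const _)).intervalIntegrable _ _) fun t _ => ?_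
    rcases le_total |u t| η with h | h
    · have : 0 ≤ u t ^ 4 / η ^ 3 := by positivity
      linarith
    · have : |u t| ≤ u t ^ 4 / η ^ 3 := by
        rw [le_div_iff₀ (by positivity), ← Even.pow_abs (show Even 4 by decide)]
        calc |u t| * η ^ 3 ≤ |u t| * |u t| ^ 3 := by gcongr
          _ = |u t| ^ 4 := by ring
      linarith
  refine this.trans_eq ?_
  have hc : Continuous fun t => u t ^ 4 / η ^ 3 := by fun_prop
  rw [intervalIntegral.integral_add intervalIntegrable_const (hc.intervalIntegrable _ _),
    intervalIntegral.integral_const, intervalIntegral.integral_div]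
  simp

/-- Pointwise bounds by local integrals. -/
theorem abs_le_of_integrals {u p w : ℝ → ℝ} (h : IsH2 u p w) (x : ℝ) :
    |u x| + |p x| ≤ 10 * ((∫ t in x..x + 1, |u t|) + ∫ t in x..x + 1, |w t|) := by
  set ε := ∫ t in x..x + 1, |w t|
  have hp : ∀ t ∈ Icc x (x + 1), |p t - p x| ≤ ε := by
    intro t ht
    rw [h.der]
    refine (intervalIntegral.abs_integral_le_integral_abs ht.1).trans ?_
    exact intervalIntegral.integral_mono_interval le_rfl ht.1 ht.2
      (Filter.Eventually.of_forall fun t => abs_nonneg _) (h.w_int _ _).abs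
  have hε : 0 ≤ ε := intervalIntegral.integral_nonneg (by linarith) fun _ _ => abs_nonneg _
  have hu : ∀ t ∈ Icc x (x + 1), |u t - (u x + p x * (t - x))| ≤ ε := by
    intro t ht
    have e : u t - (u x + p x * (t - x)) = ∫ s in x..t, (p s - p x) := by
      rw [intervalIntegral.integral_sub (h.p_cont.intervalIntegrable _ _) intervalIntegrable_const,
        ← h.u_sub, intervalIntegral.integral_const, smul_eq_mul]; ring
    rw [e]
    have := intervalIntegral.norm_integral_le_of_norm_le_const (a := x) (b := t) (C := ε)
      (f := fun s => p s - p x) (fun s hs => by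
        rw [uIoc_of_le ht.1] at hs
        exact hp s ⟨hs.1.le, hs.2.trans ht.2⟩)
    rw [Real.norm_eq_abs] at this
    refine this.trans ?_
    rw [abs_of_nonneg (by linarith [ht.1])]
    nlinarith [ht.2]
  -- On `[x, x + 1]` the function stays within `ε` of its tangent at `x`, so moments of the tangent
  -- are controlled by `∫ |u| + ε`.
  have key : ∀ (k : ℝ → ℝ) (K : ℝ), Continuous k → (∀ t ∈ Icc x (x + 1), |k t| ≤ K) →
      |∫ t in x..x + 1, k t * (u x + p x * (t - x))| ≤ K * ((∫ t in x..x + 1, |u t|) + ε) := by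
    intro k K hk hK
    have hc : Continuous fun t => k t * (u x + p x * (t - x)) := by fun_prop
    have hc2 : Continuous fun t => |u t| + ε := h.u_cont.abs.add continuous_const
    refine (intervalIntegral.abs_integral_le_integral_abs (by linarith)).trans ?_
    have h1 : ∫ t in x..x + 1, |k t * (u x + p x * (t - x))| ≤
        ∫ t in x..x + 1, K * (|u t| + ε) := by
      refine intervalIntegral.integral_mono_on (by linarith) (hc.abs.intervalIntegrable _ _)
        ((hc2.const_mul K).intervalIntegrable _ _) fun t ht => ?_
      rw [abs_mul]
      have h2 := hu t ht
      rw [abs_sub_comm] at h2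
      have h3 := abs_sub_abs_le_abs_sub (u x + p x * (t - x)) (u t)
      exact mul_le_mul (hK t ht) (by linarith) (abs_nonneg _) ((abs_nonneg _).trans (hK t ht))
    refine h1.trans_eq ?_
    rw [intervalIntegral.integral_const_mul, intervalIntegral.integral_add
      (h.u_cont.abs.intervalIntegrable _ _) intervalIntegrable_const,
      intervalIntegral.integral_const]
    simp
  -- The weights `4 - 6s` and `12s - 6` are the affine functions dual to `1, s` on `[0, 1]`: they
  -- read off value and slope. Their bounds 4 and 6 add up to the factor 10.
  have a1 : ∫ t in x..x + 1, (4 - 6 * (t - x)) * (u x + p x * (t - x)) = u x := by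
    rw [← sub_eq_integral (F := fun t => 4 * u x * (t - x) + (2 * p x - 3 * u x) * (t - x) ^ 2
      - 2 * p x * (t - x) ^ 3) (by fun_prop)]
    · simp; ring
    · intro t
      have d := (hasDerivAt_id t).sub_const x
      have := ((d.const_mul (4 * u x)).fun_add ((d.fun_pow 2).const_mul (2 * p x - 3 * u x))).fun_sub
        ((d.fun_pow 3).const_mul (2 * p x))
      convert! this using 1
      simp; ring
  have a2 : ∫ t in x..x + 1, (12 * (t - x) - 6) * (u x + p x * (t - x)) = p x := by
    rw [← sub_eq_integral (F := fun t => -6 * u x * (t - x) + (6 * u x - 3 * p x) * (t - x) ^ 2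
      + 4 * p x * (t - x) ^ 3) (by fun_prop)]
    · simp; ring
    · intro t
      have d := (hasDerivAt_id t).sub_const x
      have := ((d.const_mul (-6 * u x)).fun_add
        ((d.fun_pow 2).const_mul (6 * u x - 3 * p x))).fun_add ((d.fun_pow 3).const_mul (4 * p x))
      convert! this using 1
      simp; ring
  have b1 := key (fun t => 4 - 6 * (t - x)) 4 (by fun_prop) fun t ht => by
    rw [abs_le]; constructor <;> linarith [ht.1, ht.2]
  have b2 := key (fun t => 12 * (t - x) - 6) 6 (by fun_prop) fun t ht => by
    rw [abs_le]; constructor <;> linarith [ht.1, ht.2]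
  rw [a1] at b1
  rw [a2] at b2
  linarith

open Filter Topology in
/-- A function with `u ∈ L⁴` and `u'' ∈ L²` on a half line tends to zero together with its
derivative. -/
theorem tendsto_zero_of_bounds {u p w : ℝ → ℝ} (h : IsH2 u p w) {a C : ℝ}
    (hw : ∀ R, a ≤ R → ∫ x in a..R, w x ^ 2 ≤ C) (hu : ∀ R, a ≤ R → den a R u ≤ C) :
    Tendsto (fun x => |u x| + |p x|) atTop (𝓝 0) := by
  have t1 := tendsto_integral_unit_zero h.sq (fun x => sq_nonneg _) hw
  have t2 := tendsto_integral_unit_zero (f := fun x => u x ^ 4)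
    (fun a b => (h.u_cont.pow 4).intervalIntegrable _ _) (fun x => by positivity) hu
  refine tendsto_order.2 ⟨fun c hc => Eventually.of_forall fun x => hc.trans_le (by positivity),
    fun c hc => ?_⟩
  -- With `η = c / 50` each of the two integrals is at most `2η`, and `10 · 4η = 4c / 5 < c`.
  have hη : 0 < c / 50 := by positivity
  filter_upwards [t1.eventually (gt_mem_nhds (show (0 : ℝ) < (c / 50) ^ 2 by positivity)),
    t2.eventually (gt_mem_nhds (show (0 : ℝ) < (c / 50) ^ 4 by positivity))] with x h1 h2
  have e1 := abs_integral_le_of_sq h.meas h.sq (show x ≤ x + 1 by linarith) hη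
  have e2 := integral_abs_le_of_pow_four h.u_cont x hη
  have e3 := abs_le_of_integrals h x
  have f1 : (∫ t in x..x + 1, w t ^ 2) / (c / 50) ≤ c / 50 := by
    rw [div_le_iff₀ hη]; nlinarith
  have f2 : (∫ t in x..x + 1, u t ^ 4) / (c / 50) ^ 3 ≤ c / 50 := by
    rw [div_le_iff₀ (by positivity)]
    calc _ ≤ (c / 50) ^ 4 := h2.le
      _ = _ := by ring
  linarith

/-- Modification of a function to the right of `R` such that the derivative vanishes at `R + 1`. -/
theorem exists_glue {u p w : ℝ → ℝ} (h : IsH2 u p w) (R : ℝ) (hs : |u R| + |p R| ≤ 1) :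
    ∃ v q z : ℝ → ℝ, IsH2 v q z ∧ (∀ x, x ≤ R → v x = u x) ∧ (∀ x, x ≤ R → q x = p x) ∧
      (∀ x, x ≤ R → z x = w x) ∧ q (R + 1) = 0 ∧
      num R (R + 1) v z ≤ 4 * (|u R| + |p R|) ∧ den R (R + 1) v ≤ |u R| + |p R| := by
  -- Beyond `R` the second derivative is constant, bringing the slope linearly to zero over unit
  -- length.
  let z : ℝ → ℝ := fun x => if x ≤ R then w x else -p R
  set σ := |u R| + |p R|
  have hσ : 0 ≤ σ := by positivity
  have hpσ : |p R| ≤ σ := by simp only [σ]; linarith [abs_nonneg (u R)]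
  have huσ : |u R| ≤ σ := by simp only [σ]; linarith [abs_nonneg (p R)]
  have hm : AEStronglyMeasurable z volume := by
    have : z = (Iic R).piecewise w fun _ => -p R := by
      ext x; simp [z, Set.piecewise]
    rw [this]
    exact AEStronglyMeasurable.piecewise measurableSet_Iic h.meas.restrict
      aestronglyMeasurable_const
  have hsq : ∀ a b, IntervalIntegrable (fun x => z x ^ 2) volume a b := by
    intro a b
    refine ((h.sq a b).add (intervalIntegrable_const (c := p R ^ 2))).mono_fun (hm.pow 2).restrict
      (Filter.Eventually.of_forall fun x => ?_)
    simp only [Real.norm_eq_abs, z]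
    rw [abs_of_nonneg (by positivity), abs_of_nonneg (by positivity)]
    split_ifs <;> nlinarith [sq_nonneg (w x), sq_nonneg (p R)]
  have hH := IsH2.mk_of hm hsq R (u R) (p R)
  have q1 : ∀ x, x ≤ R → p R + ∫ t in R..x, z t = p x := by
    intro x hx
    have : ∫ t in R..x, z t = ∫ t in R..x, w t := by
      refine intervalIntegral.integral_congr fun t ht => ?_
      rw [uIcc_of_ge hx] at ht
      simp [z, ht.2]
    rw [this, ← h.der]; ring
  have q2 : ∀ x, R ≤ x → p R + ∫ t in R..x, z t = p R * (1 - (x - R)) := by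
    intro x hx
    have : ∫ t in R..x, z t = ∫ t in R..x, -p R := by
      refine intervalIntegral.integral_congr_ae (Filter.Eventually.of_forall fun t ht => ?_)
      rw [uIoc_of_le hx] at ht
      simp [z, ht.1]
    rw [this, intervalIntegral.integral_const, smul_eq_mul]; ring
  set v : ℝ → ℝ := fun x => u R + ∫ t in R..x, (p R + ∫ s in R..t, z s)
  set q : ℝ → ℝ := fun x => p R + ∫ s in R..x, z s
  have hq : ∀ x ∈ Icc R (R + 1), |q x| ≤ σ := by
    intro x hx
    have e : q x = p R * (1 - (x - R)) := q2 x hx.1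
    rw [e, abs_mul, abs_of_nonneg (by linarith [hx.2] : 0 ≤ 1 - (x - R))]
    nlinarith [abs_nonneg (p R), hx.1]
  have hv : ∀ x ∈ Icc R (R + 1), |v x| ≤ σ := by
    intro x hx
    have e : v x - u R = ∫ t in R..x, q t := by simp [v, q]
    have h1 := intervalIntegral.norm_integral_le_of_norm_le_const (a := R) (b := x) (C := |p R|)
      (f := q) (fun t ht => by
        rw [uIoc_of_le hx.1] at ht
        have e : q t = p R * (1 - (t - R)) := q2 t ht.1.le
        rw [Real.norm_eq_abs, e, abs_mul,
          abs_of_nonneg (by linarith [hx.2, ht.2] : 0 ≤ 1 - (t - R))]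
        nlinarith [abs_nonneg (p R), ht.1])
    rw [← e, Real.norm_eq_abs, abs_of_nonneg (by linarith [hx.1] : 0 ≤ x - R)] at h1
    have h2 := abs_sub_abs_le_abs_sub (v x) (u R)
    have h3 : |p R| * (x - R) ≤ |p R| := by nlinarith [abs_nonneg (p R), hx.2]
    simp only [σ]; linarith
  have hqe : q (R + 1) = 0 := by
    have := q2 (R + 1) (by linarith)
    simp only [q]; rw [this]; ring
  have hvR : v R = u R := by simp [v]
  have hqR : q R = p R := by simp [q]
  refine ⟨v, q, z, hH, fun x hx => ?_, q1, fun x hx => by simp [z, hx], hqe, ?_, ?_⟩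
  · have : ∫ t in R..x, (p R + ∫ s in R..t, z s) = ∫ t in R..x, p t := by
      refine intervalIntegral.integral_congr fun t ht => ?_
      rw [uIcc_of_ge hx] at ht
      exact q1 t ht.2
    simp only [v]
    rw [this, ← h.u_sub]; ring
  · rw [num_eq hH, hqe, hvR, hqR]
    have e1 : ∫ x in R..R + 1, z x ^ 2 = p R ^ 2 := by
      rw [intervalIntegral.integral_congr_ae (g := fun _ => p R ^ 2)]
      · simp
      · refine Filter.Eventually.of_forall fun t ht => ?_
        rw [uIoc_of_le (by linarith)] at ht
        simp [z, ht.1]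
    have e2 : ∫ x in R..R + 1, v x * q x ^ 2 ≤ ∫ x in R..R + 1, σ := by
      refine intervalIntegral.integral_mono_on (by linarith)
        ((hH.u_cont.mul (hH.p_cont.pow 2)).intervalIntegrable _ _) intervalIntegrable_const
        fun x hx => ?_
      have h1 := hv x hx
      have h2 : q x ^ 2 ≤ 1 := by
        rw [← sq_abs]
        exact pow_le_one₀ (abs_nonneg _) ((hq x hx).trans hs)
      calc v x * q x ^ 2 ≤ |v x| * q x ^ 2 := by gcongr; exact le_abs_self _
        _ ≤ σ * 1 := by gcongr
        _ = σ := mul_one _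
    rw [intervalIntegral.integral_const] at e2
    simp only [add_sub_cancel_left, smul_eq_mul, one_mul] at e2
    have e3 : p R ^ 2 ≤ |p R| := by
      rw [← sq_abs]; nlinarith [abs_nonneg (p R)]
    have e4 : u R ^ 2 * p R ≤ |u R| := by
      have : u R ^ 2 ≤ |u R| := by rw [← sq_abs]; nlinarith [abs_nonneg (u R)]
      calc u R ^ 2 * p R ≤ u R ^ 2 * |p R| := by gcongr; exact le_abs_self _
        _ ≤ |u R| * 1 := by gcongr; exact hpσ.trans hs
        _ = _ := mul_one _
    rw [e1]
    have : |u R| + |p R| = σ := rfl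
    linarith
  · have : den R (R + 1) v ≤ ∫ x in R..R + 1, σ := by
      refine intervalIntegral.integral_mono_on (by linarith)
        ((hH.u_cont.pow 4).intervalIntegrable _ _) intervalIntegrable_const fun x hx => ?_
      rw [← Even.pow_abs (show Even 4 by decide)]
      calc |v x| ^ 4 ≤ σ ^ 4 := by gcongr; exact hv x hx
        _ ≤ σ := pow_le_of_le_one hσ hs (by norm_num)
    simpa using this

open Filter Topology in
/-- The Neumann bound on a half line. -/
theorem NeumannBound.half_line {m : ℝ} (hm : NeumannBound m) {u p w : ℝ → ℝ} (h : IsH2 u p w)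
    {a b C : ℝ} (ha : p a = 0) (hw : ∀ R, b ≤ R → ∫ x in b..R, w x ^ 2 ≤ C)
    (hu : ∀ R, b ≤ R → den b R u ≤ C) {ε : ℝ} (hε : 0 < ε) :
    ∀ᶠ R in atTop, m * den a R u ≤ num a R u w + ε := by
  have ht := tendsto_zero_of_bounds h hw hu
  -- The glued end costs at most `4σ` in the numerator and `|m| σ` in `m * den`, where `σ = |u(R)| +
  -- |u'(R)|`.
  have hδ : 0 < ε / (4 + |m|) := by positivity
  filter_upwards [ht.eventually (gt_mem_nhds one_pos), ht.eventually (gt_mem_nhds hδ),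
    eventually_ge_atTop a] with R h1 h2 h3
  obtain ⟨v, q, z, hH, v1, q1, z1, q2, n1, d1⟩ := exists_glue h R h1.le
  have := hm v q z hH a (R + 1) (by linarith) (by rw [q1 a h3, ha]) q2
  rw [← den_add hH.u_cont a R, ← num_add hH a R, den_congr h3 (fun x hx => v1 x hx.2),
    num_congr h3 (fun x hx => v1 x hx.2) (fun x hx => z1 x hx.2)] at this
  set σ := |u R| + |p R|
  rw [lt_div_iff₀ (by positivity)] at h2
  have d0 := den_nonneg (show R ≤ R + 1 by linarith) v
  have : -(|m| * σ) ≤ m * den R (R + 1) v := by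
    have h5 : |m| * den R (R + 1) v ≤ |m| * σ := by gcongr
    have h6 : -|m| * den R (R + 1) v ≤ m * den R (R + 1) v := by gcongr; exact neg_abs_le m
    linarith
  linarith

/-! ### First variation and Euler–Lagrange equation -/

/-- Along `u + t g` the functional is a quartic polynomial in `t`, so the first variation is a
linear coefficient and no differentiation under the integral is needed. -/
theorem linear_coeff_eq_zero {a b c d : ℝ}
    (h : ∀ t : ℝ, 0 ≤ a * t + b * t ^ 2 + c * t ^ 3 + d * t ^ 4) : a = 0 := by
  have h1 : HasDerivAt (fun t : ℝ => a * t + b * t ^ 2 + c * t ^ 3 + d * t ^ 4) a 0 := by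
    have i := hasDerivAt_id (0 : ℝ)
    have := (((i.const_mul a).fun_add ((i.fun_pow 2).const_mul b)).fun_add
      ((i.fun_pow 3).const_mul c)).fun_add ((i.fun_pow 4).const_mul d)
    convert! this using 1
    simp
  refine IsLocalMin.hasDerivAt_eq_zero (Filter.Eventually.of_forall fun t => ?_) h1
  simpa using h t

/-- The first variation vanishes at a minimizer. -/
theorem first_variation {u p w g q h : ℝ → ℝ} (hu : IsH2 u p w) (hg : IsH2 g q h) {a b m : ℝ}
    (hmin : ∀ t : ℝ, num a b u w - m * den a b u ≤
      num a b (fun x => u x + t * g x) (fun x => w x + t * h x) -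
        m * den a b (fun x => u x + t * g x)) :
    ∫ x in a..b, (2 * w x - u x ^ 2) * h x =
      ∫ x in a..b, (2 * (w x * u x) + 4 * m * u x ^ 3) * g x := by
  have cu := hu.u_cont
  have cg := hg.u_cont
  have i1 := hu.sq a b
  have i2 := hg.sq a b
  -- Polarization: twice the product is `(w + h)² - w² - h²`.
  have i3 : IntervalIntegrable (fun x => w x * h x) volume a b := by
    have := ((hu.add hg).sq a b).sub (i1.add i2)
    refine (this.const_mul (1 / 2)).congr fun x _ => ?_
    ring
  have j : ∀ c : ℝ → ℝ, Continuous c → IntervalIntegrable (fun x => w x * c x) volume a b :=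
    fun c hc => hu.w_mul_int hc a b
  have k : ∀ c : ℝ → ℝ, Continuous c → IntervalIntegrable (fun x => h x * c x) volume a b :=
    fun c hc => hg.w_mul_int hc a b
  have l : ∀ c : ℝ → ℝ, Continuous c → IntervalIntegrable c volume a b :=
    fun c hc => hc.intervalIntegrable a b
  have eA : ∀ t : ℝ, ∫ x in a..b, (w x + t * h x) ^ 2 = (∫ x in a..b, w x ^ 2) +
      2 * t * (∫ x in a..b, w x * h x) + t ^ 2 * ∫ x in a..b, h x ^ 2 := by
    intro t
    rw [← intervalIntegral.integral_const_mul, ← intervalIntegral.integral_const_mul,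
      ← intervalIntegral.integral_add i1 (i3.const_mul _),
      ← intervalIntegral.integral_add (i1.add (i3.const_mul _)) (i2.const_mul _)]
    congr 1; ext x; ring
  have eB : ∀ t : ℝ, ∫ x in a..b, (w x + t * h x) * (u x + t * g x) ^ 2 =
      (∫ x in a..b, w x * u x ^ 2) +
      t * ((∫ x in a..b, w x * (2 * u x * g x)) + ∫ x in a..b, h x * u x ^ 2) +
      t ^ 2 * ((∫ x in a..b, w x * g x ^ 2) + ∫ x in a..b, h x * (2 * u x * g x)) +
      t ^ 3 * ∫ x in a..b, h x * g x ^ 2 := by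
    intro t
    have w1 := j (fun x => u x ^ 2) (by fun_prop)
    have w2 := j (fun x => 2 * u x * g x) (by fun_prop)
    have w3 := j (fun x => g x ^ 2) (by fun_prop)
    have h1 := k (fun x => u x ^ 2) (by fun_prop)
    have h2 := k (fun x => 2 * u x * g x) (by fun_prop)
    have h3 := k (fun x => g x ^ 2) (by fun_prop)
    rw [← intervalIntegral.integral_add w2 h1, ← intervalIntegral.integral_add w3 h2,
      ← intervalIntegral.integral_const_mul, ← intervalIntegral.integral_const_mul,
      ← intervalIntegral.integral_const_mul,
      ← intervalIntegral.integral_add w1 ((w2.add h1).const_mul _),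
      ← intervalIntegral.integral_add (w1.add ((w2.add h1).const_mul _)) ((w3.add h2).const_mul _),
      ← intervalIntegral.integral_add ((w1.add ((w2.add h1).const_mul _)).add
        ((w3.add h2).const_mul _)) (h3.const_mul _)]
    congr 1; ext x; ring
  have eD : ∀ t : ℝ, ∫ x in a..b, (u x + t * g x) ^ 4 = (∫ x in a..b, u x ^ 4) +
      t * (∫ x in a..b, 4 * u x ^ 3 * g x) + t ^ 2 * (∫ x in a..b, 6 * u x ^ 2 * g x ^ 2) +
      t ^ 3 * (∫ x in a..b, 4 * u x * g x ^ 3) + t ^ 4 * ∫ x in a..b, g x ^ 4 := by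
    intro t
    have d0 := l (fun x => u x ^ 4) (by fun_prop)
    have d1 := l (fun x => 4 * u x ^ 3 * g x) (by fun_prop)
    have d2 := l (fun x => 6 * u x ^ 2 * g x ^ 2) (by fun_prop)
    have d3 := l (fun x => 4 * u x * g x ^ 3) (by fun_prop)
    have d4 := l (fun x => g x ^ 4) (by fun_prop)
    rw [← intervalIntegral.integral_const_mul, ← intervalIntegral.integral_const_mul,
      ← intervalIntegral.integral_const_mul, ← intervalIntegral.integral_const_mul,
      ← intervalIntegral.integral_add d0 (d1.const_mul _),
      ← intervalIntegral.integral_add (d0.add (d1.const_mul _)) (d2.const_mul _),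
      ← intervalIntegral.integral_add ((d0.add (d1.const_mul _)).add (d2.const_mul _))
        (d3.const_mul _),
      ← intervalIntegral.integral_add (((d0.add (d1.const_mul _)).add (d2.const_mul _)).add
        (d3.const_mul _)) (d4.const_mul _)]
    congr 1; ext x; ring
  have key := linear_coeff_eq_zero
    (a := 2 * (∫ x in a..b, w x * h x) -
      ((∫ x in a..b, w x * (2 * u x * g x)) + ∫ x in a..b, h x * u x ^ 2) -
      m * ∫ x in a..b, 4 * u x ^ 3 * g x)
    (b := (∫ x in a..b, h x ^ 2) -
      ((∫ x in a..b, w x * g x ^ 2) + ∫ x in a..b, h x * (2 * u x * g x)) -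
      m * ∫ x in a..b, 6 * u x ^ 2 * g x ^ 2)
    (c := -(∫ x in a..b, h x * g x ^ 2) - m * ∫ x in a..b, 4 * u x * g x ^ 3)
    (d := -m * ∫ x in a..b, g x ^ 4) (fun t => by
      have := hmin t
      simp only [num, den, eA, eB, eD] at this
      linarith)
  have r1 : ∫ x in a..b, (2 * w x - u x ^ 2) * h x =
      2 * (∫ x in a..b, w x * h x) - ∫ x in a..b, h x * u x ^ 2 := by
    rw [← intervalIntegral.integral_const_mul,
      ← intervalIntegral.integral_sub (i3.const_mul _) (k (fun x => u x ^ 2) (by fun_prop))]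
    congr 1; ext x; ring
  have r2 : ∫ x in a..b, (2 * (w x * u x) + 4 * m * u x ^ 3) * g x =
      (∫ x in a..b, w x * (2 * u x * g x)) + m * ∫ x in a..b, 4 * u x ^ 3 * g x := by
    rw [← intervalIntegral.integral_const_mul,
      ← intervalIntegral.integral_add (j (fun x => 2 * u x * g x) (by fun_prop))
        ((l (fun x => 4 * u x ^ 3 * g x) (by fun_prop)).const_mul _)]
    congr 1; ext x; ring
  rw [r1, r2]
  linarith

theorem sq_intervalIntegrable_add {w c : ℝ → ℝ} (hm : AEStronglyMeasurable w volume)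
    (hs : ∀ a b, IntervalIntegrable (fun x => w x ^ 2) volume a b) (hc : Continuous c) (a b : ℝ) :
    IntervalIntegrable (fun x => (w x + c x) ^ 2) volume a b := by
  have hi := (intervalIntegrable_of_sq hm (hs a b)).mul_continuousOn hc.continuousOn
  refine (((hs a b).add (hi.const_mul 2)).add ((hc.pow 2).intervalIntegrable a b)).congr fun x _ => ?_
  simp only [Pi.pow_apply]; ring

/-- This is how regularity is gained: a continuous representative of the integrand makes the
primitive classically differentiable. -/
theorem hasDerivAt_of_ae_eq {F f c : ℝ → ℝ} (hF : ∀ a b, F b - F a = ∫ x in a..b, f x)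
    (hc : Continuous c) {a b : ℝ} (hfc : ∀ᵐ x, x ∈ Ioc a b → f x = c x) {x : ℝ}
    (hx : x ∈ Ioo a b) : HasDerivAt F (c x) x := by
  have h1 := (hasDerivAt_primitive hc x x).const_add (F x)
  refine h1.congr_of_eventuallyEq ?_
  filter_upwards [Ioo_mem_nhds hx.1 hx.2] with y hy
  have : ∫ t in x..y, f t = ∫ t in x..y, c t := by
    refine intervalIntegral.integral_congr_ae ?_
    filter_upwards [hfc] with t ht hxy
    refine ht ⟨?_, ?_⟩
    · exact lt_of_le_of_lt (le_min hx.1.le hy.1.le) hxy.1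
    · exact hxy.2.trans (max_le hx.2.le hy.2.le)
  rw [← this, ← hF]; ring

/-- A locally square integrable function that is orthogonal to all second derivatives of functions
vanishing to first order at the ends is affine. -/
theorem ae_affine_of_orthogonal {K : ℝ → ℝ} (hm : AEStronglyMeasurable K volume)
    (hs : ∀ a b, IntervalIntegrable (fun x => K x ^ 2) volume a b) {a b : ℝ} (hab : a < b)
    (hK : ∀ g q h : ℝ → ℝ, IsH2 g q h → g a = 0 → q a = 0 → g b = 0 → q b = 0 →
      ∫ x in a..b, K x * h x = 0) :
    ∃ α β : ℝ, ∀ᵐ x, x ∈ Ioc a b → K x = α + β * (x - a) := by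
  have hi := intervalIntegrable_of_sq hm (hs a b)
  set L := b - a
  have hL : 0 < L := sub_pos.2 hab
  set k0 := ∫ x in a..b, K x
  set k1 := ∫ x in a..b, K x * (x - a)
  -- `α + β (x - a)` is the `L²` projection of `K` onto affine functions. The remainder `h` then has
  -- zero mean and first moment, which is exactly what makes its double primitive vanish to first
  -- order at `b` too; testing with that primitive gives `∫ h² = 0`.
  set β := 12 * (k1 - L * k0 / 2) / L ^ 3
  set α := k0 / L - β * L / 2
  have cl : Continuous fun x : ℝ => -(α + β * (x - a)) := by fun_prop
  set h : ℝ → ℝ := fun x => K x + -(α + β * (x - a))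
  have hhm : AEStronglyMeasurable h volume := hm.add cl.aestronglyMeasurable
  have hhs : ∀ a b, IntervalIntegrable (fun x => h x ^ 2) volume a b :=
    sq_intervalIntegrable_add hm hs cl
  have hH := IsH2.mk_of hhm hhs a 0 0
  simp only [zero_add] at hH
  have hi2 : IntervalIntegrable (fun x => K x * (x - a)) volume a b :=
    hi.mul_continuousOn (by fun_prop)
  have m0 : ∫ x in a..b, h x = 0 := by
    simp only [h]
    rw [intervalIntegral.integral_add hi (cl.intervalIntegrable _ _),
      ← sub_eq_integral (F := fun x => -(α * (x - a) + β / 2 * (x - a) ^ 2)) cl]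
    · have e : α * L + β / 2 * L ^ 2 = k0 := by simp only [α]; field_simp; ring
      simp only [sub_self]
      linarith
    · intro x
      have d := (hasDerivAt_id x).sub_const a
      have := ((d.const_mul α).fun_add ((d.fun_pow 2).const_mul (β / 2))).fun_neg
      convert! this using 1
      simp; ring
  have m1 : ∫ x in a..b, h x * (x - a) = 0 := by
    have e0 : ∀ x, h x * (x - a) = K x * (x - a) + -(α + β * (x - a)) * (x - a) := fun x => by
      simp only [h]; ring
    have cl2 : Continuous fun x : ℝ => -(α + β * (x - a)) * (x - a) := by fun_prop
    simp only [e0]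
    rw [intervalIntegral.integral_add hi2 (cl2.intervalIntegrable _ _),
      ← sub_eq_integral (F := fun x => -(α / 2 * (x - a) ^ 2 + β / 3 * (x - a) ^ 3)) cl2]
    · have e : α / 2 * L ^ 2 + β / 3 * L ^ 3 = k1 := by simp only [α, β]; field_simp; ring
      simp only [sub_self]
      linarith
    · intro x
      have d := (hasDerivAt_id x).sub_const a
      have := (((d.fun_pow 2).const_mul (α / 2)).fun_add ((d.fun_pow 3).const_mul (β / 3))).fun_neg
      convert! this using 1
      simp; ring
  have hgb : ∫ t in a..b, ∫ s in a..t, h s = 0 := by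
    have := integral_mul_primitive_parts (g := fun x => x - a) (g' := fun _ => 1) hH.w_int hH.der
      (fun a b => intervalIntegrable_const) (fun c d => by simp) a b
    simp only [mul_one, m0, m1, intervalIntegral.integral_same] at this
    simpa using this
  have horth := hK _ _ _ hH (by simp) (by simp) hgb m0
  have hsq0 : ∫ x in a..b, h x ^ 2 = 0 := by
    have e : ∀ x, h x ^ 2 = K x * h x - (α * h x + β * (h x * (x - a))) := fun x => by
      simp only [h]; ring
    have i1 := hH.w_int a b
    have i2 : IntervalIntegrable (fun x => h x * (x - a)) volume a b :=
      i1.mul_continuousOn (by fun_prop)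
    have i3 : IntervalIntegrable (fun x => K x * h x) volume a b := by
      refine ((hhs a b).add ((i1.const_mul α).add (i2.const_mul β))).congr fun x _ => ?_
      simp only [h]; ring
    simp only [e]
    rw [intervalIntegral.integral_sub i3 ((i1.const_mul α).add (i2.const_mul β)),
      intervalIntegral.integral_add (i1.const_mul α) (i2.const_mul β),
      intervalIntegral.integral_const_mul, intervalIntegral.integral_const_mul, m0, m1, horth]
    ring
  refine ⟨α, β, ?_⟩
  rw [intervalIntegral.integral_of_le hab.le, integral_eq_zero_iff_of_nonneg
    (fun x => sq_nonneg _) ((intervalIntegrable_iff_integrableOn_Ioc_of_le hab.le).1 (hhs a b))]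
    at hsq0
  filter_upwards [(ae_restrict_iff' measurableSet_Ioc).1 hsq0] with x hx hxm
  have := hx hxm
  simp only [Pi.zero_apply, h] at this
  have := pow_eq_zero_iff (two_ne_zero) |>.1 this
  linarith

/-- The Euler–Lagrange equation for a minimizer with respect to perturbations that vanish to first
order at the ends of the interval. -/
theorem euler_lagrange {u p w : ℝ → ℝ} (hu : IsH2 u p w) {a b m : ℝ} (hab : a < b)
    (hmin : ∀ g q h : ℝ → ℝ, IsH2 g q h → g a = 0 → q a = 0 → g b = 0 → q b = 0 →
      num a b u w - m * den a b u ≤ num a b (fun x => u x + g x) (fun x => w x + h x) -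
        m * den a b (fun x => u x + g x)) :
    ∃ W W' : ℝ → ℝ, ∀ x ∈ Ioo a b, HasDerivAt p (W x) x ∧ HasDerivAt W (W' x) x ∧
      HasDerivAt W' (2 * u x * W x + p x ^ 2 + 2 * m * u x ^ 3) x := by
  have cu := hu.u_cont
  have cp := hu.p_cont
  -- With `G` the double primitive of `f`, two integrations by parts turn the first variation into
  -- orthogonality of `2w - u² - G` to all admissible second derivatives, so this function is affine
  -- (du Bois-Reymond).
  set f : ℝ → ℝ := fun x => 2 * (w x * u x) + 4 * m * u x ^ 3
  have hf : ∀ a b, IntervalIntegrable f volume a b := fun a b =>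
    ((hu.w_mul_int cu a b).const_mul 2).add
      (Continuous.intervalIntegrable (by fun_prop) a b)
  set G' : ℝ → ℝ := fun x => ∫ t in a..x, f t
  have hG' : ∀ c d, G' d - G' c = ∫ x in c..d, f x := fun c d =>
    intervalIntegral.integral_interval_sub_left (hf _ _) (hf _ _)
  have cG' : Continuous G' := intervalIntegral.continuous_primitive hf a
  set G : ℝ → ℝ := fun x => ∫ t in a..x, G' t
  have dG : ∀ x, HasDerivAt G (G' x) x := hasDerivAt_primitive cG' a
  have cG : Continuous G := continuous_iff_continuousAt.2 fun x => (dG x).continuousAt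
  have cK : Continuous fun x => -(u x ^ 2 + G x) := by fun_prop
  have h2 := hu.smul 2
  obtain ⟨α, β, hK⟩ := ae_affine_of_orthogonal (K := fun x => 2 * w x + -(u x ^ 2 + G x))
    (h2.meas.add cK.aestronglyMeasurable) (sq_intervalIntegrable_add h2.meas h2.sq cK) hab
    (fun g q h hg ga qa gb qb => by
      have fv := first_variation hu hg (a := a) (b := b) (m := m) (fun t =>
        hmin _ _ _ (hg.smul t) (by simp [ga]) (by simp [qa]) (by simp [gb]) (by simp [qb]))
      have p1 := integral_mul_primitive_parts hg.p_cont.intervalIntegrable hg.u_sub hf hG' a b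
      have p2 := integral_mul_primitive_parts cG'.intervalIntegrable (sub_eq_integral cG' dG)
        hg.w_int hg.der a b
      rw [ga, gb] at p1
      rw [qa, qb] at p2
      have e1 : ∫ x in a..b, f x * g x = ∫ x in a..b, g x * f x := by simp only [mul_comm]
      have e2 : ∫ x in a..b, G' x * q x = ∫ x in a..b, q x * G' x := by simp only [mul_comm]
      have e3 : ∀ x, (2 * w x + -(u x ^ 2 + G x)) * h x =
        (2 * w x - u x ^ 2) * h x - G x * h x := fun x => by ring
      simp only [e3]
      have i1 : IntervalIntegrable (fun x => G x * h x) volume a b :=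
        (hg.w_int a b).continuousOn_mul cG.continuousOn
      have i2 : IntervalIntegrable (fun x => (2 * w x - u x ^ 2) * h x) volume a b := by
        have j1 := ((hu.add hg).sq a b).sub ((hu.sq a b).add (hg.sq a b))
        have j2 := hg.w_mul_int (f := fun x => u x ^ 2) (by fun_prop) a b
        refine (j1.sub j2).congr fun x _ => ?_
        ring
      rw [intervalIntegral.integral_sub i2 i1, fv]
      change (∫ x in a..b, f x * g x) - _ = 0
      rw [e1, p1, ← e2, p2]
      ring)
  -- The continuous representative of `u''`. Substituting it into `f` makes `G` twice classically
  -- differentiable, and hence `W` as well.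
  set W : ℝ → ℝ := fun x => (u x ^ 2 + G x + (α + β * (x - a))) / 2
  have cW : Continuous W := by fun_prop
  have hwW : ∀ᵐ x, x ∈ Ioc a b → w x = W x := by
    filter_upwards [hK] with x hx hxm
    have := hx hxm
    simp only [W]; linarith
  refine ⟨W, fun x => (2 * u x * p x + G' x + β) / 2, fun x hx =>
    ⟨hasDerivAt_of_ae_eq hu.der cW hwW hx, ?_, ?_⟩⟩
  · have d := (hasDerivAt_id x).sub_const a
    have := ((((hu.hasDeriv x).fun_pow 2).fun_add (dG x)).fun_add
      ((d.const_mul β).const_add α)).div_const 2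
    convert! this using 1
    simp
  · have dG2 : HasDerivAt G' (2 * (W x * u x) + 4 * m * u x ^ 3) x := by
      refine hasDerivAt_of_ae_eq (c := fun x => 2 * (W x * u x) + 4 * m * u x ^ 3) hG'
        (by fun_prop) (a := a) (b := b) ?_ hx
      filter_upwards [hwW] with y hy hym
      simp only [f, hy hym]
    have dp := hasDerivAt_of_ae_eq hu.der cW hwW hx
    have := (((((hu.hasDeriv x).fun_mul dp).const_mul 2).fun_add dG2).add_const β).div_const 2
    convert! this using 1
    · ext y; ring
    · ring

/-- Phrasing the equation with `deriv p` removes the dependence of `W` on the interval, so local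
statements around different points can be combined. -/
theorem euler_lagrange_deriv {u p w : ℝ → ℝ} (hu : IsH2 u p w) {a b m : ℝ} (hab : a < b)
    (hmin : ∀ g q h : ℝ → ℝ, IsH2 g q h → g a = 0 → q a = 0 → g b = 0 → q b = 0 →
      num a b u w - m * den a b u ≤ num a b (fun x => u x + g x) (fun x => w x + h x) -
        m * den a b (fun x => u x + g x)) {x : ℝ} (hx : x ∈ Ioo a b) :
    HasDerivAt p (deriv p x) x ∧ HasDerivAt (deriv p) (deriv (deriv p) x) x ∧
      HasDerivAt (deriv (deriv p)) (2 * u x * deriv p x + p x ^ 2 + 2 * m * u x ^ 3) x := by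
  obtain ⟨W, W', h⟩ := euler_lagrange hu hab hmin
  have e1 : ∀ y ∈ Ioo a b, deriv p y = W y := fun y hy => (h y hy).1.deriv
  have e1' : ∀ y ∈ Ioo a b, deriv p =ᶠ[nhds y] W := fun y hy => by
    filter_upwards [Ioo_mem_nhds hy.1 hy.2] with z hz using e1 z hz
  have e2 : ∀ y ∈ Ioo a b, HasDerivAt (deriv p) (W' y) y := fun y hy =>
    (h y hy).2.1.congr_of_eventuallyEq (e1' y hy)
  have e3 : deriv (deriv p) =ᶠ[nhds x] W' := by
    filter_upwards [Ioo_mem_nhds hx.1 hx.2] with z hz using (e2 z hz).deriv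
  refine ⟨(h x hx).1.differentiableAt.hasDerivAt, (e2 x hx).differentiableAt.hasDerivAt, ?_⟩
  rw [e1 x hx]
  exact (h x hx).2.2.congr_of_eventuallyEq e3

/-! ### Energy, and exclusion of increasing solutions on a half line -/

theorem monotoneOn_of_hasDerivAt {D : Set ℝ} (hD : Convex ℝ D) {f f' : ℝ → ℝ}
    (hf : ∀ x ∈ D, HasDerivAt f (f' x) x) (h0 : ∀ x ∈ D, 0 ≤ f' x) : MonotoneOn f D :=
  monotoneOn_of_deriv_nonneg hD (fun x hx => (hf x hx).continuousAt.continuousWithinAt)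
    (fun x hx => (hf x (interior_subset hx)).differentiableAt.differentiableWithinAt)
    fun x hx => by rw [(hf x (interior_subset hx)).deriv]; exact h0 x (interior_subset hx)

/-- The energy associated with the Euler–Lagrange equation is conserved. -/
theorem hasDerivAt_energy {u p W W' : ℝ → ℝ} {m x : ℝ} (hu : HasDerivAt u (p x) x)
    (hp : HasDerivAt p (W x) x) (hW : HasDerivAt W (W' x) x)
    (hW' : HasDerivAt W' (2 * u x * W x + p x ^ 2 + 2 * m * u x ^ 3) x) :
    HasDerivAt (fun y => W' y * p y - W y ^ 2 / 2 - u y * p y ^ 2 - m * u y ^ 4 / 2) 0 x := by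
  have := (((hW'.fun_mul hp).fun_sub ((hW.fun_pow 2).div_const 2)).fun_sub
    (hu.fun_mul (hp.fun_pow 2))).fun_sub (((hu.fun_pow 4).const_mul m).div_const 2)
  convert! this using 1
  push_cast
  ring

open Filter Topology in
/-- The Euler–Lagrange equation has no nonpositive strictly increasing solution of finite energy
on a half line. -/
theorem no_half_line_solution {u p W W' : ℝ → ℝ} {m : ℝ} (hm : m < 0)
    (hlim : Tendsto (fun x => |u x| + |p x|) atTop (𝓝 0)) (hu0 : ∀ x, 0 < x → u x ≤ 0)
    (hp0 : ∀ x, 0 < x → 0 < p x)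
    (hu : ∀ x, 0 < x → HasDerivAt u (p x) x)
    (hp : ∀ x, 0 < x → HasDerivAt p (W x) x)
    (hW : ∀ x, 0 < x → HasDerivAt W (W' x) x)
    (hW' : ∀ x, 0 < x → HasDerivAt W' (2 * u x * W x + p x ^ 2 + 2 * m * u x ^ 3) x) : False := by
  set E : ℝ → ℝ := fun y => W' y * p y - W y ^ 2 / 2 - u y * p y ^ 2 - m * u y ^ 4 / 2
  have hE : ∀ x, 0 < x → HasDerivAt E 0 x := fun x hx =>
    hasDerivAt_energy (hu x hx) (hp x hx) (hW x hx) (hW' x hx)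
  have hconst : ∀ x, 0 < x → E x = E 1 := by
    intro x hx
    have h1 := monotoneOn_of_hasDerivAt (convex_Ioi 0) (f := E) (f' := fun _ => 0) (fun y hy => hE y hy)
      (fun _ _ => le_rfl)
    have h2 := monotoneOn_of_hasDerivAt (convex_Ioi 0) (f := fun y => -E y) (f' := fun _ => 0)
      (fun y hy => by simpa using (hE y hy).fun_neg) (fun _ _ => le_rfl)
    rcases le_total x 1 with h | h
    · have a1 := h1 (mem_Ioi.2 hx) (mem_Ioi.2 one_pos) h
      have a2 := h2 (mem_Ioi.2 hx) (mem_Ioi.2 one_pos) h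
      simp only at a2
      linarith
    · have a1 := h1 (mem_Ioi.2 one_pos) (mem_Ioi.2 hx) h
      have a2 := h2 (mem_Ioi.2 one_pos) (mem_Ioi.2 hx) h
      simp only at a2
      linarith
  -- If the energy were positive, smallness of `u` and `p` would give `(W p)' = W' p + W² ≥ E / 2`
  -- eventually; then `W p` exceeds 1 and `p²` grows linearly, against `p → 0`.
  have hE0 : E 1 ≤ 0 := by
    by_contra! hpos
    have hδ : 0 < E 1 / (2 * (1 + |m|)) := by positivity
    obtain ⟨x₀, hx₀⟩ := eventually_atTop.1 ((hlim.eventually (gt_mem_nhds one_pos)).and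
      (hlim.eventually (gt_mem_nhds hδ)))
    set x₁ := max x₀ 1
    have hx₁ : 0 < x₁ := one_pos.trans_le (le_max_right _ _)
    have hd : ∀ x, x₁ ≤ x → E 1 / 2 ≤ W' x * p x + W x * W x := by
      intro x hx
      obtain ⟨b1, b2⟩ := hx₀ x ((le_max_left _ _).trans hx)
      have e := hconst x (hx₁.trans_le hx)
      simp only [E] at e
      rw [lt_div_iff₀ (by positivity)] at b2
      have c1 : |u x * p x ^ 2| ≤ |u x| := by
        rw [abs_mul, abs_pow]
        exact mul_le_of_le_one_right (abs_nonneg _)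
          (pow_le_one₀ (abs_nonneg _) (by linarith [abs_nonneg (u x)]))
      have c2 : |m * u x ^ 4| ≤ |m| * |u x| := by
        rw [abs_mul, abs_pow]
        gcongr
        exact pow_le_of_le_one (abs_nonneg _) (by linarith [abs_nonneg (p x)]) (by norm_num)
      have c3 := neg_abs_le (u x * p x ^ 2)
      have c4 := neg_abs_le (m * u x ^ 4)
      have c5 : 0 ≤ |p x| * (1 + |m|) := by positivity
      have c6 : 0 ≤ |u x| * |m| := by positivity
      have c7 := sq_nonneg (W x)
      have c8 : E 1 = W' x * p x - W x ^ 2 / 2 - u x * p x ^ 2 - m * u x ^ 4 / 2 := e.symm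
      nlinarith
    have mono1 : MonotoneOn (fun x => W x * p x - E 1 / 2 * x) (Ici x₁) :=
      monotoneOn_of_hasDerivAt (convex_Ici _) (f' := fun x => (W' x * p x + W x * W x) - E 1 / 2)
        (fun x hx => by
          have hx' := hx₁.trans_le hx
          simpa using ((hW x hx').fun_mul (hp x hx')).fun_sub ((hasDerivAt_id x).const_mul (E 1 / 2)))
        (fun x hx => by linarith [hd x hx])
    set x₂ := max x₁ (x₁ + (1 - W x₁ * p x₁) / (E 1 / 2))
    have hx₂ : x₁ ≤ x₂ := le_max_left _ _
    have hWp : ∀ x, x₂ ≤ x → 1 ≤ W x * p x := by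
      intro x hx
      have h1 := mono1 (mem_Ici.2 le_rfl) (mem_Ici.2 (hx₂.trans hx)) (hx₂.trans hx)
      simp only at h1
      have h2 : (1 - W x₁ * p x₁) / (E 1 / 2) ≤ x - x₁ := by
        have := (le_max_right x₁ (x₁ + (1 - W x₁ * p x₁) / (E 1 / 2))).trans hx
        linarith
      rw [div_le_iff₀ (by positivity)] at h2
      linarith
    have mono2 : MonotoneOn (fun x => p x ^ 2 / 2 - x) (Ici x₂) :=
      monotoneOn_of_hasDerivAt (convex_Ici _) (f' := fun x => W x * p x - 1)
        (fun x hx => by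
          have hx' := (hx₁.trans_le hx₂).trans_le hx
          have := (((hp x hx').fun_pow 2).div_const 2).fun_sub (hasDerivAt_id x)
          convert! this using 1
          push_cast; ring)
        (fun x hx => by linarith [hWp x hx])
    have h3 := mono2 (mem_Ici.2 le_rfl) (mem_Ici.2 (by linarith : x₂ ≤ x₂ + 1))
      (by linarith : x₂ ≤ x₂ + 1)
    have h4 := (hx₀ (x₂ + 1) ((le_max_left _ _).trans (hx₂.trans (by linarith)))).1
    have h5 : p (x₂ + 1) ^ 2 ≤ 1 := by
      rw [← sq_abs]
      exact pow_le_one₀ (abs_nonneg _) (by linarith [abs_nonneg (u (x₂ + 1))])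
    simp only at h3
    nlinarith [sq_nonneg (p x₂)]
  have hplim : Tendsto p atTop (𝓝 0) := by
    refine squeeze_zero_norm (fun x => ?_) hlim
    rw [Real.norm_eq_abs]
    linarith [abs_nonneg (u x)]
  -- Otherwise the positive function `p` would be nondecreasing and could not tend to zero.
  obtain ⟨x₁, hx₁, hWneg⟩ : ∃ x, 0 < x ∧ W x < 0 := by
    by_contra! hc
    have mono := monotoneOn_of_hasDerivAt (convex_Ioi 0) (f := p) (f' := W) (fun x hx => hp x hx)
      (fun x hx => hc x hx)
    have : p 1 ≤ 0 := ge_of_tendsto hplim (by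
      filter_upwards [eventually_ge_atTop 1] with x hx
      exact mono (mem_Ioi.2 one_pos) (mem_Ioi.2 (one_pos.trans_le hx)) hx)
    exact absurd (hp0 1 one_pos) (not_lt.2 this)
  have hs : ∀ x, 0 < x → HasDerivAt (fun y => √(p y)) (W x / (2 * √(p x))) x := fun x hx =>
    (hp x hx).sqrt (hp0 x hx).ne'
  -- Concavity of `√p`: nonpositive energy together with `u ≤ 0` and `m < 0` gives `W' p - W² / 2 =
  -- E + u p² + m u⁴ / 2 ≤ 0`, and `W / √p` is twice the derivative of `√p`.
  have mono3 : MonotoneOn (fun x => -(W x / √(p x))) (Ici x₁) := by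
    refine monotoneOn_of_hasDerivAt (convex_Ici _) (f' := fun x =>
      -((W' x * √(p x) - W x * (W x / (2 * √(p x)))) / √(p x) ^ 2)) (fun x hx => ?_) fun x hx => ?_
    · have hx' := hx₁.trans_le hx
      exact ((hW x hx').fun_div (hs x hx') (Real.sqrt_pos.2 (hp0 x hx')).ne').fun_neg
    · have hx' := hx₁.trans_le hx
      have sp := Real.sqrt_pos.2 (hp0 x hx')
      have sq := Real.sq_sqrt (hp0 x hx').le
      rw [neg_nonneg]
      refine div_nonpos_of_nonpos_of_nonneg ?_ (sq_nonneg _)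
      have e : W' x * √(p x) - W x * (W x / (2 * √(p x))) =
          (W' x * √(p x) ^ 2 - W x ^ 2 / 2) / √(p x) := by field_simp
      rw [e, sq]
      refine div_nonpos_of_nonpos_of_nonneg ?_ sp.le
      have e1 := hconst x hx'
      have e2 : E x = W' x * p x - W x ^ 2 / 2 - u x * p x ^ 2 - m * u x ^ 4 / 2 := rfl
      have e3 : u x * p x ^ 2 ≤ 0 := mul_nonpos_of_nonpos_of_nonneg (hu0 x hx') (sq_nonneg _)
      have e4 : m * u x ^ 4 ≤ 0 := mul_nonpos_of_nonpos_of_nonneg hm.le (by positivity)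
      linarith
  set c := -(W x₁ / √(p x₁))
  have hc : 0 < c := neg_pos.2 (div_neg_of_neg_of_pos hWneg (Real.sqrt_pos.2 (hp0 x₁ hx₁)))
  -- A concave function with a negative slope at `x₁` would become negative in finite time, which
  -- `√p` cannot.
  have mono4 : MonotoneOn (fun x => -√(p x) - c / 2 * x) (Ici x₁) := by
    refine monotoneOn_of_hasDerivAt (convex_Ici _) (f' := fun x => -(W x / (2 * √(p x))) - c / 2)
      (fun x hx => ?_) fun x hx => ?_
    · have hx' := hx₁.trans_le hx
      simpa using (hs x hx').fun_neg.fun_sub ((hasDerivAt_id x).const_mul (c / 2))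
    · have h1 := mono3 (mem_Ici.2 le_rfl) hx hx
      have e : W x / (2 * √(p x)) = W x / √(p x) / 2 := by rw [div_div, mul_comm]
      rw [e]
      simp only at h1
      linarith
  have hx₂ : x₁ ≤ x₁ + (√(p x₁) + 1) / (c / 2) := by
    have : 0 ≤ (√(p x₁) + 1) / (c / 2) := by positivity
    linarith
  have h6 := mono4 (mem_Ici.2 le_rfl) (mem_Ici.2 hx₂) hx₂
  simp only at h6
  have h7 : c / 2 * ((√(p x₁) + 1) / (c / 2)) = √(p x₁) + 1 := mul_div_cancel₀ _ (by positivity)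
  have h8 := Real.sqrt_nonneg (p (x₁ + (√(p x₁) + 1) / (c / 2)))
  rw [mul_add, h7] at h6
  linarith

/-! ### Extension of perturbations by zero -/

/-- A function vanishing to first order at `a` and `b` can be continued by zero. -/
theorem exists_zero_extension {g q h : ℝ → ℝ} (hg : IsH2 g q h) {a b : ℝ} (hab : a ≤ b)
    (ga : g a = 0) (qa : q a = 0) (gb : g b = 0) (qb : q b = 0) :
    ∃ v r z : ℝ → ℝ, IsH2 v r z ∧ (∀ x ∈ Icc a b, v x = g x) ∧ (∀ x ∈ Ioc a b, z x = h x) ∧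
      (∀ x, x ≤ a → v x = 0 ∧ r x = 0 ∧ z x = 0) ∧ (∀ x, b ≤ x → v x = 0 ∧ r x = 0) ∧
      ∀ x, b < x → z x = 0 := by
  let z := (Ioc a b).indicator h
  have hm : AEStronglyMeasurable z volume := hg.meas.indicator measurableSet_Ioc
  have hs : ∀ c d, IntervalIntegrable (fun x => z x ^ 2) volume c d := by
    intro c d
    refine (hg.sq c d).mono_fun (hm.pow 2).restrict (Filter.Eventually.of_forall fun x => ?_)
    by_cases hx : x ∈ Ioc a b
    · simp [z, hx]
    · simp [z, hx]; positivity
  have hH := IsH2.mk_of hm hs a 0 0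
  simp only [zero_add] at hH
  have hr : ∀ x ∈ Icc a b, ∫ t in a..x, z t = q x := by
    intro x hx
    have : ∫ t in a..x, z t = ∫ t in a..x, h t := by
      refine intervalIntegral.integral_congr_ae (Filter.Eventually.of_forall fun t ht => ?_)
      rw [uIoc_of_le hx.1] at ht
      simp [z, ht.1, ht.2.trans hx.2]
    rw [this, ← hg.der, qa, sub_zero]
  have hra : ∀ x, x ≤ a → ∫ t in a..x, z t = 0 := by
    intro x hx
    refine intervalIntegral.integral_zero_ae (Filter.Eventually.of_forall fun t ht => ?_)
    rw [uIoc_of_ge hx] at ht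
    simp [z, ht.2]
  have hrb : ∀ x, b ≤ x → ∫ t in a..x, z t = 0 := by
    intro x hx
    rw [← intervalIntegral.integral_add_adjacent_intervals (hH.w_int a b) (hH.w_int b x),
      hr b ⟨hab, le_rfl⟩, qb, zero_add]
    refine intervalIntegral.integral_zero_ae (Filter.Eventually.of_forall fun t ht => ?_)
    rw [uIoc_of_le hx] at ht
    simp [z, ht.1]
  have hv : ∀ x ∈ Icc a b, ∫ t in a..x, ∫ s in a..t, z s = g x := by
    intro x hx
    have : ∫ t in a..x, ∫ s in a..t, z s = ∫ t in a..x, q t := by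
      refine intervalIntegral.integral_congr fun t ht => ?_
      rw [uIcc_of_le hx.1] at ht
      exact hr t ⟨ht.1, ht.2.trans hx.2⟩
    rw [this, ← hg.u_sub, ga, sub_zero]
  refine ⟨_, _, z, hH, hv, fun x hx => by simp [z, hx.1, hx.2], fun x hx =>
    ⟨?_, hra x hx, by simp [z, hx]⟩, fun x hx => ⟨?_, hrb x hx⟩, fun x hx => by simp [z, hx]⟩
  · refine intervalIntegral.integral_zero_ae (Filter.Eventually.of_forall fun t ht => ?_)
    rw [uIoc_of_ge hx] at ht
    exact hra t ht.2
  · rw [← intervalIntegral.integral_add_adjacent_intervals (hH.p_cont.intervalIntegrable a b)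
      (hH.p_cont.intervalIntegrable b x), hv b ⟨hab, le_rfl⟩, gb, zero_add]
    refine intervalIntegral.integral_zero_ae (Filter.Eventually.of_forall fun t ht => ?_)
    rw [uIoc_of_le hx] at ht
    exact hrb t ht.1.le

/-! ### Normalized increasing pieces and the minimizing sequence -/

/-- The square of the negative part is `C¹`, so `u u'` can be integrated over `{u ≤ 0}` without
locating the zero of `u`. -/
theorem hasDerivAt_min_zero_sq (t : ℝ) : HasDerivAt (fun s : ℝ => min s 0 ^ 2) (2 * min t 0) t := by
  have h := hasDerivAt_primitive (f := fun s : ℝ => 2 * min s 0) (by fun_prop) 0 t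
  convert! h using 1
  ext x
  rcases le_total 0 x with hx | hx
  · rw [min_eq_right hx, intervalIntegral.integral_congr (g := fun _ => (0 : ℝ))]
    · simp
    · intro s hs
      rw [uIcc_of_le hx] at hs
      simp [min_eq_right hs.1]
  · rw [min_eq_left hx, intervalIntegral.integral_congr (g := fun s => 2 * s)]
    · rw [intervalIntegral.integral_const_mul, integral_id]; ring
    · intro s hs
      rw [uIcc_of_ge hx] at hs
      simp [min_eq_left hs.2]

theorem monotoneOn_of_p_nonneg {u p w : ℝ → ℝ} (h : IsH2 u p w) {D : Set ℝ} (hD : Convex ℝ D)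
    (hp : ∀ x ∈ D, 0 ≤ p x) : MonotoneOn u D :=
  monotoneOn_of_hasDerivAt hD (fun x _ => h.hasDeriv x) hp

theorem nonneg_on_Icc_of_Ioo {p : ℝ → ℝ} {a b : ℝ} (ha : p a = 0) (hb : p b = 0)
    (hp : ∀ x ∈ Ioo a b, 0 < p x) : ∀ x ∈ Icc a b, 0 ≤ p x := by
  intro x hx
  rcases hx.1.eq_or_lt with rfl | h1
  · exact ha.ge
  rcases hx.2.eq_or_lt with rfl | h2
  · exact hb.ge
  exact (hp x ⟨h1, h2⟩).le

/-- Normalization of an increasing function with negative quotient: the minimum is `-1`,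
attained at `0`. -/
theorem exists_normalized {u p w : ℝ → ℝ} {a b r : ℝ} (h : IsH2 u p w) (hab : a < b)
    (ha : p a = 0) (hb : p b = 0) (hp : ∀ x ∈ Ioo a b, 0 < p x) (hr : r < 0)
    (hn : num a b u w ≤ r * den a b u) :
    ∃ (v q z : ℝ → ℝ) (L : ℝ), IsH2 v q z ∧ 0 < L ∧ q 0 = 0 ∧ q L = 0 ∧
      (∀ x ∈ Ioo 0 L, 0 < q x) ∧ v 0 = -1 ∧ num 0 L v z ≤ r * den 0 L v := by
  have hmono := monotoneOn_of_p_nonneg h (convex_Icc a b) (nonneg_on_Icc_of_Ioo ha hb hp)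
  -- If `u(a) ≥ 0`, monotonicity gives `u ≥ 0` and a nonnegative numerator. As `r < 0`, the
  -- denominator must then vanish, contradicting `p > 0`.
  have hua : u a < 0 := by
    by_contra! hc
    have h1 : 0 ≤ ∫ x in a..b, u x * p x ^ 2 :=
      intervalIntegral.integral_nonneg hab.le fun x hx => mul_nonneg
        (hc.trans (hmono ⟨le_rfl, hab.le⟩ hx hx.1)) (sq_nonneg _)
    have h2 : 0 ≤ ∫ x in a..b, w x ^ 2 :=
      intervalIntegral.integral_nonneg hab.le fun x _ => sq_nonneg _
    rw [num_eq_of_neumann h ha hb] at hn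
    have h3 : den a b u ≤ 0 := by
      by_contra! hd
      have := mul_neg_of_neg_of_pos hr hd
      linarith
    have h4 := (eq_zero_on_of_den_eq_zero h hab (le_antisymm h3 (den_nonneg hab.le u))).2
    obtain ⟨x, hx⟩ := exists_between hab
    exact (hp x hx).ne' (h4 x ⟨hx.1.le, hx.2.le⟩)
  set s := 1 / √(-u a)
  have hq : 0 < √(-u a) := Real.sqrt_pos.2 (by linarith)
  have hs : 0 < s := by positivity
  have hs2 : s ^ 2 * u a = -1 := by
    have := Real.sq_sqrt (show 0 ≤ -u a by linarith)
    have hne := hua.ne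
    simp only [s, div_pow, this]
    field_simp
  have eL : s * ((b - a) / s) + a = b := by field_simp; ring
  refine ⟨_, _, _, (b - a) / s, (h.comp_affine hs.ne' a).smul (s ^ 2),
    div_pos (sub_pos.2 hab) hs, by simp [ha], by simp [eL, hb], fun x hx => ?_, by simp [hs2], ?_⟩
  · have : 0 < p (s * x + a) := by
      refine hp _ ⟨by have := mul_pos hs hx.1; linarith, ?_⟩
      have := mul_lt_mul_of_pos_left hx.2 hs
      linarith
    positivity
  · rw [num_affine _ _ _ _ hs.ne', den_affine _ _ _ hs.ne', eL]
    simp only [mul_zero, zero_add]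
    have : 0 < s ^ 7 := by positivity
    nlinarith

/-- A priori bounds for normalized increasing functions with negative numerator. -/
theorem normalized_bounds {u p w : ℝ → ℝ} {L : ℝ} (h : IsH2 u p w) (hL : 0 < L)
    (h0 : p 0 = 0) (h1 : p L = 0) (hp : ∀ x ∈ Ioo 0 L, 0 < p x) (hu : u 0 = -1)
    (hn : num 0 L u w < 0) :
    (∫ x in (0 : ℝ)..L, w x ^ 2) ≤ 2 ∧ -2 ≤ num 0 L u w ∧ 1 ≤ 8 * L ^ 2 ∧
      ∀ c ∈ Icc 0 L, -2 * min (u c) 0 ^ 2 ≤ 2 * ∫ x in c..L, u x * p x ^ 2 := by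
  have hp' := nonneg_on_Icc_of_Ioo h0 h1 hp
  have hmono := monotoneOn_of_p_nonneg h (convex_Icc 0 L) hp'
  have cu := h.u_cont
  have cp := h.p_cont
  have hK : IsCompact (Icc 0 L ∩ {x | u x ≤ 0}) :=
    isCompact_Icc.inter_right (isClosed_le cu continuous_const)
  obtain ⟨y, ⟨hy, hyu⟩, hmax⟩ := hK.exists_isMaxOn ⟨0, ⟨le_rfl, hL.le⟩, by simp [hu]⟩
    (cp.continuousOn)
  set s := p y
  have hs : ∀ x ∈ Icc 0 L, u x ≤ 0 → p x ≤ s := fun x hx hxu => hmax ⟨hx, hxu⟩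
  have hs0 : 0 ≤ s := hp' y hy
  -- Where `u ≤ 0` the slope is at most `s`, so `2 u p² ≥ s (2 u p) = s (min(u, 0)²)'`; elsewhere
  -- the integrand is nonnegative.
  have tail : ∀ c ∈ Icc 0 L, -s * min (u c) 0 ^ 2 ≤ 2 * ∫ x in c..L, u x * p x ^ 2 := by
    intro c hc
    have e := sub_eq_integral (F := fun x => min (u x) 0 ^ 2) (f := fun x => 2 * min (u x) 0 * p x)
      (by fun_prop) (fun x => (hasDerivAt_min_zero_sq (u x)).comp x (h.hasDeriv x)) c L
    have m : ∫ x in c..L, s * (2 * min (u x) 0 * p x) ≤ ∫ x in c..L, 2 * (u x * p x ^ 2) := by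
      refine intervalIntegral.integral_mono_on hc.2 (Continuous.intervalIntegrable (by fun_prop) _ _)
        (Continuous.intervalIntegrable (by fun_prop) _ _) fun x hx => ?_
      have hx' : x ∈ Icc 0 L := ⟨hc.1.trans hx.1, hx.2⟩
      have px := hp' x hx'
      rcases le_total (u x) 0 with h2 | h2
      · rw [min_eq_left h2]
        have : u x * p x * s ≤ u x * p x * p x :=
          mul_le_mul_of_nonpos_left (hs x hx' h2) (mul_nonpos_of_nonpos_of_nonneg h2 px)
        nlinarith
      · rw [min_eq_right h2]
        have : 0 ≤ 2 * (u x * p x ^ 2) := by positivity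
        linarith
    rw [intervalIntegral.integral_const_mul, ← e, intervalIntegral.integral_const_mul] at m
    have : 0 ≤ s * min (u L) 0 ^ 2 := by positivity
    linarith
  have t0 := tail 0 ⟨le_rfl, hL.le⟩
  rw [hu] at t0
  norm_num at t0
  have hA0 : 0 ≤ ∫ x in (0 : ℝ)..L, w x ^ 2 :=
    intervalIntegral.integral_nonneg hL.le fun x _ => sq_nonneg _
  rw [num_eq_of_neumann h h0 h1] at hn ⊢
  set A := ∫ x in (0 : ℝ)..L, w x ^ 2
  -- At the maximum point `y` of the slope, `s² = 2 ∫ w p ≤ A + s (u(y) + 1) ≤ A + s`, and the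
  -- negative numerator with the tail bound at 0 gives `A ≤ s`. Hence `s² ≤ 2s`.
  have hs2 : s ≤ 2 := by
    have e1 := p_sq_eq h h0 y
    have e2 : ∫ t in (0 : ℝ)..y, w t * p t ≤
        ∫ t in (0 : ℝ)..y, (1 / 2 * w t ^ 2 + s / 2 * p t) := by
      refine intervalIntegral.integral_mono_on hy.1 (h.w_mul_int cp _ _)
        (((h.sq _ _).const_mul _).add ((cp.intervalIntegrable _ _).const_mul _)) fun t ht => ?_
      have ht' : t ∈ Icc 0 L := ⟨ht.1, ht.2.trans hy.2⟩
      have h3 := hs t ht' ((hmono ht' hy ht.2).trans hyu)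
      have h4 := hp' t ht'
      nlinarith [sq_nonneg (w t - p t)]
    rw [intervalIntegral.integral_add ((h.sq _ _).const_mul _)
      ((cp.intervalIntegrable _ _).const_mul _), intervalIntegral.integral_const_mul,
      intervalIntegral.integral_const_mul, ← h.u_sub, hu] at e2
    have e3 : ∫ t in (0 : ℝ)..y, w t ^ 2 ≤ A :=
      intervalIntegral.integral_mono_interval le_rfl hy.1 hy.2
        (Filter.Eventually.of_forall fun t => sq_nonneg _) (h.sq _ _)
    have e4 : u y ≤ 0 := hyu
    have e5 : s ^ 2 ≤ s + s := by
      change p y ^ 2 ≤ _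
      nlinarith
    nlinarith
  refine ⟨by linarith, by linarith, ?_, fun c hc => ?_⟩
  -- On a shorter interval, `u ≥ -1` and the bound on `p²` give `2 ∫ u p² ≥ -8L²A > -A`, against the
  -- negative numerator.
  · by_contra! hc
    have hA : 0 < A := by
      refine lt_of_le_of_ne hA0 fun hA => ?_
      have := p_sq_le h hL h0 (x := L / 2) ⟨by positivity, by linarith⟩
      change _ ≤ _ * A at this
      rw [← hA, mul_zero] at this
      have h5 := hp (L / 2) ⟨by positivity, by linarith⟩
      nlinarith
    have h2 : ∫ x in (0 : ℝ)..L, (-(4 * L * A)) ≤ ∫ x in (0 : ℝ)..L, u x * p x ^ 2 := by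
      refine intervalIntegral.integral_mono_on hL.le intervalIntegrable_const
        (Continuous.intervalIntegrable (by fun_prop) _ _) fun x hx => ?_
      have h3 := p_sq_le h hL h0 hx
      rw [sub_zero] at h3
      have h4 := hmono ⟨le_rfl, hL.le⟩ hx hx.1
      rw [hu] at h4
      nlinarith [sq_nonneg (p x)]
    rw [intervalIntegral.integral_const, smul_eq_mul, sub_zero] at h2
    nlinarith
  · refine le_trans ?_ (tail c hc)
    nlinarith [sq_nonneg (min (u c) 0)]

/-- An increasing function on `[0, L]`, continued by a constant to the right of `L`, whose
quotient is at most `r`, normalized such that its minimum is `-1`. -/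
structure IsNormalizedPiece (u p w : ℝ → ℝ) (L r : ℝ) : Prop where
  isH2 : IsH2 u p w
  memLp : MemLp w 2 volume
  pos : 0 < L
  p_zero : p 0 = 0
  p_eq_zero : ∀ x, L ≤ x → p x = 0
  p_nonneg : ∀ x, 0 ≤ x → 0 ≤ p x
  u_zero : u 0 = -1
  sq_le : ∫ x, w x ^ 2 ≤ 2
  sq_eq : ∫ x, w x ^ 2 = ∫ x in (0 : ℝ)..L, w x ^ 2
  num_le : num 0 L u w ≤ r * den 0 L u
  num_ge : -2 ≤ num 0 L u w
  one_le : 1 ≤ 8 * L ^ 2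
  tail : ∀ c ∈ Icc 0 L, -2 * min (u c) 0 ^ 2 ≤ 2 * ∫ x in c..L, u x * p x ^ 2

/-- Any competitor with negative quotient yields a normalized piece that is no worse, with bounds
independent of its length. -/
theorem exists_normalizedPiece {u p w : ℝ → ℝ} {r : ℝ} (h : IsH2 u p w) (h0 : p 0 = 0)
    (h1 : p 1 = 0) (hd : 0 < den 0 1 u) (hr : r < 0) (hn : num 0 1 u w = r * den 0 1 u) :
    ∃ (v q z : ℝ → ℝ) (L : ℝ), IsNormalizedPiece v q z L r := by
  have hneg : num 0 1 u w < 0 := by rw [hn]; exact mul_neg_of_neg_of_pos hr hd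
  obtain ⟨u₁, p₁, w₁, a, b, h₁, hab, ha, hb, hpos, hn₁⟩ := exists_increasing_piece h h0 h1 hneg hn.le
  obtain ⟨u₂, p₂, w₂, L, h₂, hL, h20, h2L, hpos₂, hu₂, hn₂⟩ :=
    exists_normalized h₁ hab ha hb hpos hr hn₁
  have hd₂ : 0 < den 0 L u₂ := den_pos hL h₂.u_cont (x := 0) ⟨le_rfl, hL.le⟩ (by rw [hu₂]; norm_num)
  obtain ⟨b1, b2, b3, b4⟩ := normalized_bounds h₂ hL h20 h2L hpos₂ hu₂
    (hn₂.trans_lt (mul_neg_of_neg_of_pos hr hd₂))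
  obtain ⟨v, q, z, hv, hz, e1, e2, e3, e4, e5, e6⟩ := exists_const_extension h₂ hL.le h20 h2L
  have hnum := num_congr hL.le e1 e3
  have hden := den_congr hL.le e1
  refine ⟨v, q, z, L, hv, hz, hL, ?_, e4, fun x hx => ?_, ?_, by rwa [e6], ?_, by rwa [hnum, hden],
    by rwa [hnum], b3, fun c hc => ?_⟩
  · rw [e2 0 ⟨le_rfl, hL.le⟩, h20]
  · rcases le_total x L with hxL | hxL
    · rw [e2 x ⟨hx, hxL⟩]
      exact nonneg_on_Icc_of_Ioo h20 h2L hpos₂ x ⟨hx, hxL⟩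
    · exact (e4 x hxL).ge
  · rw [e1 0 ⟨le_rfl, hL.le⟩, hu₂]
  · rw [e6]
    refine intervalIntegral.integral_congr_ae (Filter.Eventually.of_forall fun x hx => ?_)
    rw [uIoc_of_le hL.le] at hx
    rw [e3 x hx]
  · have : ∫ x in c..L, v x * q x ^ 2 = ∫ x in c..L, u₂ x * p₂ x ^ 2 := by
      refine intervalIntegral.integral_congr fun x hx => ?_
      rw [uIcc_of_le hc.2] at hx
      have hx' : x ∈ Icc 0 L := ⟨hc.1.trans hx.1, hx.2⟩
      simp only [e1 x hx', e2 x hx']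
    rw [this, e1 c hc]
    exact b4 c hc

-- The margin `r n ≤ m / 2` keeps the quotients away from zero, so the lower bound -2 on the
-- numerator bounds the denominators (see `den_le`).
open Filter Topology in
theorem exists_minimizing_sequence : ∃ m < 0, NeumannBound m ∧
    ∃ (u p w : ℕ → ℝ → ℝ) (L r : ℕ → ℝ), (∀ n, IsNormalizedPiece (u n) (p n) (w n) (L n) (r n)) ∧
      Tendsto r atTop (𝓝 m) ∧ ∀ n, r n ≤ m / 2 := by
  let S : Set ℝ := {r | ∃ u p w : ℝ → ℝ, IsH2 u p w ∧ p 0 = 0 ∧ p 1 = 0 ∧ 0 < den 0 1 u ∧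
    num 0 1 u w = r * den 0 1 u}
  obtain ⟨u, p, w, h, h0, h1, hneg⟩ := exists_num_neg
  have hd : 0 < den 0 1 u := by have := num_ge h zero_le_one; linarith
  have hS : num 0 1 u w / den 0 1 u ∈ S := ⟨u, p, w, h, h0, h1, hd, by rw [div_mul_cancel₀ _ hd.ne']⟩
  have hbdd : BddBelow S := by
    refine ⟨-1 / 4, ?_⟩
    rintro r ⟨u, p, w, h, -, -, hd, hr⟩
    have := num_ge h zero_le_one
    rw [hr] at this
    exact le_of_mul_le_mul_right this hd
  have hm : sInf S < 0 := (csInf_le hbdd hS).trans_lt (div_neg_of_neg_of_pos hneg hd)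
  refine ⟨sInf S, hm, neumannBound_of_unit fun u p w h h0 h1 => ?_, ?_⟩
  · rcases (den_nonneg zero_le_one u).eq_or_lt with h2 | h2
    · have := num_ge h zero_le_one
      rw [← h2] at this ⊢
      linarith
    · have := csInf_le hbdd (a := num 0 1 u w / den 0 1 u)
        ⟨u, p, w, h, h0, h1, h2, by rw [div_mul_cancel₀ _ h2.ne']⟩
      rwa [le_div_iff₀ h2] at this
  · obtain ⟨s, -, hs, hsS⟩ := exists_seq_tendsto_sInf ⟨_, hS⟩ hbdd
    obtain ⟨N, hN⟩ := eventually_atTop.1 (hs.eventually (gt_mem_nhds (show sInf S < sInf S / 2 by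
      linarith)))
    have hch : ∀ n, ∃ (u p w : ℝ → ℝ) (L : ℝ), IsNormalizedPiece u p w L (s (n + N)) := by
      intro n
      obtain ⟨u, p, w, h, h0, h1, hd, hn⟩ := hsS (n + N)
      exact exists_normalizedPiece h h0 h1 hd (by linarith [hN (n + N) (by simp)]) hn
    choose u p w L hP using hch
    exact ⟨u, p, w, L, fun n => s (n + N), hP, (tendsto_add_atTop_iff_nat N).2 hs,
      fun n => (hN _ (by simp)).le⟩

namespace IsNormalizedPiece

variable {u p w : ℝ → ℝ} {L r : ℝ}

theorem p_le (h : IsNormalizedPiece u p w L r) (x : ℝ) : |p x| ≤ |x| + 2 :=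
  (h.isH2.abs_p_le h.p_zero h.memLp x).trans (by linarith [h.sq_le])

theorem u_le (h : IsNormalizedPiece u p w L r) {x R : ℝ} (hx : x ∈ Icc 0 R) :
    |u x| ≤ 1 + (R + 2) * R := by
  have e := h.isH2.u_sub 0 x
  have h1 := intervalIntegral.norm_integral_le_of_norm_le_const (a := 0) (b := x) (C := R + 2)
    (f := p) (fun t ht => by
      rw [uIoc_of_le hx.1] at ht
      have := h.p_le t
      rw [abs_of_nonneg ht.1.le] at this
      exact this.trans (by linarith [ht.2, hx.2]))
  rw [← e, h.u_zero, Real.norm_eq_abs, sub_zero, abs_of_nonneg hx.1] at h1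
  have h2 := abs_sub_abs_le_abs_sub (u x) (-1)
  rw [abs_neg, abs_one] at h2
  have h3 : (R + 2) * x ≤ (R + 2) * R :=
    mul_le_mul_of_nonneg_left hx.2 (by linarith [hx.1, hx.2])
  linarith

theorem den_le (h : IsNormalizedPiece u p w L r) {m : ℝ} (hm : m < 0) (hr : r ≤ m / 2) :
    den 0 L u ≤ 4 / -m := by
  have h1 := h.num_ge.trans h.num_le
  have h2 : r * den 0 L u ≤ m / 2 * den 0 L u :=
    mul_le_mul_of_nonneg_right hr (den_nonneg h.pos.le u)
  rw [le_div_iff₀ (by linarith)]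
  linarith

theorem integral_eq (h : IsNormalizedPiece u p w L r) {R : ℝ} (hR : L ≤ R) :
    ∫ x in (0 : ℝ)..R, u x * p x ^ 2 = ∫ x in (0 : ℝ)..L, u x * p x ^ 2 := by
  have cu := h.isH2.u_cont
  have cp := h.isH2.p_cont
  have c : Continuous fun x => u x * p x ^ 2 := by fun_prop
  rw [← intervalIntegral.integral_add_adjacent_intervals (c.intervalIntegrable 0 L)
    (c.intervalIntegrable L R), intervalIntegral.integral_zero_ae (a := L), add_zero]
  refine Filter.Eventually.of_forall fun x hx => ?_
  rw [uIoc_of_le hR] at hx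
  simp [h.p_eq_zero x hx.1.le]

end IsNormalizedPiece

/-! ### Existence of a minimizer: bounded and unbounded lengths -/

open Filter Topology in
/-- If the lengths of the pieces converge, then a minimizer exists. -/
theorem exists_minimizer_of_tendsto {u p w : ℕ → ℝ → ℝ} {L r : ℕ → ℝ} {m Λ : ℝ} {u₀ p₀ w₀ : ℝ → ℝ}
    (hP : ∀ n, IsNormalizedPiece (u n) (p n) (w n) (L n) (r n)) (hr : Tendsto r atTop (𝓝 m))
    (hL : Tendsto L atTop (𝓝 Λ)) (h₀ : IsH2 u₀ p₀ w₀)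
    (hpl : ∀ x, Tendsto (fun n => p n x) atTop (𝓝 (p₀ x)))
    (hul : ∀ x, Tendsto (fun n => u n x) atTop (𝓝 (u₀ x)))
    (hlsc : ∀ a b, a ≤ b → ∀ ε > 0, ∀ᶠ n in atTop,
      ∫ x in a..b, w₀ x ^ 2 ≤ (∫ x in a..b, w n x ^ 2) + ε) :
    ∃ (u p w : ℝ → ℝ) (a b : ℝ), IsH2 u p w ∧ a < b ∧ p a = 0 ∧ p b = 0 ∧ 0 < den a b u ∧
      num a b u w ≤ m * den a b u := by
  have hΛ0 : 0 ≤ Λ := ge_of_tendsto hL (Eventually.of_forall fun n => (hP n).pos.le)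
  have hΛ1 : 1 ≤ 8 * Λ ^ 2 :=
    ge_of_tendsto ((hL.pow 2).const_mul 8) (Eventually.of_forall fun n => (hP n).one_le)
  have hΛ : 0 < Λ := lt_of_le_of_ne hΛ0 fun h => by rw [← h] at hΛ1; norm_num at hΛ1
  -- A fixed interval that eventually contains all `[0, L n]`; since `u'` vanishes beyond `L n`, the
  -- cubic term does not see the difference.
  set R := Λ + 1
  have hR : 0 ≤ R := by simp only [R]; linarith
  have hLR : ∀ᶠ n in atTop, L n ≤ R :=
    (hL.eventually (gt_mem_nhds (show Λ < R by simp [R]))).mono fun n h => h.le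
  have hp0 : p₀ 0 = 0 := tendsto_nhds_unique (hpl 0) (by simp [(hP _).p_zero])
  have hu0 : u₀ 0 = -1 := tendsto_nhds_unique (hul 0) (by simp [(hP _).u_zero])
  have hpR : ∀ x, Λ < x → p₀ x = 0 := by
    intro x hx
    refine tendsto_nhds_unique (hpl x) (tendsto_const_nhds.congr' ?_)
    filter_upwards [hL.eventually (gt_mem_nhds hx)] with n hn
    exact ((hP n).p_eq_zero x hn.le).symm
  have hpΛ : p₀ Λ = 0 := by
    have hcl : IsClosed {x | p₀ x = 0} := isClosed_eq h₀.p_cont continuous_const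
    have : Λ ∈ closure (Ioi Λ) := by rw [closure_Ioi]; simp
    exact closure_minimal (fun x hx => hpR x hx) hcl this
  set K := 1 + (R + 2) * R
  have hK : 0 ≤ K := by positivity
  have hRK : R + 2 ≤ K + 2 := by simp only [K]; nlinarith
  have huK : ∀ n, ∀ x ∈ Icc 0 R, |u n x| ≤ K + 2 := fun n x hx => ((hP n).u_le hx).trans (by
    simp only [K]; linarith)
  have hpK : ∀ n, ∀ x ∈ Icc 0 R, |p n x| ≤ K + 2 := fun n x hx => by
    have := (hP n).p_le x
    rw [abs_of_nonneg hx.1] at this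
    linarith [hx.2]
  have cB : Tendsto (fun n => ∫ x in (0 : ℝ)..R, u n x * p n x ^ 2) atTop
      (𝓝 (∫ x in (0 : ℝ)..R, u₀ x * p₀ x ^ 2)) :=
    tendsto_integral_comp (F := fun x y => x * y ^ 2) (by fun_prop) (fun n => (hP n).isH2.u_cont)
      (fun n => (hP n).isH2.p_cont) (K := K + 2) (fun n x hx => huK n x (by rwa [uIcc_of_le hR] at hx))
      (fun n x hx => hpK n x (by rwa [uIcc_of_le hR] at hx)) hul hpl
  have hB : ∫ x in (0 : ℝ)..R, u₀ x * p₀ x ^ 2 = ∫ x in (0 : ℝ)..Λ, u₀ x * p₀ x ^ 2 := by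
    have cu := h₀.u_cont
    have cp := h₀.p_cont
    have c : Continuous fun x => u₀ x * p₀ x ^ 2 := by fun_prop
    rw [← intervalIntegral.integral_add_adjacent_intervals (c.intervalIntegrable 0 Λ)
      (c.intervalIntegrable Λ R), intervalIntegral.integral_zero_ae (a := Λ), add_zero]
    refine Filter.Eventually.of_forall fun x hx => ?_
    rw [uIoc_of_le (by simp [R])] at hx
    simp [hpR x hx.1]
  have cD₀ : Tendsto (fun n => den 0 Λ (u n)) atTop (𝓝 (den 0 Λ u₀)) := by
    have hsub : ∀ x ∈ uIcc 0 Λ, x ∈ Icc 0 R := fun x hx => by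
      rw [uIcc_of_le hΛ0] at hx
      exact ⟨hx.1, hx.2.trans (by simp [R])⟩
    exact tendsto_integral_comp (F := fun x y => x ^ 4) (by fun_prop) (fun n => (hP n).isH2.u_cont)
      (fun n => (hP n).isH2.p_cont) (K := K + 2) (fun n x hx => huK n x (hsub x hx))
      (fun n x hx => hpK n x (hsub x hx)) hul hpl
  -- The constant continuation does contribute to `∫ u⁴`, so the denominator must stop at `L n`; the
  -- discrepancy from `Λ` is of order `|L n - Λ|`.
  have cD₁ : Tendsto (fun n => den Λ (L n) (u n)) atTop (𝓝 0) := by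
    have hlim : Tendsto (fun n => (K + 2) ^ 4 * |L n - Λ|) atTop (𝓝 0) := by
      have := ((hL.sub_const Λ).abs).const_mul ((K + 2) ^ 4)
      simpa using this
    refine squeeze_zero_norm' ?_ hlim
    filter_upwards [hLR] with n hn
    refine intervalIntegral.norm_integral_le_of_norm_le_const fun x hx => ?_
    have hx' : x ∈ Icc 0 R := by
      constructor
      · exact (le_min hΛ0 (hP n).pos.le).trans hx.1.le
      · exact hx.2.trans (max_le (by simp [R]) hn)
    rw [Real.norm_eq_abs, abs_pow]
    gcongr
    exact huK n x hx'
  have cD : Tendsto (fun n => den 0 (L n) (u n)) atTop (𝓝 (den 0 Λ u₀)) := by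
    have := cD₀.add cD₁
    rw [add_zero] at this
    exact this.congr fun n => den_add (hP n).isH2.u_cont 0 Λ (L n)
  refine ⟨u₀, p₀, w₀, 0, Λ, h₀, hΛ, hp0, hpΛ, den_pos hΛ h₀.u_cont (x := 0) ⟨le_rfl, hΛ0⟩
    (by rw [hu0]; norm_num), ?_⟩
  rw [num_eq_of_neumann h₀ hp0 hpΛ, ← hB]
  refine le_of_forall_pos_le_add fun ε hε => ?_
  have hl := ((hr.mul cD).sub (cB.const_mul 2)).add_const ε
  have h1 : ∫ x in (0 : ℝ)..R, w₀ x ^ 2 ≤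
      m * den 0 Λ u₀ - 2 * (∫ x in (0 : ℝ)..R, u₀ x * p₀ x ^ 2) + ε := by
    refine ge_of_tendsto hl ?_
    filter_upwards [hlsc 0 R hR ε hε, hLR] with n hn hnR
    have e := (hP n).num_le
    rw [num_eq_of_neumann (hP n).isH2 (hP n).p_zero ((hP n).p_eq_zero _ le_rfl), ← (hP n).sq_eq,
      ← (hP n).integral_eq hnR] at e
    have := intervalIntegral_sq_le (hP n).memLp hR
    linarith
  have h2 : ∫ x in (0 : ℝ)..Λ, w₀ x ^ 2 ≤ ∫ x in (0 : ℝ)..R, w₀ x ^ 2 :=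
    intervalIntegral.integral_mono_interval le_rfl hΛ0 (by simp [R])
      (Eventually.of_forall fun t => sq_nonneg _) (h₀.sq _ _)
  linarith

-- Part of the energy may escape to infinity, but the tail bound limits what the escaping part can
-- subtract from the numerator. So the limit on the half line has asymptotically no excess `num - m
-- * den`, and additivity of the Neumann bound localizes this to an interval once `p₀` has a
-- positive zero.
open Filter Topology in
theorem exists_minimizer_of_tendsto_atTop {u p w : ℕ → ℝ → ℝ} {L r : ℕ → ℝ} {m : ℝ}
    {u₀ p₀ w₀ : ℝ → ℝ} (hm : m < 0) (hN : NeumannBound m)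
    (hP : ∀ n, IsNormalizedPiece (u n) (p n) (w n) (L n) (r n)) (hr : Tendsto r atTop (𝓝 m))
    (hrm : ∀ n, r n ≤ m / 2) (hL : Tendsto L atTop atTop) (h₀ : IsH2 u₀ p₀ w₀)
    (hpl : ∀ x, Tendsto (fun n => p n x) atTop (𝓝 (p₀ x)))
    (hul : ∀ x, Tendsto (fun n => u n x) atTop (𝓝 (u₀ x)))
    (hlsc : ∀ a b, a ≤ b → ∀ ε > 0, ∀ᶠ n in atTop,
      ∫ x in a..b, w₀ x ^ 2 ≤ (∫ x in a..b, w n x ^ 2) + ε) :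
    ∃ (u p w : ℝ → ℝ) (a b : ℝ), IsH2 u p w ∧ a < b ∧ p a = 0 ∧ p b = 0 ∧ 0 < den a b u ∧
      num a b u w ≤ m * den a b u := by
  have hp0 : p₀ 0 = 0 := tendsto_nhds_unique (hpl 0) (by simp [(hP _).p_zero])
  have hu0 : u₀ 0 = -1 := tendsto_nhds_unique (hul 0) (by simp [(hP _).u_zero])
  have hp : ∀ x, 0 ≤ x → 0 ≤ p₀ x := fun x hx =>
    ge_of_tendsto (hpl x) (Eventually.of_forall fun n => (hP n).p_nonneg x hx)
  have conv : ∀ R, 0 ≤ R → ∀ F : ℝ → ℝ → ℝ, (Continuous fun z : ℝ × ℝ => F z.1 z.2) →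
      Tendsto (fun n => ∫ x in (0 : ℝ)..R, F (u n x) (p n x)) atTop
        (𝓝 (∫ x in (0 : ℝ)..R, F (u₀ x) (p₀ x))) := by
    intro R hR F hF
    refine tendsto_integral_comp hF (fun n => (hP n).isH2.u_cont) (fun n => (hP n).isH2.p_cont)
      (K := 1 + (R + 2) * R + (R + 2)) (fun n x hx => ?_) (fun n x hx => ?_) hul hpl
    · rw [uIcc_of_le hR] at hx
      have := (hP n).u_le hx
      linarith
    · rw [uIcc_of_le hR] at hx
      have := (hP n).p_le x
      rw [abs_of_nonneg hx.1] at this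
      nlinarith [hx.2]
  have hw₀ : ∀ R, 0 ≤ R → ∫ x in (0 : ℝ)..R, w₀ x ^ 2 ≤ 2 := by
    intro R hR
    refine le_of_forall_pos_le_add fun ε hε => ?_
    obtain ⟨n, hn⟩ := (hlsc 0 R hR ε hε).exists
    have := intervalIntegral_sq_le (hP n).memLp hR
    linarith [(hP n).sq_le]
  have hd₀ : ∀ R, 0 ≤ R → den 0 R u₀ ≤ 4 / -m := by
    intro R hR
    refine le_of_tendsto (conv R hR (fun x _ => x ^ 4) (by fun_prop)) ?_
    filter_upwards [hL.eventually (eventually_ge_atTop R)] with n hn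
    have h1 := (hP n).den_le hm (hrm n)
    have h2 := den_add (hP n).isH2.u_cont 0 R (L n)
    have h3 := den_nonneg hn (u n)
    change den 0 R (u n) ≤ _
    linarith
  have hlim : Tendsto (fun x => |u₀ x| + |p₀ x|) atTop (𝓝 0) :=
    tendsto_zero_of_bounds h₀ (a := 0) (C := max 2 (4 / -m))
      (fun R hR => (hw₀ R hR).trans (le_max_left _ _))
      (fun R hR => (hd₀ R hR).trans (le_max_right _ _))
  -- Beyond `R`, the terms `∫ w²` and `-r ∫ u⁴` are nonnegative and dropped; the cubic term is at
  -- least `-2 min(u(R), 0)²` by `tail`.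
  have hmain : ∀ R, 0 ≤ R → num 0 R u₀ w₀ + u₀ R ^ 2 * p₀ R - m * den 0 R u₀ ≤
      2 * min (u₀ R) 0 ^ 2 := by
    intro R hR
    rw [num_eq h₀, hp0]
    refine le_of_forall_pos_le_add fun ε hε => ?_
    have cB := conv R hR (fun x y => x * y ^ 2) (by fun_prop)
    have cD : Tendsto (fun n => den 0 R (u n)) atTop (𝓝 (den 0 R u₀)) :=
      conv R hR (fun x _ => x ^ 4) (by fun_prop)
    have cψ : Tendsto (fun n => min (u n R) 0 ^ 2) atTop (𝓝 (min (u₀ R) 0 ^ 2)) :=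
      ((hul R).min tendsto_const_nhds).pow 2
    have hl := (((hr.mul cD).sub (cB.const_mul 2)).add (cψ.const_mul 2)).add_const ε
    have : ∫ x in (0 : ℝ)..R, w₀ x ^ 2 ≤ m * den 0 R u₀ -
        2 * (∫ x in (0 : ℝ)..R, u₀ x * p₀ x ^ 2) + 2 * min (u₀ R) 0 ^ 2 + ε := by
      refine ge_of_tendsto hl ?_
      filter_upwards [hlsc 0 R hR ε hε, hL.eventually (eventually_ge_atTop R)] with n hn hnR
      have e := (hP n).num_le
      rw [num_eq_of_neumann (hP n).isH2 (hP n).p_zero ((hP n).p_eq_zero _ le_rfl), ← (hP n).sq_eq]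
        at e
      have h1 := intervalIntegral_sq_le (hP n).memLp hR
      have h2 := den_add (hP n).isH2.u_cont 0 R (L n)
      have h3 := den_nonneg hnR (u n)
      have h4 := (hP n).tail R ⟨hR, hnR⟩
      have cu := (hP n).isH2.u_cont
      have cp := (hP n).isH2.p_cont
      have c : Continuous fun x => u n x * p n x ^ 2 := by fun_prop
      rw [← intervalIntegral.integral_add_adjacent_intervals (c.intervalIntegrable 0 R)
        (c.intervalIntegrable R (L n))] at e
      have h5 : r n * den 0 (L n) (u n) ≤ r n * den 0 R (u n) := by
        have := hrm n
        nlinarith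
      linarith
    linarith
  have hsmall : ∀ ε > 0, ∀ᶠ R in atTop, num 0 R u₀ w₀ - m * den 0 R u₀ ≤ ε := by
    intro ε hε
    filter_upwards [hlim.eventually (gt_mem_nhds (show (0 : ℝ) < min 1 (ε / 2) by positivity)),
      eventually_ge_atTop 0] with R h1 h2
    have h3 := hmain R h2
    have h4 : 0 ≤ u₀ R ^ 2 * p₀ R := mul_nonneg (sq_nonneg _) (hp R h2)
    have h5 := min_le_left 1 (ε / 2)
    have h6 := min_le_right 1 (ε / 2)
    have h7 : min (u₀ R) 0 ^ 2 ≤ |u₀ R| := by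
      have : min (u₀ R) 0 ^ 2 ≤ |u₀ R| ^ 2 := by
        rw [sq_abs]
        rcases le_total (u₀ R) 0 with h | h
        · rw [min_eq_left h]
        · rw [min_eq_right h]; simpa using sq_nonneg (u₀ R)
      nlinarith [abs_nonneg (u₀ R), abs_nonneg (p₀ R)]
    linarith [abs_nonneg (p₀ R)]
  -- At a critical point `x` the half line `[x, ∞)` has asymptotically nonnegative excess, so `[0,
  -- x]` has none.
  by_cases hz : ∃ x, 0 < x ∧ p₀ x = 0
  · obtain ⟨x, hx, hpx⟩ := hz
    refine ⟨u₀, p₀, w₀, 0, x, h₀, hx, hp0, hpx, den_pos hx h₀.u_cont (x := 0) ⟨le_rfl, hx.le⟩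
      (by rw [hu0]; norm_num), ?_⟩
    refine le_of_forall_pos_le_add fun ε hε => ?_
    obtain ⟨R, hR1, hR2⟩ := ((hsmall (ε / 2) (half_pos hε)).and
      (hN.half_line h₀ hpx (b := 0) (C := max 2 (4 / -m))
        (fun R hR => (hw₀ R hR).trans (le_max_left _ _))
        (fun R hR => (hd₀ R hR).trans (le_max_right _ _)) (half_pos hε))).exists
    rw [← num_add h₀ 0 x R, ← den_add h₀.u_cont 0 x R] at hR1
    linarith
  · exfalso
    push Not at hz
    have hpos : ∀ x, 0 < x → 0 < p₀ x := fun x hx => lt_of_le_of_ne (hp x hx.le) (hz x hx).symm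
    have hmono := monotoneOn_of_p_nonneg h₀ (convex_Ici 0) hp
    have hulim : Tendsto u₀ atTop (𝓝 0) := by
      refine squeeze_zero_norm (fun x => ?_) hlim
      rw [Real.norm_eq_abs]
      linarith [abs_nonneg (p₀ x)]
    have hneg : ∀ x, 0 < x → u₀ x ≤ 0 := fun x hx => ge_of_tendsto hulim (by
      filter_upwards [eventually_ge_atTop x] with y hy
      exact hmono (mem_Ici.2 hx.le) (mem_Ici.2 (hx.le.trans hy)) hy)
    have hEL : ∀ x, 0 < x → HasDerivAt p₀ (deriv p₀ x) x ∧
        HasDerivAt (deriv p₀) (deriv (deriv p₀) x) x ∧ HasDerivAt (deriv (deriv p₀))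
          (2 * u₀ x * deriv p₀ x + p₀ x ^ 2 + 2 * m * u₀ x ^ 3) x := by
      intro x hx
      have hab : x / 2 < x + 1 := by linarith
      -- On a long interval the excess of `u₀` is at most `ε / 2` and that of the perturbed function
      -- at least `-ε / 2`; outside `[a, b]` the two agree, so the contributions cancel.
      refine euler_lagrange_deriv h₀ hab (fun g q h hg ga qa gb qb => ?_) ⟨by linarith, by linarith⟩
      set a := x / 2
      set b := x + 1
      have ha : 0 ≤ a := by simp only [a]; linarith
      obtain ⟨v, s, z, hv, e1, e2, e3, e4, e5⟩ := exists_zero_extension hg hab.le ga qa gb qb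
      have hs := h₀.add hv
      have hb0 : 0 ≤ b := ha.trans hab.le
      have n1 := num_congr (u := u₀) (w := w₀) (v := fun x => u₀ x + v x)
        (z := fun x => w₀ x + z x) (a := 0) (b := a) ha
        (fun y hy => by simp [(e3 y hy.2).1]) (fun y hy => by simp [(e3 y hy.2).2.2])
      have n2 := num_congr (u := fun x => u₀ x + g x) (w := fun x => w₀ x + h x)
        (v := fun x => u₀ x + v x) (z := fun x => w₀ x + z x) hab.le
        (fun y hy => by simp [e1 y hy]) (fun y hy => by simp [e2 y hy])
      have n3 : ∀ R, b ≤ R → num b R (fun x => u₀ x + v x) (fun x => w₀ x + z x) = num b R u₀ w₀ :=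
        fun R hR => num_congr hR (fun y hy => by simp [(e4 y hy.1).1])
          (fun y hy => by simp [e5 y hy.1])
      have d1 := den_congr (u := u₀) (v := fun x => u₀ x + v x) (a := 0) (b := a) ha
        (fun y hy => by simp [(e3 y hy.2).1])
      have d2 := den_congr (u := fun x => u₀ x + g x) (v := fun x => u₀ x + v x) hab.le
        (fun y hy => by simp [e1 y hy])
      have d3 : ∀ R, b ≤ R → den b R (fun x => u₀ x + v x) = den b R u₀ :=
        fun R hR => den_congr hR (fun y hy => by simp [(e4 y hy.1).1])
      refine le_of_forall_pos_le_add fun ε hε => ?_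
      have hhl := hN.half_line hs (a := 0) (b := b) (C := max 2 (4 / -m))
        (by simp [hp0, (e3 0 ha).2.1]) (fun R hR => ?_) (fun R hR => ?_) (half_pos hε)
      · obtain ⟨R, ⟨hR1, hR2⟩, hR3⟩ := ((hsmall (ε / 2) (half_pos hε)).and hhl).and
          (eventually_ge_atTop b) |>.exists
        rw [← num_add h₀ 0 b R, ← num_add h₀ 0 a b, ← den_add h₀.u_cont 0 b R,
          ← den_add h₀.u_cont 0 a b] at hR1
        rw [← num_add hs 0 b R, ← num_add hs 0 a b, ← den_add hs.u_cont 0 b R,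
          ← den_add hs.u_cont 0 a b, n1, n2, n3 R hR3, d1, d2, d3 R hR3] at hR2
        linarith
      · have : ∫ y in b..R, (w₀ y + z y) ^ 2 = ∫ y in b..R, w₀ y ^ 2 := by
          refine intervalIntegral.integral_congr_ae (Eventually.of_forall fun y hy => ?_)
          rw [uIoc_of_le hR] at hy
          simp [e5 y hy.1]
        rw [this]
        refine le_trans ?_ ((hw₀ R (hb0.trans hR)).trans (le_max_left _ _))
        exact intervalIntegral.integral_mono_interval hb0 hR le_rfl
          (Eventually.of_forall fun t => sq_nonneg _) (h₀.sq _ _)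
      · rw [d3 R hR]
        refine le_trans ?_ ((hd₀ R (hb0.trans hR)).trans (le_max_right _ _))
        have := den_add h₀.u_cont 0 b R
        linarith [den_nonneg hb0 u₀]
    exact no_half_line_solution hm hlim hneg hpos (fun x _ => h₀.hasDeriv x)
      (fun x hx => (hEL x hx).1) (fun x hx => (hEL x hx).2.1) (fun x hx => (hEL x hx).2.2)

open Filter Topology in
/-- Existence of a minimizer on some interval. -/
theorem exists_minimizer : ∃ m < 0, NeumannBound m ∧ ∃ (u p w : ℝ → ℝ) (a b : ℝ), IsH2 u p w ∧
    a < b ∧ p a = 0 ∧ p b = 0 ∧ 0 < den a b u ∧ num a b u w = m * den a b u := by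
  obtain ⟨m, hm, hN, u, p, w, L, r, hP, hr, hrm⟩ := exists_minimizing_sequence
  refine ⟨m, hm, hN, ?_⟩
  obtain ⟨u₀, p₀, w₀, h₀, -, -, φ, hφ, hpl, hul, hlsc⟩ := exists_isH2_limit (C := 2)
    (fun n => (hP n).isH2) (fun n => (hP n).memLp) (fun n => (hP n).sq_le)
    (fun n => (hP n).p_zero) (fun n => by rw [(hP n).u_zero]; norm_num)
  suffices h : ∃ (u p w : ℝ → ℝ) (a b : ℝ), IsH2 u p w ∧ a < b ∧ p a = 0 ∧ p b = 0 ∧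
      0 < den a b u ∧ num a b u w ≤ m * den a b u by
    obtain ⟨u, p, w, a, b, h, hab, ha, hb, hd, hn⟩ := h
    exact ⟨u, p, w, a, b, h, hab, ha, hb, hd, le_antisymm hn (hN u p w h a b hab.le ha hb)⟩
  by_cases hL : Tendsto (fun n => L (φ n)) atTop atTop
  · exact exists_minimizer_of_tendsto_atTop hm hN (fun n => hP (φ n)) (hr.comp hφ.tendsto_atTop)
      (fun n => hrm _) hL h₀ hpl hul hlsc
  · rw [tendsto_atTop] at hL
    push Not at hL
    obtain ⟨K, hK⟩ := hL
    obtain ⟨ψ, hψ, hψK⟩ := extraction_of_frequently_atTop hK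
    obtain ⟨Λ, -, χ, hχ, hΛ⟩ := tendsto_subseq_of_bounded (Metric.isBounded_Icc 0 K)
      (x := fun n => L (φ (ψ n))) (fun n => ⟨(hP _).pos.le, (hψK n).le⟩)
    have ht : Tendsto (fun n => ψ (χ n)) atTop atTop := (hψ.comp hχ).tendsto_atTop
    exact exists_minimizer_of_tendsto (fun n => hP (φ (ψ (χ n))))
      ((hr.comp hφ.tendsto_atTop).comp ht) hΛ h₀ (fun x => (hpl x).comp ht)
      (fun x => (hul x).comp ht) (fun a b hab ε hε => ht.eventually (hlsc a b hab ε hε))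

/-! ### Decreasing minimizers and their periodic extension -/

/-- For every `T` there is a minimizer on `[0, T]` that is strictly decreasing. -/
theorem exists_decreasing_minimizer : ∃ m < 0, NeumannBound m ∧ ∀ T : ℝ, 0 < T →
    ∃ u p w : ℝ → ℝ, IsH2 u p w ∧ p 0 = 0 ∧ p T = 0 ∧ (∀ x ∈ Ioo 0 T, p x < 0) ∧
      num 0 T u w = m * den 0 T u := by
  obtain ⟨m, hm, hN, u, p, w, a, b, h, hab, ha, hb, hd, hn⟩ := exists_minimizer
  refine ⟨m, hm, hN, fun T hT => ?_⟩
  have hne : ∃ x ∈ Icc a b, p x ≠ 0 := by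
    by_contra! hc
    rw [num_eq_of_neumann h ha hb] at hn
    have e : ∫ x in a..b, u x * p x ^ 2 = 0 := by
      rw [intervalIntegral.integral_congr (g := fun _ => (0 : ℝ))]
      · simp
      · intro x hx
        rw [uIcc_of_le hab.le] at hx
        simp [hc x hx]
    have : 0 ≤ ∫ x in a..b, w x ^ 2 :=
      intervalIntegral.integral_nonneg hab.le fun x _ => sq_nonneg _
    have := mul_neg_of_neg_of_pos hm hd
    linarith
  obtain ⟨x, hx, hpx⟩ := hne
  obtain ⟨c, d, hac, hcd, hdb, hpc, hpd, hnz⟩ := exists_consecutive_zeros h.p_cont ha hb hx hpx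
  -- The Neumann bounds on the three pieces add up to an equality, so each of them is an equality.
  have hcdn : num c d u w = m * den c d u := by
    have l1 := hN u p w h a c hac ha hpc
    have l2 := hN u p w h c d hcd.le hpc hpd
    have l3 := hN u p w h d b hdb hpd hb
    have n1 := num_add h a c d
    have n2 := num_add h a d b
    have d1 := den_add h.u_cont a c d
    have d2 := den_add h.u_cont a d b
    nlinarith
  have hs : 0 < (d - c) / T := div_pos (sub_pos.2 hcd) hT
  set s := (d - c) / T
  have hsT : s * T = d - c := div_mul_cancel₀ _ hT.ne'
  rcases pos_or_neg_of_ne_zero h.p_cont hnz with hp | hp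
  -- An increasing piece is traversed backwards, starting from its right end `d`.
  · have hs' : -s ≠ 0 := by linarith
    have eT : -s * T + d = c := by linarith
    refine ⟨_, _, _, (h.comp_affine hs' d).smul ((-s) ^ 2), by simp [hpd],
      by simp only [eT, hpc, mul_zero], fun y hy => ?_, ?_⟩
    · have : 0 < p (-s * y + d) := hp _ ⟨by
        have := mul_lt_mul_of_pos_left hy.2 hs
        linarith, by
        have := mul_pos hs hy.1
        linarith⟩
      have h1 : 0 < s ^ 3 * p (-s * y + d) := by positivity
      linarith
    · rw [num_affine _ _ _ _ hs', den_affine _ _ _ hs', eT]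
      simp only [mul_zero, zero_add]
      rw [num_swap c d, den_swap c d, hcdn]; ring
  · have eT : s * T + c = d := by linarith
    refine ⟨_, _, _, (h.comp_affine hs.ne' c).smul (s ^ 2), by simp [hpc], by simp [eT, hpd],
      fun y hy => ?_, ?_⟩
    · have : p (s * y + c) < 0 := hp _ ⟨by
        have := mul_pos hs hy.1
        linarith, by
        have := mul_lt_mul_of_pos_left hy.2 hs
        linarith⟩
      have h1 : s ^ 3 * p (s * y + c) < 0 := mul_neg_of_pos_of_neg (by positivity) this
      linarith
    · rw [num_affine _ _ _ _ hs.ne', den_affine _ _ _ hs.ne', eT]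
      simp only [mul_zero, zero_add]
      rw [hcdn]; ring

theorem IsH2.ae_hasDerivAt {u p w : ℝ → ℝ} (h : IsH2 u p w) : ∀ᵐ x, HasDerivAt p (w x) x := by
  have hl : LocallyIntegrable w volume := by
    intro x
    refine ⟨Icc (x - 1) (x + 1), Icc_mem_nhds (by linarith) (by linarith), ?_⟩
    rw [integrableOn_Icc_iff_integrableOn_Ioc]
    exact (intervalIntegrable_iff_integrableOn_Ioc_of_le (by linarith)).1 (h.w_int _ _)
  filter_upwards [LocallyIntegrable.ae_hasDerivAt_integral hl] with x hx
  have e : p = fun y => p 0 + ∫ t in (0 : ℝ)..y, w t := by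
    ext y; rw [← h.der 0 y]; ring
  rw [e]
  exact (hx 0).const_add (p 0)

theorem num_congr_ae {u p w w' : ℝ → ℝ} (h : IsH2 u p w) (h' : IsH2 u p w') (a b : ℝ) :
    num a b u w = num a b u w' := by
  have hae : ∀ᵐ x, w x = w' x := by
    filter_upwards [h.ae_hasDerivAt, h'.ae_hasDerivAt] with x h1 h2 using h1.unique h2
  unfold num
  congr 1 <;> refine intervalIntegral.integral_congr_ae ?_ <;>
    filter_upwards [hae] with x hx _ <;> rw [hx]

/-- The even `2T`-periodic extension of a function on `[0, T]` with `u'(0) = u'(T) = 0`. -/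
theorem exists_periodic_extension {u p w : ℝ → ℝ} (h : IsH2 u p w) {T : ℝ} (hT : 0 < T)
    (h0 : p 0 = 0) (hpT : p T = 0) :
    ∃ U P W : ℝ → ℝ, IsH2 U P W ∧ (∀ x ∈ Icc 0 T, U x = u x) ∧ (∀ x ∈ Icc 0 T, P x = p x) ∧
      (∀ x, U (-x) = U x) ∧ (∀ x, P (-x) = -P x) ∧ (∀ x, W (-x) = W x) ∧
      Function.Periodic U (2 * T) ∧ Function.Periodic P (2 * T) ∧ Function.Periodic W (2 * T) ∧
      num 0 T U W = num 0 T u w := by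
  -- The even `2T`-periodic triangle wave, equal to `x` on `[0, T]`.
  let τ : ℝ → ℝ := fun x => T / Real.pi * Real.arccos (Real.cos (Real.pi / T * x))
  have hπ := Real.pi_pos
  have τc : Continuous τ := by fun_prop
  have τ0 : ∀ x ∈ Icc 0 T, τ x = x := by
    intro x hx
    simp only [τ]
    rw [Real.arccos_cos (mul_nonneg (by positivity) hx.1)]
    · field_simp
    · calc Real.pi / T * x ≤ Real.pi / T * T := by gcongr; exact hx.2
        _ = Real.pi := by field_simp
  have τe : ∀ x, τ (-x) = τ x := by intro x; simp [τ]
  have τp : ∀ x, τ (x + 2 * T) = τ x := by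
    intro x
    simp only [τ]
    rw [show Real.pi / T * (x + 2 * T) = Real.pi / T * x + 2 * Real.pi by field_simp,
      Real.cos_add_two_pi]
  -- A Borel representative composes measurably with `τ`; `U` and `P` are then recovered as
  -- primitives.
  let w₁ := h.meas.mk w
  have hw₁ : Measurable w₁ := h.meas.stronglyMeasurable_mk.measurable
  have hae : ∀ᵐ x, w x = w₁ x := h.meas.ae_eq_mk
  let W : ℝ → ℝ := fun x => w₁ (τ x)
  have hWm : AEStronglyMeasurable W volume := (hw₁.comp τc.measurable).aestronglyMeasurable
  have We : ∀ x, W (-x) = W x := fun x => by simp only [W, τe]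
  have Wp : Function.Periodic W (2 * T) := fun x => by simp only [W, τp]
  have hWw : ∀ᵐ x, x ∈ Icc 0 T → W x = w x := by
    filter_upwards [hae] with x hx hxm
    simp only [W, τ0 x hxm, hx]
  have hWs : ∀ a b, IntervalIntegrable (fun x => W x ^ 2) volume a b := by
    have i1 : IntervalIntegrable (fun x => W x ^ 2) volume 0 T := by
      refine (h.sq 0 T).congr_ae ?_
      rw [Filter.EventuallyEq, ae_restrict_iff' measurableSet_uIoc]
      filter_upwards [hWw] with x hx hxm
      rw [uIoc_of_le hT.le] at hxm
      rw [hx ⟨hxm.1.le, hxm.2⟩]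
    have i2 : IntervalIntegrable (fun x => W x ^ 2) volume (-T) 0 := by
      have := (IntervalIntegrable.iff_comp_neg (f := fun x => W x ^ 2)).1 i1
      simp only [We, neg_zero] at this
      exact this.symm
    refine Function.Periodic.intervalIntegrable (T := 2 * T) (fun x => by simp only [Wp x])
      (by positivity) (t := -T) ?_
    rw [show -T + 2 * T = T by ring]
    exact i2.trans i1
  have hH := IsH2.mk_of hWm hWs 0 (u 0) 0
  simp only [zero_add] at hH
  set P : ℝ → ℝ := fun x => ∫ t in (0 : ℝ)..x, W t
  set U : ℝ → ℝ := fun x => u 0 + ∫ t in (0 : ℝ)..x, P t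
  have hP : ∀ x ∈ Icc 0 T, P x = p x := by
    intro x hx
    have : P x = ∫ t in (0 : ℝ)..x, w t := by
      refine intervalIntegral.integral_congr_ae ?_
      filter_upwards [hWw] with t ht htm
      rw [uIoc_of_le hx.1] at htm
      exact ht ⟨htm.1.le, htm.2.trans hx.2⟩
    rw [this, ← h.der, h0, sub_zero]
  have hU : ∀ x ∈ Icc 0 T, U x = u x := by
    intro x hx
    have : ∫ t in (0 : ℝ)..x, P t = ∫ t in (0 : ℝ)..x, p t := by
      refine intervalIntegral.integral_congr fun t ht => ?_
      rw [uIcc_of_le hx.1] at ht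
      exact hP t ⟨ht.1, ht.2.trans hx.2⟩
    simp only [U]
    rw [this, ← h.u_sub]; ring
  have Po : ∀ x, P (-x) = -P x := by
    intro x
    have := intervalIntegral.integral_comp_neg (f := W) (a := 0) (b := x)
    simp only [We, neg_zero] at this
    simp only [P]
    rw [this, intervalIntegral.integral_symm]
  have Ue : ∀ x, U (-x) = U x := by
    intro x
    have := intervalIntegral.integral_comp_neg (f := P) (a := 0) (b := x)
    simp only [Po, neg_zero, intervalIntegral.integral_neg] at this
    simp only [U]
    rw [intervalIntegral.integral_symm, ← this]; ring
  have Pp : Function.Periodic P (2 * T) := by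
    intro x
    have e := hH.der x (x + 2 * T)
    rw [Wp.intervalIntegral_add_eq x (-T), show -T + 2 * T = T by ring, ← hH.der, Po,
      hP T ⟨hT.le, le_rfl⟩, hpT] at e
    simpa [sub_eq_zero] using e
  have Up : Function.Periodic U (2 * T) := by
    intro x
    have e := hH.u_sub x (x + 2 * T)
    rw [Pp.intervalIntegral_add_eq x (-T), show -T + 2 * T = T by ring, ← hH.u_sub, Ue, sub_self]
      at e
    exact sub_eq_zero.1 e
  refine ⟨U, P, W, hH, hU, hP, Ue, Po, We, Up, Pp, Wp, ?_⟩
  unfold num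
  congr 1 <;> refine intervalIntegral.integral_congr_ae ?_ <;> filter_upwards [hWw] with x hx hxm <;>
    rw [uIoc_of_le hT.le] at hxm <;> have hxm' : x ∈ Icc 0 T := ⟨hxm.1.le, hxm.2⟩
  · rw [hx hxm']
  · rw [hx hxm', hU x hxm']

/-! ### The periodic minimizer: equation, smoothness, zero energy, sign -/

/-- A periodic function whose values on one period are minimal is a local minimizer, hence
satisfies the Euler–Lagrange equation. -/
theorem euler_lagrange_of_periodic {u p w : ℝ → ℝ} (h : IsH2 u p w) {T m : ℝ} (hT : 0 < T)
    (hN : NeumannBound m) (hu : Function.Periodic u (2 * T)) (hp : Function.Periodic p (2 * T))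
    (hw : Function.Periodic w (2 * T)) (hpT : p T = 0)
    (hn : num (-T) T u w = m * den (-T) T u) (x : ℝ) :
    HasDerivAt p (deriv p x) x ∧ HasDerivAt (deriv p) (deriv (deriv p) x) x ∧
      HasDerivAt (deriv (deriv p)) (2 * u x * deriv p x + p x ^ 2 + 2 * m * u x ^ 3) x := by
  -- An odd number `2n + 1` of periods around the origin contains `[x - 1, x + 1]` and ends at
  -- critical points, so the Neumann bound applies to the perturbed function.
  obtain ⟨n, hnx⟩ := exists_nat_gt ((|x| + 1) / T)
  rw [div_lt_iff₀ hT] at hnx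
  set R := (2 * n + 1) * T
  have hR : |x| + 1 < R := by
    have : 0 ≤ n * T := by positivity
    simp only [R]; linarith
  have hpR : p R = 0 := by
    have := hp.nat_mul n T
    rw [← hpT, ← this]; congr 1; simp only [R]; ring
  have hpR' : p (-R) = 0 := by
    have := hp.nat_mul (2 * n + 1) (-R)
    rw [← this, ← hpR]; congr 1; simp only [R]; push_cast; ring
  have key : ∀ f : ℝ → ℝ, Function.Periodic f (2 * T) →
      (∀ a b, IntervalIntegrable f volume a b) →
      ∫ x in -R..R, f x = (2 * n + 1) * ∫ x in -T..T, f x := by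
    intro f hf hi
    have := hf.intervalIntegral_add_zsmul_eq (2 * n + 1) (-R) hi
    rw [hf.intervalIntegral_add_eq (-R) (-T), show -T + 2 * T = T by ring] at this
    have e : -R + (2 * (n : ℤ) + 1) • (2 * T) = R := by
      simp only [R, zsmul_eq_mul]; push_cast; ring
    rw [e, zsmul_eq_mul] at this
    push_cast at this
    exact this
  have hnR : num (-R) R u w = m * den (-R) R u := by
    unfold num den at hn ⊢
    rw [key (fun x => w x ^ 2) (fun x => by simp only [hw x]) h.sq,
      key (fun x => w x * u x ^ 2) (fun x => by simp only [hw x, hu x]) h.w_mul_sq_int,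
      key (fun x => u x ^ 4) (fun x => by simp only [hu x])
        (fun a b => (h.u_cont.pow 4).intervalIntegrable a b)]
    linear_combination (2 * (n : ℝ) + 1) * hn
  have hxa : -|x| ≤ x := neg_abs_le x
  have hxb : x ≤ |x| := le_abs_self x
  have hab : x - 1 < x + 1 := by linarith
  refine euler_lagrange_deriv h hab (fun g q z hg ga qa gb qb => ?_) ⟨by linarith, by linarith⟩
  set a := x - 1
  set b := x + 1
  have ha : -R ≤ a := by simp only [a]; linarith
  have hb : b ≤ R := by simp only [b]; linarith
  obtain ⟨v, s, z', hv, e1, e2, e3, e4, e5⟩ := exists_zero_extension hg hab.le ga qa gb qb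
  have hs := h.add hv
  have n1 := num_congr (u := u) (w := w) (v := fun x => u x + v x)
    (z := fun x => w x + z' x) ha
    (fun y hy => by simp [(e3 y hy.2).1]) (fun y hy => by simp [(e3 y hy.2).2.2])
  have n2 := num_congr (u := fun x => u x + g x) (w := fun x => w x + z x)
    (v := fun x => u x + v x) (z := fun x => w x + z' x) hab.le
    (fun y hy => by simp [e1 y hy]) (fun y hy => by simp [e2 y hy])
  have n3 : num b R (fun x => u x + v x) (fun x => w x + z' x) = num b R u w :=
    num_congr hb (fun y hy => by simp [(e4 y hy.1).1]) (fun y hy => by simp [e5 y hy.1])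
  have d1 := den_congr (u := u) (v := fun x => u x + v x) ha (fun y hy => by simp [(e3 y hy.2).1])
  have d2 := den_congr (u := fun x => u x + g x) (v := fun x => u x + v x) hab.le
    (fun y hy => by simp [e1 y hy])
  have d3 : den b R (fun x => u x + v x) = den b R u :=
    den_congr hb (fun y hy => by simp [(e4 y hy.1).1])
  have hmin := hN _ _ _ hs (-R) R (ha.trans (hab.le.trans hb)) (by simp [hpR', (e3 _ ha).2.1])
    (by simp [hpR, (e4 _ hb).2])
  rw [← num_add h (-R) b R, ← num_add h (-R) a b, ← den_add h.u_cont (-R) b R,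
    ← den_add h.u_cont (-R) a b] at hnR
  rw [← num_add hs (-R) b R, ← num_add hs (-R) a b, ← den_add hs.u_cont (-R) b R,
    ← den_add hs.u_cont (-R) a b, n1, n2, n3, d1, d2, d3] at hmin
  linarith

/-- Solutions of the Euler–Lagrange equation are smooth. -/
theorem contDiff_of_euler_lagrange {u p W V : ℝ → ℝ} {m : ℝ} (hu : ∀ x, HasDerivAt u (p x) x)
    (hp : ∀ x, HasDerivAt p (W x) x) (hW : ∀ x, HasDerivAt W (V x) x)
    (hV : ∀ x, HasDerivAt V (2 * u x * W x + p x ^ 2 + 2 * m * u x ^ 3) x) :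
    ContDiff ℝ ∞ u := by
  have step : ∀ {f f' : ℝ → ℝ} (n : ℕ), (∀ x, HasDerivAt f (f' x) x) → ContDiff ℝ n f' →
      ContDiff ℝ (n + 1 : ℕ) f := by
    intro f f' n hf hf'
    rw [Nat.cast_add, Nat.cast_one, contDiff_succ_iff_deriv]
    refine ⟨fun x => (hf x).differentiableAt, by simp, ?_⟩
    rwa [show deriv f = f' from funext fun x => (hf x).deriv]
  have cont : ∀ {f f' : ℝ → ℝ}, (∀ x, HasDerivAt f (f' x) x) → ContDiff ℝ (0 : ℕ) f := by
    intro f f' hf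
    rw [Nat.cast_zero, contDiff_zero]
    exact continuous_iff_continuousAt.2 fun x => (hf x).continuousAt
  have all : ∀ n : ℕ, ContDiff ℝ n u ∧ ContDiff ℝ n p ∧ ContDiff ℝ n W ∧ ContDiff ℝ n V := by
    intro n
    induction n with
    | zero => exact ⟨cont hu, cont hp, cont hW, cont hV⟩
    | succ n ih =>
      obtain ⟨i1, i2, i3, i4⟩ := ih
      exact ⟨step n hu i2, step n hp i3, step n hW i4, step n hV
        ((((contDiff_const.mul i1).mul i3).add (i2.pow 2)).add (contDiff_const.mul (i1.pow 3)))⟩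
  exact contDiff_infty.2 fun n => (all n).1

/-- Solutions of the Euler–Lagrange equation with Neumann boundary conditions and minimal quotient
have zero energy. -/
theorem energy_eq_zero {u p W V : ℝ → ℝ} {m T : ℝ} (hT : 0 < T) (hu : ∀ x, HasDerivAt u (p x) x)
    (hp : ∀ x, HasDerivAt p (W x) x) (hW : ∀ x, HasDerivAt W (V x) x)
    (hV : ∀ x, HasDerivAt V (2 * u x * W x + p x ^ 2 + 2 * m * u x ^ 3) x)
    (p0 : p 0 = 0) (pT : p T = 0) (V0 : V 0 = 0) (VT : V T = 0)
    (hn : (∫ x in (0 : ℝ)..T, W x ^ 2) + 2 * (∫ x in (0 : ℝ)..T, u x * p x ^ 2) =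
      m * ∫ x in (0 : ℝ)..T, u x ^ 4) (x : ℝ) :
    V x * p x - W x ^ 2 / 2 - u x * p x ^ 2 - m * u x ^ 4 / 2 = 0 := by
  have cu : Continuous u := continuous_iff_continuousAt.2 fun x => (hu x).continuousAt
  have cp : Continuous p := continuous_iff_continuousAt.2 fun x => (hp x).continuousAt
  have cW : Continuous W := continuous_iff_continuousAt.2 fun x => (hW x).continuousAt
  set E : ℝ → ℝ := fun y => V y * p y - W y ^ 2 / 2 - u y * p y ^ 2 - m * u y ^ 4 / 2
  have hE : ∀ y, HasDerivAt E 0 y := fun y => hasDerivAt_energy (hu y) (hp y) (hW y) (hV y)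
  have hc : ∀ y, E y = E x := fun y => is_const_of_deriv_eq_zero
    (fun y => (hE y).differentiableAt) (fun y => (hE y).deriv) y x
  -- A Pohozaev-type identity: the derivative is the energy plus 7/2 of the density of `num - m *
  -- den`. Over `[0, T]` the boundary terms and the latter integral vanish, leaving `T · E = 0`.
  have hG : ∀ y, HasDerivAt (fun y => 3 * (W y * p y) - 2 * (V y * u y) + 4 * (u y ^ 2 * p y))
      (E x + 7 / 2 * (W y ^ 2 + 2 * (u y * p y ^ 2) - m * u y ^ 4)) y := by
    intro y
    have := ((((hW y).fun_mul (hp y)).const_mul 3).fun_sub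
      (((hV y).fun_mul (hu y)).const_mul 2)).fun_add
      ((((hu y).fun_pow 2).fun_mul (hp y)).const_mul 4)
    convert! this using 1
    rw [← hc y]
    simp only [E]
    push_cast
    ring
  have i1 : IntervalIntegrable (fun x => W x ^ 2) volume 0 T := (cW.pow 2).intervalIntegrable _ _
  have i2 : IntervalIntegrable (fun x => 2 * (u x * p x ^ 2)) volume 0 T :=
    (continuous_const.mul (cu.mul (cp.pow 2))).intervalIntegrable _ _
  have i3 : IntervalIntegrable (fun x => m * u x ^ 4) volume 0 T :=
    (continuous_const.mul (cu.pow 4)).intervalIntegrable _ _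
  have key := sub_eq_integral (by fun_prop) hG 0 T
  rw [intervalIntegral.integral_add intervalIntegrable_const (((i1.add i2).sub i3).const_mul _),
    intervalIntegral.integral_const_mul, intervalIntegral.integral_sub (i1.add i2) i3,
    intervalIntegral.integral_add i1 i2, intervalIntegral.integral_const_mul,
    intervalIntegral.integral_const_mul, hn] at key
  simp only [p0, pT, V0, VT, mul_zero, zero_mul, sub_self, add_zero,
    intervalIntegral.integral_const, sub_zero, smul_eq_mul] at key
  exact (mul_eq_zero.1 key.symm).resolve_left hT.ne'

/-- Uniqueness for the zero solution of the Euler–Lagrange equation. -/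
theorem eq_zero_of_initial {u p W V : ℝ → ℝ} {m T : ℝ} (hu : ∀ x, HasDerivAt u (p x) x)
    (hp : ∀ x, HasDerivAt p (W x) x) (hW : ∀ x, HasDerivAt W (V x) x)
    (hV : ∀ x, HasDerivAt V (2 * u x * W x + p x ^ 2 + 2 * m * u x ^ 3) x)
    (u0 : u 0 = 0) (p0 : p 0 = 0) (W0 : W 0 = 0) (V0 : V 0 = 0) {x : ℝ} (hx : x ∈ Icc 0 T) :
    p x = 0 := by
  have cu : Continuous u := continuous_iff_continuousAt.2 fun x => (hu x).continuousAt
  have cp : Continuous p := continuous_iff_continuousAt.2 fun x => (hp x).continuousAt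
  obtain ⟨K, hK⟩ := (isCompact_Icc (a := (0 : ℝ)) (b := T)).exists_bound_of_continuousOn
    cu.continuousOn
  obtain ⟨L, hL⟩ := (isCompact_Icc (a := (0 : ℝ)) (b := T)).exists_bound_of_continuousOn
    cp.continuousOn
  simp only [Real.norm_eq_abs] at hK hL
  -- A Grönwall constant: `S = u² + p² + W² + V²` satisfies `S' ≤ C S` on `[0, T]`, where `|u| ≤ K`
  -- and `|p| ≤ L`.
  set C := 3 + 2 * K + L + 2 * |m| * K ^ 2
  have hD : ∀ y, HasDerivAt
      (fun y => -((u y ^ 2 + p y ^ 2 + W y ^ 2 + V y ^ 2) * Real.exp (-C * y)))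
      ((C * (u y ^ 2 + p y ^ 2 + W y ^ 2 + V y ^ 2) - 2 * (u y * p y + p y * W y + W y * V y +
        V y * (2 * u y * W y + p y ^ 2 + 2 * m * u y ^ 3))) * Real.exp (-C * y)) y := by
    intro y
    have := ((((((hu y).fun_pow 2).fun_add ((hp y).fun_pow 2)).fun_add
      ((hW y).fun_pow 2)).fun_add ((hV y).fun_pow 2)).fun_mul
      (((hasDerivAt_id y).const_mul (-C)).exp)).fun_neg
    convert! this using 1
    simp only [id]
    push_cast
    ring
  have hmono := monotoneOn_of_hasDerivAt (convex_Icc 0 T) (fun y _ => hD y) fun y hy => by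
    refine mul_nonneg ?_ (Real.exp_pos _).le
    have k1 := hK y hy
    have k2 := hL y hy
    have K0 : 0 ≤ K := (abs_nonneg _).trans k1
    have L0 : 0 ≤ L := (abs_nonneg _).trans k2
    have VW : |V y * W y| ≤ (u y ^ 2 + p y ^ 2 + W y ^ 2 + V y ^ 2) / 2 := by
      rw [abs_le]; constructor <;>
        nlinarith [sq_nonneg (V y + W y), sq_nonneg (V y - W y), sq_nonneg (u y), sq_nonneg (p y)]
    have Vp : |V y * p y| ≤ (u y ^ 2 + p y ^ 2 + W y ^ 2 + V y ^ 2) / 2 := by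
      rw [abs_le]; constructor <;>
        nlinarith [sq_nonneg (V y + p y), sq_nonneg (V y - p y), sq_nonneg (u y), sq_nonneg (W y)]
    have Vu : |V y * u y| ≤ (u y ^ 2 + p y ^ 2 + W y ^ 2 + V y ^ 2) / 2 := by
      rw [abs_le]; constructor <;>
        nlinarith [sq_nonneg (V y + u y), sq_nonneg (V y - u y), sq_nonneg (p y), sq_nonneg (W y)]
    set S := u y ^ 2 + p y ^ 2 + W y ^ 2 + V y ^ 2
    have S0 : 0 ≤ S := by positivity
    have t1 : u y * (V y * W y) ≤ K * (S / 2) :=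
      (le_abs_self _).trans (by rw [abs_mul]; gcongr)
    have t2 : p y * (V y * p y) ≤ L * (S / 2) :=
      (le_abs_self _).trans (by rw [abs_mul]; gcongr)
    have t3 : m * u y ^ 2 * (V y * u y) ≤ |m| * K ^ 2 * (S / 2) :=
      (le_abs_self _).trans (by rw [abs_mul, abs_mul, abs_pow]; gcongr)
    have t4 : 2 * (u y * p y + p y * W y + W y * V y) ≤ 3 * S := by
      simp only [S]
      nlinarith [sq_nonneg (u y - p y), sq_nonneg (p y - W y), sq_nonneg (W y - V y),
        sq_nonneg (u y), sq_nonneg (p y), sq_nonneg (W y), sq_nonneg (V y)]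
    have e : C * S = 3 * S + 4 * (K * (S / 2)) + 2 * (L * (S / 2)) +
      4 * (|m| * K ^ 2 * (S / 2)) := by simp only [C]; ring
    rw [e]
    linarith
  have h := hmono ⟨le_rfl, hx.1.trans hx.2⟩ hx hx.1
  simp only [u0, p0, W0, V0] at h
  norm_num at h
  have h' : u x ^ 2 + p x ^ 2 + W x ^ 2 + V x ^ 2 ≤ 0 :=
    nonpos_of_mul_nonpos_left h (Real.exp_pos _)
  have : p x ^ 2 = 0 := by
    nlinarith [sq_nonneg (u x), sq_nonneg (p x), sq_nonneg (W x), sq_nonneg (V x)]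
  exact pow_eq_zero_iff (two_ne_zero) |>.1 this

/-- A decreasing solution with zero energy and Neumann boundary conditions is positive at the
left end. -/
theorem pos_of_energy_eq_zero {u p W V : ℝ → ℝ} {m T : ℝ} (hT : 0 < T)
    (hu : ∀ x, HasDerivAt u (p x) x)
    (hp : ∀ x, HasDerivAt p (W x) x) (hW : ∀ x, HasDerivAt W (V x) x)
    (hV : ∀ x, HasDerivAt V (2 * u x * W x + p x ^ 2 + 2 * m * u x ^ 3) x)
    (p0 : p 0 = 0) (pT : p T = 0) (V0 : V 0 = 0) (VT : V T = 0) (hneg : ∀ x ∈ Ioo 0 T, p x < 0)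
    (hE : ∀ x, V x * p x - W x ^ 2 / 2 - u x * p x ^ 2 - m * u x ^ 4 / 2 = 0) : 0 < u 0 := by
  have cu : Continuous u := continuous_iff_continuousAt.2 fun x => (hu x).continuousAt
  by_contra! h0
  have hmid : T / 2 ∈ Ioo 0 T := ⟨by linarith, by linarith⟩
  rcases h0.eq_or_lt with h0 | h0
  -- Zero energy at a point where `u = p = V = 0` forces `W = 0`, so all Cauchy data vanish.
  · have W0 : W 0 = 0 := by
      have := hE 0
      rw [h0, p0, V0] at this
      nlinarith
    exact (hneg _ hmid).ne (eq_zero_of_initial hu hp hW hV h0 p0 W0 V0 (Ioo_subset_Icc_self hmid))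
  have ha : StrictAntiOn u (Icc 0 T) := by
    refine strictAntiOn_of_deriv_neg (convex_Icc _ _) cu.continuousOn fun x hx => ?_
    rw [interior_Icc] at hx
    rw [(hu x).deriv]
    exact hneg x hx
  have hun : ∀ x ∈ Icc 0 T, u x < 0 := fun x hx =>
    (ha.antitoneOn ⟨le_rfl, hT.le⟩ hx hx.1).trans_lt h0
  -- At zero energy and with `u < 0` this quantity is strictly decreasing, yet it vanishes at both
  -- ends, where `p = V = 0`.
  have hΦ : ∀ x ∈ Icc 0 T, HasDerivAt (fun y => (2 * (p y * u y) - V y) / u y ^ 4)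
      (2 * W x ^ 2 / u x ^ 5 - 3 * p x ^ 2 / u x ^ 4) x := by
    intro x hx
    have hux := (hun x hx).ne
    have := ((((hp x).fun_mul (hu x)).const_mul 2).fun_sub (hV x)).fun_div ((hu x).fun_pow 4)
      (pow_ne_zero 4 hux)
    convert! this using 1
    field_simp
    push_cast
    linear_combination (-4 * u x ^ 3) * hE x
  have hs : StrictAntiOn (fun y => (2 * (p y * u y) - V y) / u y ^ 4) (Icc 0 T) := by
    refine strictAntiOn_of_deriv_neg (convex_Icc _ _)
      (fun x hx => (hΦ x hx).continuousAt.continuousWithinAt) fun x hx => ?_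
    rw [interior_Icc] at hx
    have hx' := Ioo_subset_Icc_self hx
    rw [(hΦ x hx').deriv]
    have h1 : 2 * W x ^ 2 / u x ^ 5 ≤ 0 :=
      div_nonpos_of_nonneg_of_nonpos (by positivity) (Odd.pow_neg (by decide) (hun x hx')).le
    have h2 : 0 < 3 * p x ^ 2 / u x ^ 4 := by
      have := (hneg x hx).ne
      have := (hun x hx').ne
      positivity
    linarith
  have := hs ⟨le_rfl, hT.le⟩ ⟨hT.le, le_rfl⟩ hT
  simp [p0, pT, V0, VT] at this

/-- The smooth periodic minimizer. -/
theorem exists_smooth_minimizer : ∃ m < 0, NeumannBound m ∧ ∀ T : ℝ, 0 < T → ∃ u : ℝ → ℝ,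
    ContDiff ℝ ∞ u ∧ Function.Periodic u (2 * T) ∧
      num (-T) T u (iteratedDeriv 2 u) = m * den (-T) T u ∧
      (∀ x, u x ≤ u 0) ∧ 0 < u 0 ∧ deriv u 0 = 0 ∧ deriv u T = 0 ∧
      (∀ x, u (-x) = u x) ∧ StrictAntiOn u (Ioo 0 T) ∧
      (∃ x ∈ Ioo 0 T, ∃ y ∈ Ioo 0 T, 0 < u x ∧ u y < 0) ∧
      ∀ x, iteratedDeriv 4 u x - 2 * iteratedDeriv 2 u x * u x - deriv u x ^ 2 =
        2 * m * |u x| ^ 2 * u x := by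
  obtain ⟨m, hm, hN, H⟩ := exists_decreasing_minimizer
  refine ⟨m, hm, hN, fun T hT => ?_⟩
  obtain ⟨u₀, p₀, w₀, h₀, a0, aT, hneg₀, hn₀⟩ := H T hT
  obtain ⟨u, p, w, h, eu, ep, ue, po, we, uper, pper, wper, en⟩ :=
    exists_periodic_extension h₀ hT a0 aT
  have hn0 : num 0 T u w = m * den 0 T u := by
    rw [en, hn₀, ← den_congr hT.le eu]
  have hn : num (-T) T u w = m * den (-T) T u := by
    have r1 := num_reflect 0 T u w
    have r2 := den_reflect 0 T u
    simp only [ue, we, neg_zero] at r1 r2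
    rw [← num_add h (-T) 0 T, ← den_add h.u_cont (-T) 0 T, ← r1, ← r2, hn0]; ring
  have p0 : p 0 = 0 := by rw [ep 0 ⟨le_rfl, hT.le⟩, a0]
  have pT : p T = 0 := by rw [ep T ⟨hT.le, le_rfl⟩, aT]
  have hneg : ∀ x ∈ Ioo 0 T, p x < 0 := fun x hx => by
    rw [ep x (Ioo_subset_Icc_self hx)]; exact hneg₀ x hx
  have EL := euler_lagrange_of_periodic h hT hN uper pper wper pT hn
  have hp := fun x => (EL x).1
  have hW := fun x => (EL x).2.1
  have hV := fun x => (EL x).2.2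
  have hsm := contDiff_of_euler_lagrange h.hasDeriv hp hW hV
  have du : deriv u = p := funext fun x => (h.hasDeriv x).deriv
  have d2 : iteratedDeriv 2 u = deriv p := by
    simp [iteratedDeriv_succ, iteratedDeriv_zero, du]
  have d4 : iteratedDeriv 4 u = deriv (deriv (deriv p)) := by
    simp [iteratedDeriv_succ, iteratedDeriv_zero, du]
  have hH : IsH2 u p (deriv p) := by
    have := IsH2.of_contDiff (contDiff_infty.1 hsm 2)
    rwa [du, d2] at this
  have We : ∀ x, deriv p (-x) = deriv p x := by
    intro x
    have : p = fun y => -p (-y) := funext fun y => by rw [po, neg_neg]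
    have h1 : deriv p x = deriv (fun y => -p (-y)) x := by rw [← this]
    rw [h1, deriv.fun_neg, deriv_comp_neg, neg_neg]
  have Vo : ∀ x, deriv (deriv p) (-x) = -deriv (deriv p) x := by
    intro x
    have : deriv p = fun y => deriv p (-y) := funext fun y => (We y).symm
    have h1 : deriv (deriv p) x = deriv (fun y => deriv p (-y)) x := by rw [← this]
    rw [h1, deriv_comp_neg, neg_neg]
  have dper : ∀ f : ℝ → ℝ, Function.Periodic f (2 * T) → Function.Periodic (deriv f) (2 * T) := by
    intro f hf x
    rw [← deriv_comp_add_const]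
    congr 1
    ext y; exact hf y
  -- The third derivative is odd and `2T`-periodic, hence zero at 0 and at `T`.
  have V0 : deriv (deriv p) 0 = 0 := by
    have := Vo 0; rw [neg_zero] at this; linarith
  have VT : deriv (deriv p) T = 0 := by
    have h1 := Vo T
    have h2 := dper _ (dper _ pper) (-T)
    rw [show -T + 2 * T = T by ring] at h2
    linarith
  have hn0' : (∫ x in (0 : ℝ)..T, deriv p x ^ 2) + 2 * (∫ x in (0 : ℝ)..T, u x * p x ^ 2) =
      m * ∫ x in (0 : ℝ)..T, u x ^ 4 := by
    rw [← num_eq_of_neumann hH p0 pT, num_congr_ae hH h, hn0]; rfl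
  have hpos := pos_of_energy_eq_zero hT h.hasDeriv hp hW hV p0 pT V0 VT hneg
    (energy_eq_zero hT h.hasDeriv hp hW hV p0 pT V0 VT hn0')
  have ha : StrictAntiOn u (Icc 0 T) := by
    refine strictAntiOn_of_deriv_neg (convex_Icc _ _) h.u_cont.continuousOn fun x hx => ?_
    rw [interior_Icc] at hx
    rw [du]
    exact hneg x hx
  have hmid : T / 2 ∈ Ioo 0 T := ⟨by linarith, by linarith⟩
  have hden : 0 < den 0 T u := den_pos hT h.u_cont ⟨le_rfl, hT.le⟩ hpos.ne'
  refine ⟨u, hsm, uper, ?_, ?_, hpos, by rw [du, p0], by rw [du, pT], ue,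
    ha.mono Ioo_subset_Icc_self, ?_, ?_⟩
  · rw [d2, num_congr_ae hH h, hn]
  · intro x
    obtain ⟨y, hy, hxy⟩ := uper.exists_mem_Ico (by linarith : 0 < 2 * T) x (-T)
    rw [show -T + 2 * T = T by ring] at hy
    have key : ∀ z ∈ Icc 0 T, u z ≤ u 0 := fun z hz =>
      ha.antitoneOn ⟨le_rfl, hT.le⟩ hz hz.1
    rw [hxy]
    rcases le_total 0 y with h0 | h0
    · exact key y ⟨h0, hy.2.le⟩
    · rw [← ue]
      exact key (-y) ⟨by linarith, by linarith [hy.1]⟩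
  · have h1 : ∃ x ∈ Ioo 0 T, 0 < u x := by
      have h2 : ∀ᶠ x in nhdsWithin 0 (Ioi 0), 0 < u x :=
        (h.u_cont.continuousAt.eventually (lt_mem_nhds hpos)).filter_mono nhdsWithin_le_nhds
      have h3 : ∀ᶠ x in nhdsWithin (0 : ℝ) (Ioi 0), x ∈ Ioo 0 T := Ioo_mem_nhdsGT hT
      obtain ⟨x, hx⟩ := (h2.and h3).exists
      exact ⟨x, hx.2, hx.1⟩
    -- For `u ≥ 0` the numerator `∫ (u'')² + 2 ∫ u (u')²` would be nonnegative, but it equals `m *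
    -- den < 0`.
    have h2 : ∃ y ∈ Ioo 0 T, u y < 0 := by
      by_contra! hc
      have hc' : ∀ x ∈ Icc 0 T, 0 ≤ u x * p x ^ 2 := by
        intro x hx
        rcases hx.1.eq_or_lt with e | e
        · rw [← e, p0]; simp
        rcases hx.2.eq_or_lt with e' | e'
        · rw [e', pT]; simp
        exact mul_nonneg (hc x ⟨e, e'⟩) (sq_nonneg _)
      have i1 : 0 ≤ ∫ x in (0 : ℝ)..T, u x * p x ^ 2 :=
        intervalIntegral.integral_nonneg hT.le hc'
      have i2 : 0 ≤ ∫ x in (0 : ℝ)..T, deriv p x ^ 2 :=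
        intervalIntegral.integral_nonneg hT.le fun x _ => sq_nonneg _
      have := mul_neg_of_neg_of_pos hm hden
      unfold den at this
      linarith
    obtain ⟨x, hx, hux⟩ := h1
    obtain ⟨y, hy, huy⟩ := h2
    exact ⟨x, hx, y, hy, hux, huy⟩
  · intro x
    rw [d4, d2, du, (hV x).deriv, sq_abs]
    ring

/-! ### From distributional derivatives to `C¹` representatives -/

theorem integral_eq_intervalIntegral {f : ℝ → ℝ} {R : ℝ} (h : ∀ x, R ≤ |x| → f x = 0) :
    ∫ x, f x = ∫ x in -R..R, f x := by
  refine (intervalIntegral.integral_eq_integral_of_support_subset fun x hx => ?_).symm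
  have : |x| < R := not_le.1 fun hc => hx (h x hc)
  exact ⟨(abs_lt.1 this).1, (abs_lt.1 this).2.le⟩

/-- A test function of mean zero is the derivative of a test function. -/
theorem exists_test_primitive {ψ : ℝ → ℝ} (hψ : ContDiff ℝ ∞ ψ) (hc : HasCompactSupport ψ)
    (h0 : ∫ x, ψ x = 0) :
    ∃ Ψ : ℝ → ℝ, ContDiff ℝ ∞ Ψ ∧ HasCompactSupport Ψ ∧ deriv Ψ = ψ := by
  obtain ⟨R, hR, hz⟩ := hc.exists_pos_le_norm
  simp only [Real.norm_eq_abs] at hz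
  have hd : ∀ x, HasDerivAt (fun y => ∫ t in -R..y, ψ t) (ψ x) x :=
    hasDerivAt_primitive hψ.continuous _
  have hd' : deriv (fun y => ∫ t in -R..y, ψ t) = ψ := funext fun x => (hd x).deriv
  refine ⟨fun y => ∫ t in -R..y, ψ t, ?_, ?_, hd'⟩
  · rw [contDiff_infty_iff_deriv, hd']
    exact ⟨fun x => (hd x).differentiableAt, hψ⟩
  · refine HasCompactSupport.intro (isCompact_Icc (a := -R) (b := R)) fun x hx => ?_
    have hz' : ∀ a b, (∀ t ∈ uIcc a b, R ≤ |t|) → ∫ t in a..b, ψ t = 0 := by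
      intro a b hab
      rw [intervalIntegral.integral_congr (g := fun _ => (0 : ℝ)) fun t ht => hz t (hab t ht)]
      simp
    rcases lt_or_ge x (-R) with h | h
    · refine hz' _ _ fun t ht => ?_
      rw [uIcc_of_ge h.le] at ht
      rw [abs_of_nonpos (by linarith [ht.2])]
      linarith [ht.2]
    · have hxR : R < x := not_le.1 fun hc => hx ⟨h, hc⟩
      rw [← intervalIntegral.integral_add_adjacent_intervals
        (hψ.continuous.intervalIntegrable (-R) R) (hψ.continuous.intervalIntegrable R x),
        ← integral_eq_intervalIntegral hz, h0, zero_add]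
      refine hz' _ _ fun t ht => ?_
      rw [uIcc_of_le hxR.le] at ht
      exact ht.1.trans (le_abs_self t)

theorem exists_test_integral_one :
    ∃ ρ : ℝ → ℝ, ContDiff ℝ ∞ ρ ∧ HasCompactSupport ρ ∧ ∫ x, ρ x = 1 := by
  let f : ContDiffBump (0 : ℝ) := ⟨1, 2, by norm_num, by norm_num⟩
  exact ⟨f.normed volume, f.contDiff_normed, f.hasCompactSupport_normed, f.integral_normed⟩

theorem integrable_mul_test {f φ : ℝ → ℝ} (hf : LocallyIntegrable f volume)
    (hφ : Continuous φ) (hc : HasCompactSupport φ) : Integrable (fun x => f x * φ x) := by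
  have := hf.integrable_smul_left_of_hasCompactSupport hφ hc
  simpa [mul_comm] using this

/-- A locally integrable function with vanishing weak derivative is constant. -/
theorem ae_const_of_weak_deriv_eq_zero {f : ℝ → ℝ} (hf : LocallyIntegrable f volume)
    (h : ∀ φ : ℝ → ℝ, ContDiff ℝ ∞ φ → HasCompactSupport φ → ∫ x, f x * deriv φ x = 0) :
    ∃ c : ℝ, ∀ᵐ x, f x = c := by
  obtain ⟨ρ, hρ, hρc, hρ1⟩ := exists_test_integral_one
  refine ⟨∫ x, f x * ρ x, ae_eq_of_integral_contDiff_smul_eq hf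
    (continuous_const.locallyIntegrable) fun g hg hgc => ?_⟩
  have ig : Integrable g := hg.continuous.integrable_of_hasCompactSupport hgc
  have iρ : Integrable ρ := hρ.continuous.integrable_of_hasCompactSupport hρc
  -- Subtracting a multiple of `ρ` makes the mean zero, so the difference is the derivative of a
  -- test function.
  obtain ⟨Ψ, h1, h2, h3⟩ := exists_test_primitive (ψ := fun x => g x - (∫ y, g y) * ρ x)
    (hg.sub (contDiff_const.mul hρ)) (hgc.sub hρc.mul_left)
    (by rw [integral_sub ig (iρ.const_mul _), integral_const_mul, hρ1]; ring)
  have := h Ψ h1 h2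
  rw [h3] at this
  have e : ∀ x, f x * (g x - (∫ y, g y) * ρ x) = f x * g x - (∫ y, g y) * (f x * ρ x) :=
    fun x => by ring
  simp only [e] at this
  rw [integral_sub (integrable_mul_test hf hg.continuous hgc)
    ((integrable_mul_test hf hρ.continuous hρc).const_mul _), integral_const_mul] at this
  simp only [smul_eq_mul]
  rw [integral_mul_const, ← sub_eq_zero, ← this]
  simp only [mul_comm]

/-- A locally integrable function with vanishing weak second derivative is affine. -/
theorem ae_affine_of_weak_second_deriv_eq_zero {f : ℝ → ℝ} (hf : LocallyIntegrable f volume)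
    (h : ∀ φ : ℝ → ℝ, ContDiff ℝ ∞ φ → HasCompactSupport φ →
      ∫ x, f x * deriv (deriv φ) x = 0) :
    ∃ c k : ℝ, ∀ᵐ x, f x = c + k * x := by
  obtain ⟨ρ, hρ, hρc, hρ1⟩ := exists_test_integral_one
  have dsm : ∀ {φ : ℝ → ℝ}, ContDiff ℝ ∞ φ → ContDiff ℝ ∞ (deriv φ) := fun hφ =>
    (contDiff_infty_iff_deriv.1 hφ).2
  -- The weak derivative tested against `ρ`: the only possible slope.
  set k := -∫ x, f x * deriv ρ x
  have hl : LocallyIntegrable (fun x => f x - k * x) volume :=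
    hf.sub (continuous_const.mul continuous_id).locallyIntegrable
  obtain ⟨c, hc⟩ := ae_const_of_weak_deriv_eq_zero hl fun g hg hgc => by
    have ig : Integrable g := hg.continuous.integrable_of_hasCompactSupport hgc
    have iρ : Integrable ρ := hρ.continuous.integrable_of_hasCompactSupport hρc
    obtain ⟨Ψ, h1, h2, h3⟩ := exists_test_primitive (ψ := fun x => g x - (∫ y, g y) * ρ x)
      (hg.sub (contDiff_const.mul hρ)) (hgc.sub hρc.mul_left)
      (by rw [integral_sub ig (iρ.const_mul _), integral_const_mul, hρ1]; ring)
    have e3 : deriv (deriv Ψ) = fun x => deriv g x - (∫ y, g y) * deriv ρ x := by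
      rw [h3]
      ext x
      exact ((hg.differentiable (by simp) x).hasDerivAt.fun_sub
        ((hρ.differentiable (by simp) x).hasDerivAt.const_mul _)).deriv
    have i1 := integrable_mul_test hf (dsm hg).continuous hgc.deriv
    have i2 := integrable_mul_test hf (dsm hρ).continuous hρc.deriv
    have h4 := h Ψ h1 h2
    rw [e3] at h4
    have e : ∀ x, f x * (deriv g x - (∫ y, g y) * deriv ρ x) =
      f x * deriv g x - (∫ y, g y) * (f x * deriv ρ x) := fun x => by ring
    simp only [e] at h4
    rw [integral_sub i1 (i2.const_mul _), integral_const_mul] at h4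
    have i3 : Integrable fun x => x * deriv g x :=
      integrable_mul_test continuous_id.locallyIntegrable (dsm hg).continuous hgc.deriv
    have h5 : ∫ x, x * deriv g x = -∫ x, g x := by
      have := integral_mul_deriv_eq_deriv_mul_of_integrable (u := fun x : ℝ => x) (v := g)
        (u' := fun _ => 1) (v' := deriv g) (fun x _ => hasDerivAt_id x)
        (fun x _ => (hg.differentiable (by simp) x).hasDerivAt) i3 (by simpa [Pi.mul_def] using ig)
        (integrable_mul_test continuous_id.locallyIntegrable hg.continuous hgc)
      simpa using this
    have e' : ∀ x, (f x - k * x) * deriv g x = f x * deriv g x - k * (x * deriv g x) :=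
      fun x => by ring
    simp only [e']
    rw [integral_sub i1 (i3.const_mul _), integral_const_mul, h5]
    simp only [k]
    linarith
  refine ⟨c, k, ?_⟩
  filter_upwards [hc] with x hx
  linarith

/-- Functions with weak second derivative in `L²_loc` have a `C¹` representative. -/
theorem exists_isH2_of_hasWeakSecondDeriv {u w : ℝ → ℝ} (h : HasWeakSecondDeriv u w)
    (hs : ∀ a b, IntervalIntegrable (fun x => w x ^ 2) volume a b) :
    ∃ v p : ℝ → ℝ, IsH2 v p w ∧ u =ᵐ[volume] v := by
  obtain ⟨hu, hw, hφ⟩ := h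
  have hH := IsH2.mk_of hw.aestronglyMeasurable hs 0 0 0
  set P : ℝ → ℝ := fun x => 0 + ∫ s in (0 : ℝ)..x, w s
  set U : ℝ → ℝ := fun x => 0 + ∫ t in (0 : ℝ)..x, P t
  have dsm : ∀ {φ : ℝ → ℝ}, ContDiff ℝ ∞ φ → ContDiff ℝ ∞ (deriv φ) := fun hφ =>
    (contDiff_infty_iff_deriv.1 hφ).2
  -- The double primitive `U` of `w` has the same weak second derivative as `u`, so the two differ
  -- by an affine function.
  obtain ⟨c, k, hck⟩ := ae_affine_of_weak_second_deriv_eq_zero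
    (f := fun x => u x - U x) (hu.sub hH.u_cont.locallyIntegrable) fun φ h1 h2 => by
    have e2 : iteratedDeriv 2 φ = deriv (deriv φ) := by
      simp [iteratedDeriv_succ, iteratedDeriv_zero]
    have c2 := (dsm (dsm h1)).continuous
    obtain ⟨R₀, hR₀, z0⟩ := h2.exists_pos_le_norm
    obtain ⟨R₁, hR₁, z1⟩ := h2.deriv.exists_pos_le_norm
    obtain ⟨R₂, hR₂, z2⟩ := h2.deriv.deriv.exists_pos_le_norm
    simp only [Real.norm_eq_abs] at z0 z1 z2
    set R := max R₀ (max R₁ R₂)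
    have hR : 0 < R := hR₀.trans_le (le_max_left _ _)
    have a0 : ∀ x, R ≤ |x| → φ x = 0 := fun x hx => z0 x ((le_max_left _ _).trans hx)
    have a1 : ∀ x, R ≤ |x| → deriv φ x = 0 := fun x hx =>
      z1 x (((le_max_left _ _).trans (le_max_right _ _)).trans hx)
    have a2 : ∀ x, R ≤ |x| → deriv (deriv φ) x = 0 := fun x hx =>
      z2 x (((le_max_right _ _).trans (le_max_right _ _)).trans hx)
    have s1 := sub_eq_integral (dsm h1).continuous
      fun x => (h1.differentiable (by simp) x).hasDerivAt
    have s2 := sub_eq_integral c2 fun x => ((dsm h1).differentiable (by simp) x).hasDerivAt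
    have p1 := integral_mul_primitive_parts (fun a b => hH.p_cont.intervalIntegrable a b)
      hH.u_sub (fun a b => c2.intervalIntegrable a b) s2 (-R) R
    have p2 := integral_mul_primitive_parts hH.w_int
      hH.der (fun a b => (dsm h1).continuous.intervalIntegrable a b) s1 (-R) R
    have r1 : R ≤ |R| := le_abs_self R
    have r2 : R ≤ |(-R)| := by rw [abs_neg]; exact r1
    rw [a1 R r1, a1 (-R) r2, mul_zero, mul_zero, p2, a0 R r1, a0 (-R) r2] at p1
    have q1 : ∫ x, U x * deriv (deriv φ) x = ∫ x in -R..R, U x * deriv (deriv φ) x :=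
      integral_eq_intervalIntegral fun x hx => by rw [a2 x hx, mul_zero]
    have q2 : ∫ x, w x * φ x = ∫ x in -R..R, w x * φ x :=
      integral_eq_intervalIntegral fun x hx => by rw [a0 x hx, mul_zero]
    have key := hφ φ h1 h2
    rw [e2] at key
    simp only [sub_mul]
    rw [integral_sub (integrable_mul_test hu c2 h2.deriv.deriv)
      (integrable_mul_test hH.u_cont.locallyIntegrable c2 h2.deriv.deriv), key, q1, q2, p1]
    ring
  refine ⟨fun x => U x + (c + k * x), fun x => P x + k, ⟨hH.meas, hH.sq, fun a b => ?_,
    fun x => ?_⟩, ?_⟩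
  · rw [← hH.der]; ring
  · have := (hH.hasDeriv x).fun_add (((hasDerivAt_id x).const_mul k).const_add c)
    simpa using this
  · filter_upwards [hck] with x hx
    linarith

/-! ### The lower bound for admissible functions -/

/-- The numerator only depends on the function on the interval. -/
theorem num_congr_of_eqOn {u p w v q z : ℝ → ℝ} (h : IsH2 u p w) (k : IsH2 v q z) {a b : ℝ}
    (hab : a ≤ b) (huv : ∀ x ∈ Ioo a b, v x = u x) : num a b v z = num a b u w := by
  have hp : ∀ x ∈ Ioo a b, q x = p x := by
    intro x hx
    have e : v =ᶠ[nhds x] u := by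
      filter_upwards [Ioo_mem_nhds hx.1 hx.2] with y hy using huv y hy
    exact ((h.hasDeriv x).congr_of_eventuallyEq e).unique (k.hasDeriv x) |>.symm
  have hae : ∀ᵐ x, x ∈ uIoc a b → z x = w x ∧ v x = u x := by
    filter_upwards [h.ae_hasDerivAt, k.ae_hasDerivAt, compl_mem_ae_iff.2 (measure_singleton b)]
      with x h1 h2 hxb hx
    rw [uIoc_of_le hab] at hx
    have hx' : x ∈ Ioo a b := ⟨hx.1, lt_of_le_of_ne hx.2 hxb⟩
    have e : q =ᶠ[nhds x] p := by
      filter_upwards [Ioo_mem_nhds hx'.1 hx'.2] with y hy using hp y hy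
    exact ⟨h2.unique (h1.congr_of_eventuallyEq e), huv x hx'⟩
  unfold num
  congr 1 <;> refine intervalIntegral.integral_congr_ae ?_ <;> filter_upwards [hae] with x hx hx'
  · rw [(hx hx').1]
  · rw [(hx hx').1, (hx hx').2]

theorem num_add_right (a b c : ℝ) (u w : ℝ → ℝ) :
    num a b (fun x => u (x + c)) (fun x => w (x + c)) = num (a + c) (b + c) u w := by
  have := num_affine a b u w (s := 1) one_ne_zero c
  simpa using this

theorem den_add_right (a b c : ℝ) (u : ℝ → ℝ) :
    den a b (fun x => u (x + c)) = den (a + c) (b + c) u := by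
  have := den_affine a b u (s := 1) one_ne_zero c
  simpa using this

theorem IsH2.comp_add_right {u p w : ℝ → ℝ} (h : IsH2 u p w) (c : ℝ) :
    IsH2 (fun x => u (x + c)) (fun x => p (x + c)) (fun x => w (x + c)) := by
  have := h.comp_affine one_ne_zero c
  simpa using this

theorem num_shift {u p w : ℝ → ℝ} (h : IsH2 u p w) {c : ℝ} (hu : ∀ x, u (x + c) = u x) {a b : ℝ}
    (hab : a ≤ b) : num (a + c) (b + c) u w = num a b u w := by
  rw [← num_add_right]
  exact num_congr_of_eqOn h (h.comp_add_right c) hab fun x _ => hu x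

theorem den_shift {u : ℝ → ℝ} {c : ℝ} (hu : ∀ x, u (x + c) = u x) (a b : ℝ) :
    den (a + c) (b + c) u = den a b u := by
  rw [← den_add_right]
  simp only [hu]

open Filter Topology in
/-- A function of finite energy on the line has a critical point. -/
theorem exists_critical_point {u p w : ℝ → ℝ} (h : IsH2 u p w) (hw : MemLp w 2 volume)
    (hu : Integrable fun x => u x ^ 4) : ∃ x, p x = 0 := by
  have main : ∀ v q z : ℝ → ℝ, IsH2 v q z → MemLp z 2 volume → (Integrable fun x => v x ^ 4) →
      Tendsto v atTop (𝓝 0) := by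
    intro v q z hv hz hv4
    have := tendsto_zero_of_bounds hv (a := 0) (C := max (∫ x, z x ^ 2) (∫ x, v x ^ 4))
      (fun R hR => (intervalIntegral_sq_le hz hR).trans (le_max_left _ _))
      (fun R hR => by
        refine le_trans ?_ (le_max_right _ _)
        unfold den
        rw [intervalIntegral.integral_of_le hR]
        exact setIntegral_le_integral hv4 (Eventually.of_forall fun x => by positivity))
    refine squeeze_zero_norm (fun x => ?_) this
    rw [Real.norm_eq_abs]
    linarith [abs_nonneg (q x)]
  have ht := main u p w h hw hu
  have hb : Tendsto u atBot (𝓝 0) := by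
    have := main _ _ _ h.reflect
      (hw.comp_measurePreserving (Measure.measurePreserving_neg volume)) hu.comp_neg
    simpa [Function.comp_def] using this.comp tendsto_neg_atBot_atTop
  -- Without critical points `u` would be strictly monotone, although it tends to zero at both ends.
  by_contra! hc
  have hsign : (∀ x, 0 < p x) ∨ ∀ x, p x < 0 := by
    by_contra! hc'
    obtain ⟨⟨x, hx⟩, y, hy⟩ := hc'
    obtain ⟨t, -, h0⟩ := isPreconnected_univ.intermediate_value (mem_univ x) (mem_univ y)
      h.p_cont.continuousOn ⟨hx, hy⟩
    exact hc t h0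
  have hd : ∀ x, deriv u x = p x := fun x => (h.hasDeriv x).deriv
  rcases hsign with hp | hp
  · have hs : StrictMono u := strictMono_of_deriv_pos fun x => by rw [hd]; exact hp x
    have h1 := hs.monotone.ge_of_tendsto ht 1
    have h2 := hs.monotone.le_of_tendsto hb 0
    have h3 := hs one_pos
    linarith
  · have hs : StrictAnti u := strictAnti_of_deriv_neg fun x => by rw [hd]; exact hp x
    have h1 := hs.antitone.le_of_tendsto ht 1
    have h2 := hs.antitone.ge_of_tendsto hb 0
    have h3 := hs one_pos
    linarith

open Filter Topology in
/-- The Neumann bound passes to the whole line. -/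
theorem NeumannBound.line {m : ℝ} (hm : NeumannBound m) {u p w : ℝ → ℝ} (h : IsH2 u p w)
    (hw : MemLp w 2 volume) (hu : Integrable fun x => u x ^ 4)
    (hwu : Integrable fun x => w x * u x ^ 2) :
    m * ∫ x, u x ^ 4 ≤ (∫ x, w x ^ 2) - ∫ x, w x * u x ^ 2 := by
  have half : ∀ v q z : ℝ → ℝ, IsH2 v q z → MemLp z 2 volume → (Integrable fun x => v x ^ 4) →
      ∀ x₀, q x₀ = 0 → ∀ ε > 0, ∀ᶠ R in atTop, m * den x₀ R v ≤ num x₀ R v z + ε := by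
    intro v q z hv hz hv4 x₀ h0 ε hε
    exact hm.half_line hv (b := x₀) (C := max (∫ x, z x ^ 2) (∫ x, v x ^ 4)) h0
      (fun R hR => (intervalIntegral_sq_le hz hR).trans (le_max_left _ _))
      (fun R hR => by
        refine le_trans ?_ (le_max_right _ _)
        unfold den
        rw [intervalIntegral.integral_of_le hR]
        exact setIntegral_le_integral hv4 (Eventually.of_forall fun x => by positivity)) hε
  -- The critical point splits the line into two half lines with a Neumann end; the left one is
  -- reflected.
  obtain ⟨x₀, h0⟩ := exists_critical_point h hw hu
  refine le_of_forall_pos_le_add fun ε hε => ?_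
  have e1 := half u p w h hw hu x₀ h0 (ε / 2) (by positivity)
  have e2 := half _ _ _ h.reflect
    (hw.comp_measurePreserving (Measure.measurePreserving_neg volume)) hu.comp_neg (-x₀)
    (by simp [h0]) (ε / 2) (by positivity)
  have t1 := (intervalIntegral_tendsto_integral hu tendsto_neg_atTop_atBot tendsto_id).const_mul m
  have t2 := ((intervalIntegral_tendsto_integral hw.integrable_sq tendsto_neg_atTop_atBot
    tendsto_id).sub (intervalIntegral_tendsto_integral hwu tendsto_neg_atTop_atBot
      tendsto_id)).add_const ε
  refine le_of_tendsto_of_tendsto t1 t2 ?_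
  filter_upwards [e1, e2] with R h1 h2
  rw [num_reflect, den_reflect, neg_neg] at h2
  have n1 := num_add h (-R) x₀ R
  have n2 := den_add h.u_cont (-R) x₀ R
  unfold num den at *
  simp only [id] at *
  rw [← n1, ← n2]
  linarith

/-- The Neumann bound holds for the admissible functions on the line. -/
theorem NeumannBound.le_lineValues {m : ℝ} (hm : NeumannBound m) {q : ℝ} (hq : q ∈ lineValues) :
    m ≤ q := by
  obtain ⟨u, w, ⟨hu, hw, hweak, hne⟩, rfl⟩ := hq
  obtain ⟨v, p, hH, huv⟩ := exists_isH2_of_hasWeakSecondDeriv hweak (intervalIntegrable_sq_of_memLp hw)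
  have i4 : Integrable (fun x => u x ^ 4) := by
    have := hu.integrable_norm_pow (p := 4) (by norm_num)
    refine this.congr (Filter.Eventually.of_forall fun x => ?_)
    simp [Even.pow_abs (show Even 4 by decide)]
  have i3 : Integrable (fun x => w x * u x ^ 2) := by
    refine (hw.integrable_sq.add i4).mono' (hw.1.mul (hu.1.pow 2))
      (Filter.Eventually.of_forall fun x => ?_)
    rw [Real.norm_eq_abs, abs_le, Pi.add_apply]
    constructor <;> nlinarith [sq_nonneg (w x + u x ^ 2), sq_nonneg (w x - u x ^ 2),
      sq_nonneg (w x), sq_nonneg (u x ^ 2)]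
  have c4 : (fun x => u x ^ 4) =ᵐ[volume] fun x => v x ^ 4 := by
    filter_upwards [huv] with x hx
    rw [hx]
  have c3 : (fun x => w x * u x ^ 2) =ᵐ[volume] fun x => w x * v x ^ 2 := by
    filter_upwards [huv] with x hx
    rw [hx]
  have key := hm.line hH hw (i4.congr c4) (i3.congr c3)
  have hpos : 0 < ∫ x, v x ^ 4 := by
    refine (integral_nonneg fun x => by positivity).lt_of_ne' fun h0 => hne ?_
    have := (integral_eq_zero_iff_of_nonneg (fun x => by positivity) (i4.congr c4)).1 h0
    filter_upwards [huv, this] with x h1 h2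
    rw [h1]
    simpa using h2
  unfold quotientQ
  simp only [Measure.restrict_univ]
  rw [integral_congr_ae c4, integral_congr_ae c3, le_div_iff₀ hpos]
  exact key

theorem quotientQ_Ico {T : ℝ} (hT : 0 < T) (u w : ℝ → ℝ) :
    quotientQ (Ico (-T) T) u w = num (-T) T u w / den (-T) T u := by
  have hT' : -T ≤ T := by linarith
  unfold quotientQ num den
  simp only [integral_Ico_eq_integral_Ioc, intervalIntegral.integral_of_le hT']

/-- The Neumann bound holds for the admissible periodic functions. -/
theorem NeumannBound.le_quotientQ {m : ℝ} (hm : NeumannBound m) {T : ℝ} (hT : 0 < T)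
    {u w : ℝ → ℝ} (h : PeriodicAdmissible T u w) : m ≤ quotientQ (Ico (-T) T) u w := by
  obtain ⟨-, hw, hweak, hper, hne⟩ := h
  have hs : ∀ a b, IntervalIntegrable (fun x => w x ^ 2) volume a b := fun a b => by
    have : IntegrableOn (fun x => w x ^ 2) (uIcc a b) volume :=
      MemLp.integrable_sq (hw _ isCompact_uIcc)
    exact this.intervalIntegrable
  obtain ⟨v, p, hH, huv⟩ := exists_isH2_of_hasWeakSecondDeriv hweak hs
  have vper : Function.Periodic v (2 * T) := by
    have h1 : (fun x => u (x + 2 * T)) =ᵐ[volume] fun x => v (x + 2 * T) :=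
      (measurePreserving_add_right volume (2 * T)).quasiMeasurePreserving.ae_eq_comp huv
    have h2 : (fun x => v (x + 2 * T)) =ᵐ[volume] v := h1.symm.trans (hper.trans huv)
    have hc : Continuous fun x => v (x + 2 * T) := hH.u_cont.comp (continuous_add_const _)
    exact congrFun ((hc.ae_eq_iff_eq volume hH.u_cont).1 h2)
  have pper : Function.Periodic p (2 * T) := fun x => by
    have h1 := (hH.comp_add_right (2 * T)).hasDeriv x
    rw [show (fun x => v (x + 2 * T)) = v from funext vper] at h1
    exact h1.unique (hH.hasDeriv x)
  -- Rolle's theorem on one period; the translated period `[c, c + 2T]` then has critical points at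
  -- both ends.
  obtain ⟨c, hc, hpc⟩ := exists_hasDerivAt_eq_zero (f := v) (f' := p) (a := -T) (b := T)
    (by linarith) hH.u_cont.continuousOn
    (by rw [← vper (-T)]; congr 1; ring) fun x _ => hH.hasDeriv x
  have key := hm v p w hH c (c + 2 * T) (by linarith) hpc (by rw [pper, hpc])
  have n1 := num_add hH c T (c + 2 * T)
  have n2 := num_shift hH vper hc.1.le
  have n3 := num_add hH (-T) c T
  have d1 := den_add hH.u_cont c T (c + 2 * T)
  have d2 := den_shift vper (-T) c
  have d3 := den_add hH.u_cont (-T) c T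
  rw [show -T + 2 * T = T by ring] at n2 d2
  have hx : ∃ x, v x ≠ 0 := by
    by_contra! h0
    refine hne ?_
    filter_upwards [huv] with x hx
    rw [hx, h0]; rfl
  obtain ⟨x, hx⟩ := hx
  obtain ⟨y, hy, hxy⟩ := vper.exists_mem_Ico (by linarith : 0 < 2 * T) x (-T)
  rw [show -T + 2 * T = T by ring] at hy
  have hpos : 0 < den (-T) T v :=
    den_pos (by linarith) hH.u_cont (Ico_subset_Icc_self hy) (hxy ▸ hx)
  have en : num (-T) T u w = num (-T) T v w := by
    unfold num
    congr 1
    refine intervalIntegral.integral_congr_ae ?_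
    filter_upwards [huv] with x hx _
    rw [hx]
  have ed : den (-T) T u = den (-T) T v := by
    refine intervalIntegral.integral_congr_ae ?_
    filter_upwards [huv] with x hx _
    rw [hx]
  rw [quotientQ_Ico hT, en, ed, le_div_iff₀ hpos, show den (-T) T v = den c (c + 2 * T) v by linarith]
  linarith

/-! ### The upper bound by cutting off periodic functions -/

/-- For smooth compactly supported functions, the quotient on the line is that on an interval. -/
theorem infimumI_mul_den_le {f : ℝ → ℝ} (hf : ContDiff ℝ ∞ f) {a b : ℝ} (hab : a ≤ b)
    (h0 : ∀ x, x ∉ Icc a b → f x = 0) (hne : f ≠ 0) :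
    infimumI * den a b f ≤ num a b f (iteratedDeriv 2 f) := by
  have hf2 : ContDiff ℝ 2 f := contDiff_infty.1 hf 2
  have hc : HasCompactSupport f := HasCompactSupport.intro isCompact_Icc h0
  have hw : Continuous (iteratedDeriv 2 f) := hf2.continuous_iteratedDeriv 2 le_rfl
  have hw0 : ∀ x, x ∉ Icc a b → iteratedDeriv 2 f x = 0 := by
    intro x hx
    have e : f =ᶠ[nhds x] fun _ => 0 := by
      filter_upwards [isClosed_Icc.isOpen_compl.mem_nhds hx] with y hy using h0 y hy
    rw [e.iteratedDeriv_eq 2]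
    simp
  have hcw : HasCompactSupport (iteratedDeriv 2 f) := HasCompactSupport.intro isCompact_Icc hw0
  have hint : ∀ g : ℝ → ℝ, (∀ x, x ∉ Icc a b → g x = 0) → ∫ x, g x = ∫ x in a..b, g x := by
    intro g hg
    rw [intervalIntegral.integral_of_le hab, ← integral_Icc_eq_integral_Ioc,
      setIntegral_eq_integral_of_forall_compl_eq_zero hg]
  have hmem : quotientQ univ f (iteratedDeriv 2 f) ∈ lineValues :=
    ⟨f, iteratedDeriv 2 f, ⟨hf.continuous.memLp_of_hasCompactSupport hc,
      hw.memLp_of_hasCompactSupport hcw, hasWeakSecondDeriv_of_contDiff hf2, fun h =>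
        hne ((hf.continuous.ae_eq_iff_eq volume continuous_const).1 h)⟩, rfl⟩
  have hle := isGLB_infimumI.1 hmem
  have hpos : 0 < ∫ x, f x ^ 4 := by
    obtain ⟨x, hx⟩ := Function.ne_iff.1 hne
    refine (hf.continuous.pow 4).integral_pos_of_hasCompactSupport_nonneg_nonzero
      (hc.comp_left (g := fun y => y ^ 4) (by norm_num)) (fun x => by positivity)
      (x := x) (pow_ne_zero 4 hx)
  unfold quotientQ at hle
  simp only [Measure.restrict_univ] at hle
  rw [le_div_iff₀ hpos, hint _ fun x hx => by simp [h0 x hx], hint _ fun x hx => by simp [hw0 x hx],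
    hint (fun x => iteratedDeriv 2 f x * f x ^ 2) fun x hx => by simp [hw0 x hx]] at hle
  exact hle

/-- Cutting off a smooth periodic function gives test functions for the problem on the line. -/
theorem infimumI_le_of_periodic {V : ℝ → ℝ} {m : ℝ} (hV : ContDiff ℝ ∞ V)
    (hper : Function.Periodic V (2 * 1)) (h0 : 0 < V 0)
    (hn : num (-1) 1 V (iteratedDeriv 2 V) = m * den (-1) 1 V) : infimumI ≤ m := by
  have sm : ContDiff ℝ ∞ Real.smoothTransition := Real.smoothTransition.contDiff
  have sm' : ∀ c : ℝ, ContDiff ℝ ∞ fun x => Real.smoothTransition (c - x) := fun c =>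
    sm.comp (contDiff_const.sub contDiff_id)
  have toH : ∀ {f : ℝ → ℝ}, ContDiff ℝ ∞ f → IsH2 f (deriv f) (iteratedDeriv 2 f) := fun hf =>
    IsH2.of_contDiff (contDiff_infty.1 hf 2)
  set g₁ : ℝ → ℝ := fun x => V x * Real.smoothTransition x
  set g₃ : ℝ → ℝ := fun x => V x * Real.smoothTransition (2 - x)
  have hg₁ : ContDiff ℝ ∞ g₁ := hV.mul sm
  have hg₃ : ContDiff ℝ ∞ g₃ := hV.mul (sm' 2)
  -- Contributions of the two cut-off layers. By periodicity the right layer can be shifted back by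
  -- `2n`, so `A` and `B` do not depend on `n`.
  set A := num 0 1 g₁ (iteratedDeriv 2 g₁) + num 1 2 g₃ (iteratedDeriv 2 g₃)
  set B := den 0 1 g₁ + den 1 2 g₃
  have hper' : ∀ n : ℕ, ∀ x, V (x + 2 * n) = V x := fun n x => by
    have := hper.nat_mul n x
    rw [← this]; congr 1; ring
  have mid : ∀ n : ℕ, num 1 (2 * n + 1) V (iteratedDeriv 2 V) = n * (m * den (-1) 1 V) ∧
      den 1 (2 * n + 1) V = n * den (-1) 1 V := by
    intro n
    induction n with
    | zero => simp [num, den]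
    | succ n ih =>
      have e1 : (-1 : ℝ) + 2 * (n + 1 : ℕ) = 2 * n + 1 := by push_cast; ring
      have e2 : (1 : ℝ) + 2 * (n + 1 : ℕ) = 2 * (n + 1 : ℕ) + 1 := by ring
      have s1 := num_shift (toH hV) (hper' (n + 1)) (a := -1) (b := 1) (by norm_num)
      have s2 := den_shift (hper' (n + 1)) (-1) 1
      rw [e1, e2] at s1 s2
      rw [← num_add (toH hV) 1 (2 * n + 1), ← den_add hV.continuous 1 (2 * n + 1), s1, s2, hn,
        ih.1, ih.2]
      push_cast
      exact ⟨by ring, by ring⟩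
  have hD : 0 < den (-1) 1 V :=
    den_pos (by norm_num) hV.continuous ⟨by norm_num, by norm_num⟩ h0.ne'
  have key : ∀ n : ℕ, 1 ≤ n →
      infimumI * (n * den (-1) 1 V + B) ≤ n * (m * den (-1) 1 V) + A := by
    intro n hn1
    have hn1' : (1 : ℝ) ≤ n := by exact_mod_cast hn1
    set f : ℝ → ℝ := fun x => V x * Real.smoothTransition x *
      Real.smoothTransition (2 * n + 2 - x)
    have hf : ContDiff ℝ ∞ f := (hV.mul sm).mul (sm' (2 * n + 2))
    have f₁ : ∀ x ∈ Icc (0 : ℝ) 1, f x = g₁ x := fun x hx => by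
      simp only [f, g₁]
      rw [Real.smoothTransition.one_of_one_le (x := 2 * n + 2 - x) (by linarith [hx.2]), mul_one]
    have f₂ : ∀ x ∈ Icc (1 : ℝ) (2 * n + 1), f x = V x := fun x hx => by
      simp only [f]
      rw [Real.smoothTransition.one_of_one_le (x := 2 * n + 2 - x) (by linarith [hx.2]),
        Real.smoothTransition.one_of_one_le hx.1, mul_one, mul_one]
    have f₃ : ∀ x ∈ Icc (1 : ℝ) 2, f (x + 2 * n) = g₃ x := fun x hx => by
      simp only [f, g₃]
      rw [Real.smoothTransition.one_of_one_le (x := x + 2 * n) (by linarith [hx.1]), hper' n,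
        mul_one]
      congr 2
      ring
    have hle := infimumI_mul_den_le hf (a := 0) (b := 2 * n + 2) (by linarith) (fun x hx => by
      rcases lt_or_ge x 0 with h | h
      · simp [f, Real.smoothTransition.zero_of_nonpos h.le]
      · have : 2 * n + 2 - x ≤ 0 := by
          by_contra! hc
          exact hx ⟨h, by linarith⟩
        simp [f, Real.smoothTransition.zero_of_nonpos this]) (fun h => by
      have h2 : f 2 = V 2 := f₂ 2 ⟨by norm_num, by linarith⟩
      have h3 := hper 0
      rw [zero_add, mul_one] at h3
      rw [h, h3] at h2
      exact h0.ne h2)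
    have n₁ := num_congr_of_eqOn (toH hg₁) (toH hf) zero_le_one
      fun x hx => f₁ x (Ioo_subset_Icc_self hx)
    have n₂ := num_congr_of_eqOn (toH hV) (toH hf) (by linarith : (1 : ℝ) ≤ 2 * n + 1)
      fun x hx => f₂ x (Ioo_subset_Icc_self hx)
    have n₃ := num_congr_of_eqOn (toH hg₃) ((toH hf).comp_add_right (2 * n)) one_le_two
      fun x hx => f₃ x (Ioo_subset_Icc_self hx)
    have d₁ := den_congr zero_le_one f₁
    have d₂ := den_congr (by linarith : (1 : ℝ) ≤ 2 * n + 1) f₂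
    have d₃ := den_congr one_le_two f₃
    rw [num_add_right] at n₃
    rw [den_add_right] at d₃
    rw [add_comm 1, add_comm 2] at n₃ d₃
    rw [← num_add (toH hf) 0 1, ← num_add (toH hf) 1 (2 * n + 1), ← den_add hf.continuous 0 1,
      ← den_add hf.continuous 1 (2 * n + 1), n₁, n₂, n₃, d₁, d₂, d₃, (mid n).1, (mid n).2] at hle
    calc infimumI * (n * den (-1) 1 V + B) = _ := by simp only [B]; ring
      _ ≤ _ := hle
      _ = _ := by simp only [A]; ring
  -- The main terms are linear in `n` while `A` and `B` are fixed, so a large `n` gives the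
  -- contradiction.
  by_contra! hlt
  have hd : 0 < (infimumI - m) * den (-1) 1 V := mul_pos (by linarith) hD
  obtain ⟨n, hn'⟩ := exists_nat_gt ((A - infimumI * B) / ((infimumI - m) * den (-1) 1 V))
  rw [div_lt_iff₀ hd] at hn'
  have := key (n + 1) (by omega)
  push_cast at this
  linarith

/-! ### Conclusion -/

theorem locMemLp_of_continuous {u : ℝ → ℝ} (hu : Continuous u) (q : ENNReal) : LocMemLp u q := by
  intro K hK
  obtain ⟨C, hC⟩ := hK.exists_bound_of_continuousOn hu.continuousOn
  have : IsFiniteMeasure (volume.restrict K) := ⟨by simpa using hK.measure_lt_top⟩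
  exact MemLp.of_bound hu.aestronglyMeasurable C
    ((ae_restrict_iff' hK.measurableSet).2 (Filter.Eventually.of_forall hC))

theorem mainTheorem2 (T : ℝ) (hT : 0 < T) :
    (∃ u : ℝ → ℝ, ContDiff ℝ ∞ u ∧ u ≠ 0 ∧ Function.Periodic u (2 * T) ∧
      quotientQ (Ico (-T) T) u (iteratedDeriv 2 u) = infimumI) ∧
    ∃ u : ℝ → ℝ, ContDiff ℝ ∞ u ∧ u ≠ 0 ∧ Function.Periodic u (2 * T) ∧
      quotientQ (Ico (-T) T) u (iteratedDeriv 2 u) = infimumI ∧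
      IsPeriodicMinimizer T u (iteratedDeriv 2 u) ∧
      (∀ x, u x ≤ u 0) ∧ 0 < u 0 ∧ deriv u 0 = 0 ∧ deriv u T = 0 ∧
      (∀ x, u (-x) = u x) ∧ StrictAntiOn u (Ioo 0 T) ∧
      (∃ x ∈ Ioo 0 T, ∃ y ∈ Ioo 0 T, 0 < u x ∧ u y < 0) ∧
      ∀ x, iteratedDeriv 4 u x - 2 * iteratedDeriv 2 u x * u x - deriv u x ^ 2 =
        2 * infimumI * |u x| ^ 2 * u x := by
  obtain ⟨m, -, hN, H⟩ := exists_smooth_minimizer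
  -- The constant `m` serves all periods at once, so the upper bound needs a cut-off for one period
  -- only, here with `T = 1`.
  have hI : infimumI = m := by
    refine le_antisymm ?_ (isGLB_infimumI.2 fun q hq => hN.le_lineValues hq)
    obtain ⟨V, h1, h2, h3, -, h4, -⟩ := H 1 one_pos
    exact infimumI_le_of_periodic h1 h2 h4 h3
  obtain ⟨u, hu, hper, hn, hmax, hpos, d0, dT, he, ha, hs, hEL⟩ := H T hT
  have hne : u ≠ 0 := fun h => hpos.ne' (by rw [h]; rfl)
  have hden : 0 < den (-T) T u :=
    den_pos (by linarith) hu.continuous ⟨by linarith, hT.le⟩ hpos.ne'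
  have hq : quotientQ (Ico (-T) T) u (iteratedDeriv 2 u) = infimumI := by
    rw [quotientQ_Ico hT, hn, hI, mul_div_cancel_right₀ _ hden.ne']
  have hu2 : ContDiff ℝ 2 u := contDiff_infty.1 hu 2
  have hadm : PeriodicAdmissible T u (iteratedDeriv 2 u) :=
    ⟨locMemLp_of_continuous hu.continuous 4,
      locMemLp_of_continuous (hu2.continuous_iteratedDeriv 2 le_rfl) 2,
      hasWeakSecondDeriv_of_contDiff hu2, Filter.Eventually.of_forall hper,
      fun h => hne ((hu.continuous.ae_eq_iff_eq volume continuous_const).1 h)⟩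
  refine ⟨⟨u, hu, hne, hper, hq⟩, u, hu, hne, hper, hq, ⟨hadm, fun v z hv => ?_⟩, hmax, hpos, d0,
    dT, he, ha, hs, fun x => by rw [hEL x, hI]⟩
  rw [hq, hI]
  exact hN.le_quotientQ hT hv
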